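/- Let $\mathcal D$ be a strongly self-absorbing $C^*$-algebra, that is, a separable, unital, infinite-dimensional $C^*$-algebra for which there are an isomorphism $\varphi\colon\mathcal D\to\mathcal D\otimes\mathcal D$ and a sequence of unitaries $u_n\in\mathcal D\otimes\mathcal D$ with $u_n(d\otimes 1)u_n^*\to\varphi(d)$ in norm for every $d\in\mathcal D$. Let $A$ be a separable unital $C^*$-algebra (with $1\neq 0$) which is $\mathcal D$-absorbing, that is, $A\otimes\mathcal D\cong A$. (All tensor products are minimal $C^*$-tensor products.) Let $\mathbb T=\{\zeta\in\mathbb C\colon|\zeta|=1\}$ and let $\alpha\colon\mathbb T\to\mathrm{Aut}(A)$ be an action, continuous for the topology of pointwise norm convergence, with the Rokhlin property: for every finite subset $F\subseteq A$ and every $\varepsilon>0$ there is a unitary $u\in A$ such that $\|\alpha_\zeta(u)-\zeta u\|<\varepsilon$ for all $\zeta\in\mathbb T$ and $\|ua-au\|<\varepsilon$ for all $a\in F$. For an integer $n\geq 1$, let $\alpha|_n\colon\mathbb Z_n\to\mathrm{Aut}(A)$, $k\mapsto\alpha_{e^{2\pi i k/n}}$, be the restriction of $\alpha$ to the $n$-th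 roots of unity. Then, for every integer $n\geq 1$, the crossed product $A\rtimes_{\alpha|_n}\mathbb Z_n$ is a unital (with $1\neq0$), separable, $\mathcal D$-absorbing $C^*$-algebra. -/

import Mathlib

open scoped TensorProduct InnerProductSpace
open Filter Topology

universe u

noncomputable section

/-! ### The minimal (spatial) tensor product of two unital C⋆-algebras -/

/-- A (unital) representation of a unital C⋆-algebra on a complex Hilbert space. -/
structure HilbertRep (A : Type u) [CStarAlgebra A] where
  /-- The Hilbert space. -/
  space : Type u
  [normedAddCommGroup : NormedAddCommGroup space]
  [innerProductSpace : InnerProductSpace ℂ space]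
  [completeSpace : CompleteSpace space]
  /-- The representation. -/
  rep : A →⋆ₐ[ℂ] (space →L[ℂ] space)

attribute [instance] HilbertRep.normedAddCommGroup HilbertRep.innerProductSpace
  HilbertRep.completeSpace

section HilbertTensor

variable (H K : Type u) [NormedAddCommGroup H] [InnerProductSpace ℂ H]
  [NormedAddCommGroup K] [InnerProductSpace ℂ K]

/-- The Hilbert space tensor product: the completion of the algebraic tensor product for the inner
product `⟪h ⊗ k, h' ⊗ k'⟫ = ⟪h, h'⟫ ⟪k, k'⟫`. -/
def HilbertTensor : Type u := UniformSpace.Completion (H ⊗[ℂ] K)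

instance : NormedAddCommGroup (HilbertTensor H K) :=
  inferInstanceAs (NormedAddCommGroup (UniformSpace.Completion (H ⊗[ℂ] K)))

instance : InnerProductSpace ℂ (HilbertTensor H K) :=
  inferInstanceAs (InnerProductSpace ℂ (UniformSpace.Completion (H ⊗[ℂ] K)))

instance : CompleteSpace (HilbertTensor H K) :=
  inferInstanceAs (CompleteSpace (UniformSpace.Completion (H ⊗[ℂ] K)))

variable {H K}

/-- The elementary tensor `h ⊗ k`. -/
def HilbertTensor.tmul (h : H) (k : K) : HilbertTensor H K :=
  ((h ⊗ₜ[ℂ] k : H ⊗[ℂ] K) : UniformSpace.Completion (H ⊗[ℂ] K))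

/-- The tensor product `S ⊗ T` of two bounded operators. -/
def HilbertTensor.map (S : H →L[ℂ] H) (T : K →L[ℂ] K) :
    HilbertTensor H K →L[ℂ] HilbertTensor H K :=
  (TensorProduct.mapL S T).completion

theorem HilbertTensor.map_tmul (S : H →L[ℂ] H) (T : K →L[ℂ] K) (h : H) (k : K) :
    HilbertTensor.map S T (.tmul h k) = .tmul (S h) (T k) := by
  refine (ContinuousLinearMap.completion_apply_coe _ _).trans ?_
  simp [HilbertTensor.tmul]

theorem HilbertTensor.inner_tmul (h h' : H) (k k' : K) :
    ⟪HilbertTensor.tmul h k, HilbertTensor.tmul h' k'⟫_ℂ = ⟪h, h'⟫_ℂ * ⟪k, k'⟫_ℂ :=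
  (UniformSpace.Completion.inner_coe _ _).trans (TensorProduct.inner_tmul ..)

theorem HilbertTensor.ext {E : Type*} [NormedAddCommGroup E] [NormedSpace ℂ E]
    {S T : HilbertTensor H K →L[ℂ] E}
    (hST : ∀ h k, S (.tmul h k) = T (.tmul h k)) : S = T := by
  have key : ∀ z : H ⊗[ℂ] K, S (z : UniformSpace.Completion (H ⊗[ℂ] K)) =
      T (z : UniformSpace.Completion (H ⊗[ℂ] K)) := by
    intro z
    induction z with
    | zero =>
      rw [UniformSpace.Completion.coe_zero]
      exact (map_zero S).trans (map_zero T).symm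
    | add x y hx hy =>
      rw [UniformSpace.Completion.coe_add]
      exact (map_add S _ _).trans ((congrArg₂ _ hx hy).trans (map_add T _ _).symm)
    | tmul h k => exact hST h k
  ext x
  exact UniformSpace.Completion.induction_on (p := fun x => S x = T x) x
    (isClosed_eq S.continuous T.continuous) key

theorem HilbertTensor.norm_map_le (S : H →L[ℂ] H) (T : K →L[ℂ] K) :
    ‖HilbertTensor.map S T‖ ≤ ‖S‖ * ‖T‖ := by
  refine ContinuousLinearMap.opNorm_le_bound _ (by positivity) fun x => ?_
  refine UniformSpace.Completion.induction_on
    (p := fun x => ‖HilbertTensor.map S T x‖ ≤ ‖S‖ * ‖T‖ * ‖(x : HilbertTensor H K)‖) x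
    (isClosed_le (by fun_prop) (by fun_prop)) fun z => ?_
  have h1 : HilbertTensor.map S T (z : UniformSpace.Completion (H ⊗[ℂ] K)) =
      ((TensorProduct.mapL S T z : H ⊗[ℂ] K) : UniformSpace.Completion (H ⊗[ℂ] K)) :=
    ContinuousLinearMap.completion_apply_coe _ _
  rw [h1]
  refine (UniformSpace.Completion.norm_coe _).trans_le ?_
  refine (ContinuousLinearMap.le_of_opNorm_le _ (TensorProduct.norm_mapL_le S T) z).trans_eq ?_
  exact congrArg _ (UniformSpace.Completion.norm_coe z).symm

theorem HilbertTensor.tmul_add (h : H) (k k' : K) :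
    HilbertTensor.tmul h (k + k') = .tmul h k + .tmul h k' :=
  (congrArg _ (TensorProduct.tmul_add h k k')).trans (UniformSpace.Completion.coe_add _ _)

theorem HilbertTensor.add_tmul (h h' : H) (k : K) :
    HilbertTensor.tmul (h + h') k = .tmul h k + .tmul h' k :=
  (congrArg _ (TensorProduct.add_tmul h h' k)).trans (UniformSpace.Completion.coe_add _ _)

theorem HilbertTensor.smul_tmul (c : ℂ) (h : H) (k : K) :
    HilbertTensor.tmul (c • h) k = c • .tmul h k :=
  (congrArg _ (TensorProduct.smul_tmul' c h k).symm).trans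
    (UniformSpace.Completion.coe_smul _ _)

theorem HilbertTensor.tmul_smul (c : ℂ) (h : H) (k : K) :
    HilbertTensor.tmul h (c • k) = c • .tmul h k :=
  (congrArg _ (TensorProduct.tmul_smul c h k)).trans
    (UniformSpace.Completion.coe_smul _ _)

theorem HilbertTensor.star_map [CompleteSpace H] [CompleteSpace K]
    (S : H →L[ℂ] H) (T : K →L[ℂ] K) :
    star (HilbertTensor.map S T) = HilbertTensor.map (star S) (star T) := by
  refine HilbertTensor.ext fun h k => ?_
  have key : innerSL ℂ (star (HilbertTensor.map S T) (.tmul h k)) =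
      innerSL ℂ (HilbertTensor.map (star S) (star T) (.tmul h k)) := by
    refine HilbertTensor.ext fun h' k' => ?_
    simp only [innerSL_apply_apply, ContinuousLinearMap.star_eq_adjoint,
      ContinuousLinearMap.adjoint_inner_left, HilbertTensor.map_tmul, HilbertTensor.inner_tmul]
  exact ext_inner_right ℂ fun x => congrArg (fun f => f x) key

end HilbertTensor

section Spatial

variable {A D : Type u} [CStarAlgebra A] [CStarAlgebra D]

/-- The representation `a ↦ π(a) ⊗ 1` on `H ⊗ K`. -/
def HilbertRep.tensorLeft (π : HilbertRep A) (K : Type u) [NormedAddCommGroup K]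
    [InnerProductSpace ℂ K] :
    A →ₐ[ℂ] (HilbertTensor π.space K →L[ℂ] HilbertTensor π.space K) :=
  AlgHom.ofLinearMap
    { toFun := fun a => HilbertTensor.map (π.rep a) 1
      map_add' := fun a b => HilbertTensor.ext fun h k => by
        simp [HilbertTensor.map_tmul, HilbertTensor.add_tmul]
      map_smul' := fun c a => HilbertTensor.ext fun h k => by
        simp [HilbertTensor.map_tmul, HilbertTensor.smul_tmul] }
    (HilbertTensor.ext fun h k => by simp [HilbertTensor.map_tmul])
    (fun a b => HilbertTensor.ext fun h k => by simp [HilbertTensor.map_tmul])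

/-- The representation `d ↦ 1 ⊗ ρ(d)` on `H ⊗ K`. -/
def HilbertRep.tensorRight (H : Type u) [NormedAddCommGroup H] [InnerProductSpace ℂ H]
    (ρ : HilbertRep D) :
    D →ₐ[ℂ] (HilbertTensor H ρ.space →L[ℂ] HilbertTensor H ρ.space) :=
  AlgHom.ofLinearMap
    { toFun := fun d => HilbertTensor.map 1 (ρ.rep d)
      map_add' := fun a b => HilbertTensor.ext fun h k => by
        simp [HilbertTensor.map_tmul, HilbertTensor.tmul_add]
      map_smul' := fun c a => HilbertTensor.ext fun h k => by
        simp [HilbertTensor.map_tmul, HilbertTensor.tmul_smul] }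
    (HilbertTensor.ext fun h k => by simp [HilbertTensor.map_tmul])
    (fun a b => HilbertTensor.ext fun h k => by simp [HilbertTensor.map_tmul])

theorem HilbertRep.commute_tensor (π : HilbertRep A) (ρ : HilbertRep D) (a : A) (d : D) :
    Commute (π.tensorLeft ρ.space a) (ρ.tensorRight π.space d) :=
  HilbertTensor.ext fun h k => by
    simp [HilbertRep.tensorLeft, HilbertRep.tensorRight, HilbertTensor.map_tmul]

/-- The tensor product `π ⊗ ρ` of two representations, as a representation of the algebraic tensor
product on the Hilbert space tensor product. It sends `a ⊗ d` to `π(a) ⊗ ρ(d)`. -/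
def HilbertRep.tensor (π : HilbertRep A) (ρ : HilbertRep D) :
    A ⊗[ℂ] D →ₐ[ℂ]
      (HilbertTensor π.space ρ.space →L[ℂ] HilbertTensor π.space ρ.space) :=
  Algebra.TensorProduct.lift (π.tensorLeft ρ.space) (ρ.tensorRight π.space) (π.commute_tensor ρ)

theorem HilbertRep.tensor_tmul (π : HilbertRep A) (ρ : HilbertRep D) (a : A) (d : D) :
    π.tensor ρ (a ⊗ₜ d) = HilbertTensor.map (π.rep a) (ρ.rep d) := by
  rw [HilbertRep.tensor, Algebra.TensorProduct.lift_tmul]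
  exact HilbertTensor.ext fun h k => by
    simp [HilbertRep.tensorLeft, HilbertRep.tensorRight, HilbertTensor.map_tmul]

theorem HilbertRep.tensor_star (π : HilbertRep A) (ρ : HilbertRep D) (z : A ⊗[ℂ] D) :
    π.tensor ρ (star z) = star (π.tensor ρ z) := by
  induction z with
  | zero => simp
  | add x y hx hy => simp [hx, hy]
  | tmul a d =>
    simp [TensorProduct.star_tmul, HilbertRep.tensor_tmul, HilbertTensor.star_map, map_star]

/-- The spatial C⋆-seminorm on the algebraic tensor product: the supremum of `‖(π ⊗ ρ)(z)‖` over
all representations `π` of `A` and `ρ` of `D`. -/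
def spatialNorm (z : A ⊗[ℂ] D) : ℝ :=
  ⨆ p : HilbertRep A × HilbertRep D, ‖p.1.tensor p.2 z‖

theorem spatialNorm_bddAbove (z : A ⊗[ℂ] D) :
    BddAbove (Set.range fun p : HilbertRep A × HilbertRep D => ‖p.1.tensor p.2 z‖) := by
  suffices h : ∃ C : ℝ, ∀ p : HilbertRep A × HilbertRep D, ‖p.1.tensor p.2 z‖ ≤ C by
    obtain ⟨C, hC⟩ := h
    exact ⟨C, by rintro _ ⟨p, rfl⟩; exact hC p⟩
  induction z with
  | zero => exact ⟨0, fun p => by simp⟩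
  | add x y hx hy =>
    obtain ⟨C, hC⟩ := hx
    obtain ⟨C', hC'⟩ := hy
    exact ⟨C + C', fun p => by
      rw [map_add]; exact (norm_add_le _ _).trans (add_le_add (hC p) (hC' p))⟩
  | tmul a d =>
    refine ⟨‖a‖ * ‖d‖, fun p => ?_⟩
    rw [HilbertRep.tensor_tmul]
    refine (HilbertTensor.norm_map_le _ _).trans ?_
    gcongr
    · exact NonUnitalStarAlgHom.norm_apply_le p.1.rep a
    · exact NonUnitalStarAlgHom.norm_apply_le p.2.rep d

theorem le_spatialNorm (p : HilbertRep A × HilbertRep D) (z : A ⊗[ℂ] D) :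
    ‖p.1.tensor p.2 z‖ ≤ spatialNorm z :=
  le_ciSup (spatialNorm_bddAbove z) p

theorem spatialNorm_nonneg (z : A ⊗[ℂ] D) : 0 ≤ spatialNorm z :=
  Real.iSup_nonneg fun _ => norm_nonneg _

theorem spatialNorm_zero : spatialNorm (0 : A ⊗[ℂ] D) = 0 := by
  simp [spatialNorm]

theorem spatialNorm_neg (z : A ⊗[ℂ] D) : spatialNorm (-z) = spatialNorm z := by
  simp [spatialNorm]

theorem spatialNorm_star (z : A ⊗[ℂ] D) : spatialNorm (star z) = spatialNorm z := by
  simp [spatialNorm, HilbertRep.tensor_star]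

theorem spatialNorm_add_le (y z : A ⊗[ℂ] D) :
    spatialNorm (y + z) ≤ spatialNorm y + spatialNorm z := by
  refine Real.iSup_le (fun p => ?_) (add_nonneg (spatialNorm_nonneg y) (spatialNorm_nonneg z))
  rw [map_add]
  exact (norm_add_le _ _).trans (add_le_add (le_spatialNorm p y) (le_spatialNorm p z))

theorem spatialNorm_mul_le (y z : A ⊗[ℂ] D) :
    spatialNorm (y * z) ≤ spatialNorm y * spatialNorm z := by
  refine Real.iSup_le (fun p => ?_) (mul_nonneg (spatialNorm_nonneg y) (spatialNorm_nonneg z))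
  rw [map_mul]
  exact (norm_mul_le _ _).trans
    (mul_le_mul (le_spatialNorm p y) (le_spatialNorm p z) (norm_nonneg _) (spatialNorm_nonneg y))

theorem spatialNorm_smul_le (c : ℂ) (z : A ⊗[ℂ] D) :
    spatialNorm (c • z) ≤ ‖c‖ * spatialNorm z := by
  refine Real.iSup_le (fun p => ?_) (mul_nonneg (norm_nonneg c) (spatialNorm_nonneg z))
  rw [map_smul, norm_smul]
  exact mul_le_mul_of_nonneg_left (le_spatialNorm p z) (norm_nonneg c)

theorem tensor_star_mul (y z : A ⊗[ℂ] D) : star (y * z) = star z * star y := by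
  induction y with
  | zero => simp
  | add y y' hy hy' => simp [add_mul, mul_add, hy, hy']
  | tmul a d =>
    induction z with
    | zero => simp
    | add z z' hz hz' => simp [add_mul, mul_add, hz, hz']
    | tmul b e => simp [TensorProduct.star_tmul]

theorem spatialNorm_mul_self_le (z : A ⊗[ℂ] D) :
    spatialNorm z * spatialNorm z ≤ spatialNorm (star z * z) := by
  have h : spatialNorm z ≤ √(spatialNorm (star z * z)) := by
    refine Real.iSup_le (fun p => Real.le_sqrt_of_sq_le ?_) (Real.sqrt_nonneg _)
    rw [sq, ← CStarRing.norm_star_mul_self, ← HilbertRep.tensor_star, ← map_mul]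
    exact le_spatialNorm p _
  exact (mul_self_le_mul_self (spatialNorm_nonneg z) h).trans_eq
    (Real.mul_self_sqrt (spatialNorm_nonneg _))

variable (A D) in
/-- The algebraic tensor product `A ⊗ D`, equipped with the spatial C⋆-seminorm. -/
def SpatialAlg : Type u := A ⊗[ℂ] D

instance : Ring (SpatialAlg A D) := inferInstanceAs (Ring (A ⊗[ℂ] D))

instance : Algebra ℂ (SpatialAlg A D) := inferInstanceAs (Algebra ℂ (A ⊗[ℂ] D))

instance : StarRing (SpatialAlg A D) where
  star z := Star.star (R := A ⊗[ℂ] D) z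
  star_involutive z := star_star (R := A ⊗[ℂ] D) z
  star_mul y z := tensor_star_mul (A := A) (D := D) y z
  star_add y z := star_add (R := A ⊗[ℂ] D) y z

instance : StarModule ℂ (SpatialAlg A D) where
  star_smul c z := star_smul (A := A ⊗[ℂ] D) c z

instance : SeminormedRing (SpatialAlg A D) :=
  RingSeminorm.toSeminormedRing
    { toFun := fun z => spatialNorm (A := A) (D := D) z
      map_zero' := spatialNorm_zero
      add_le' := spatialNorm_add_le
      neg' := spatialNorm_neg
      mul_le' := spatialNorm_mul_le }

theorem SpatialAlg.norm_def (z : SpatialAlg A D) :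
    ‖z‖ = spatialNorm (A := A) (D := D) z := rfl

instance : NormedAlgebra ℂ (SpatialAlg A D) where
  norm_smul_le c z := spatialNorm_smul_le (A := A) (D := D) c z

instance : NormedStarGroup (SpatialAlg A D) where
  norm_star_le z := (spatialNorm_star (A := A) (D := D) z).le

variable (A D) in
/-- The minimal (spatial) tensor product of two unital C⋆-algebras: the completion of the
algebraic tensor product in the spatial norm. -/
def MinTensor : Type u := UniformSpace.Completion (SpatialAlg A D)

namespace MinTensor

instance : NormedRing (MinTensor A D) :=
  inferInstanceAs (NormedRing (UniformSpace.Completion (SpatialAlg A D)))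

instance : Algebra ℂ (MinTensor A D) :=
  inferInstanceAs (Algebra ℂ (UniformSpace.Completion (SpatialAlg A D)))

instance : CompleteSpace (MinTensor A D) :=
  inferInstanceAs (CompleteSpace (UniformSpace.Completion (SpatialAlg A D)))

instance : NormedAlgebra ℂ (MinTensor A D) where
  norm_smul_le c x := norm_smul_le (β := UniformSpace.Completion (SpatialAlg A D)) c x

/-- The canonical map from the algebraic tensor product to the minimal tensor product. -/
def ofAlg : SpatialAlg A D →ₐ[ℂ] MinTensor A D where
  toFun z := (z : UniformSpace.Completion (SpatialAlg A D))
  map_one' := UniformSpace.Completion.coe_one _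
  map_mul' := UniformSpace.Completion.coe_mul
  map_zero' := UniformSpace.Completion.coe_zero
  map_add' := UniformSpace.Completion.coe_add
  commutes' _ := rfl

theorem norm_ofAlg (z : SpatialAlg A D) : ‖ofAlg z‖ = ‖z‖ :=
  UniformSpace.Completion.norm_coe z

theorem denseRange_ofAlg : DenseRange (ofAlg : SpatialAlg A D → MinTensor A D) :=
  UniformSpace.Completion.denseRange_coe

/-- The involution, extended by continuity from the algebraic tensor product. -/
instance : Star (MinTensor A D) where
  star := UniformSpace.Completion.map (star : SpatialAlg A D → SpatialAlg A D)

theorem continuous_star' : Continuous (star : MinTensor A D → MinTensor A D) :=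
  UniformSpace.Completion.continuous_map

theorem star_ofAlg (z : SpatialAlg A D) : star (ofAlg z) = ofAlg (star z) :=
  UniformSpace.Completion.map_coe
    star_isometry.uniformContinuous z

theorem induction_on {p : MinTensor A D → Prop} (x : MinTensor A D)
    (hp : IsClosed {x | p x}) (h : ∀ z, p (ofAlg z)) : p x :=
  UniformSpace.Completion.induction_on x hp h

instance : StarRing (MinTensor A D) where
  star_involutive x := by
    refine induction_on (p := fun x => star (star x) = x) x (isClosed_eq ?_ continuous_id)
      fun z => ?_
    · exact continuous_star'.comp continuous_star'
    · rw [star_ofAlg, star_ofAlg, star_star]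
  star_mul x y := by
    refine induction_on (p := fun x => star (x * y) = star y * star x) x (isClosed_eq ?_ ?_)
      fun z => ?_
    · exact continuous_star'.comp (continuous_id.mul continuous_const)
    · exact continuous_const.mul continuous_star'
    refine induction_on (p := fun y => star (ofAlg z * y) = star y * star (ofAlg z)) y
      (isClosed_eq ?_ ?_) fun w => ?_
    · exact continuous_star'.comp (continuous_const.mul continuous_id)
    · exact continuous_star'.mul continuous_const
    rw [← map_mul, star_ofAlg, star_ofAlg, star_ofAlg, star_mul, map_mul]
  star_add x y := by
    refine induction_on (p := fun x => star (x + y) = star x + star y) x (isClosed_eq ?_ ?_)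
      fun z => ?_
    · exact continuous_star'.comp (continuous_id.add continuous_const)
    · exact continuous_star'.add continuous_const
    refine induction_on (p := fun y => star (ofAlg z + y) = star (ofAlg z) + star y) y
      (isClosed_eq ?_ ?_) fun w => ?_
    · exact continuous_star'.comp (continuous_const.add continuous_id)
    · exact continuous_const.add continuous_star'
    rw [← map_add, star_ofAlg, star_ofAlg, star_ofAlg, star_add, map_add]

instance : StarModule ℂ (MinTensor A D) where
  star_smul c x := by
    refine induction_on (p := fun x => star (c • x) = star c • star x) x (isClosed_eq ?_ ?_)
      fun z => ?_
    · exact continuous_star'.comp (continuous_const_smul c)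
    · exact (continuous_star' (A := A) (D := D)).const_smul (star c)
    rw [← map_smul, star_ofAlg, star_ofAlg, star_smul, map_smul]

instance : CStarRing (MinTensor A D) where
  norm_mul_self_le x := by
    refine induction_on (p := fun x => ‖x‖ * ‖x‖ ≤ ‖star x * x‖) x (isClosed_le ?_ ?_)
      fun z => ?_
    · exact continuous_norm.mul continuous_norm
    · exact continuous_norm.comp (continuous_star'.mul continuous_id)
    rw [star_ofAlg, ← map_mul, norm_ofAlg, norm_ofAlg]
    exact spatialNorm_mul_self_le (A := A) (D := D) z

instance : CStarAlgebra (MinTensor A D) where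

/-- The elementary tensor `a ⊗ d` in the minimal tensor product. -/
def tmul (a : A) (d : D) : MinTensor A D := ofAlg (a ⊗ₜ[ℂ] d : A ⊗[ℂ] D)

variable (A D) in
/-- The first-factor embedding `a ↦ a ⊗ 1`. -/
def inl : A →⋆ₐ[ℂ] MinTensor A D where
  toFun a := tmul a 1
  map_one' := map_one ofAlg
  map_mul' a b := by
    refine Eq.trans ?_ (map_mul ofAlg _ _)
    refine congrArg ofAlg (Eq.trans ?_ (Algebra.TensorProduct.tmul_mul_tmul a b (1 : D) 1).symm)
    rw [one_mul]
  map_zero' := (congrArg ofAlg (TensorProduct.zero_tmul A (1 : D))).trans (map_zero ofAlg)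
  map_add' a b := (congrArg ofAlg (TensorProduct.add_tmul a b (1 : D))).trans (map_add ofAlg _ _)
  commutes' c := by
    refine Eq.trans ?_ (AlgHom.commutes ofAlg c)
    rfl
  map_star' a := by
    refine Eq.trans ?_ (star_ofAlg _).symm
    refine congrArg ofAlg (Eq.trans ?_ (TensorProduct.star_tmul a (1 : D)).symm)
    rw [star_one]

end MinTensor

end Spatial

/-! ### Strongly self-absorbing C⋆-algebras -/

section SelfAbsorbing

/-- Two unital ⋆-homomorphisms `φ, ψ : A → B` are approximately unitarily equivalent if there are
unitaries `uₙ` in `B` such that `uₙ φ(a) uₙ* → ψ(a)` for every `a`. (This is the sequential form,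
used for separable `A`.) -/
def ApproxUnitarilyEquivalent {A B : Type u} [CStarAlgebra A] [CStarAlgebra B]
    (φ ψ : A →⋆ₐ[ℂ] B) : Prop :=
  ∃ w : ℕ → unitary B, ∀ a : A,
    Tendsto (fun n => (w n : B) * φ a * star (w n : B)) atTop (𝓝 (ψ a))

/-- A unital separable C⋆-algebra `D` is strongly self-absorbing if it is infinite-dimensional and
`d ↦ d ⊗ 1` is approximately unitarily equivalent to an isomorphism `D → D ⊗ D`. -/
structure IsStronglySelfAbsorbing (D : Type u) [CStarAlgebra D] : Prop where
  separable : TopologicalSpace.SeparableSpace D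
  infinite_dimensional : ¬ FiniteDimensional ℂ D
  exists_equiv : ∃ φ : D ≃⋆ₐ[ℂ] MinTensor D D,
    ApproxUnitarilyEquivalent (MinTensor.inl D D) (φ : D →⋆ₐ[ℂ] MinTensor D D)

/-- `A` is `D`-absorbing if `A ⊗ D` is isomorphic to `A`. -/
def IsAbsorbing (D A : Type u) [CStarAlgebra D] [CStarAlgebra A] : Prop :=
  Nonempty (MinTensor A D ≃⋆ₐ[ℂ] A)

end SelfAbsorbing

/-! ### Crossed products by finite groups -/

section CrossedProduct

variable {A : Type u} [CStarAlgebra A] {G : Type} [Group G] [Fintype G] [DecidableEq G]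

attribute [local instance] CStarAlgebra.spectralOrder CStarAlgebra.spectralOrderedRing

/-- The canonical copy of `a ∈ A` in the regular representation of `(A, G, α)` on `⊕_G A`: the
diagonal matrix with entries `α_{g⁻¹}(a)`. -/
def crossedDiag (α : G →* (A ≃⋆ₐ[ℂ] A)) (a : A) : CStarMatrix G G A :=
  CStarMatrix.ofMatrix (Matrix.diagonal fun g => α g⁻¹ a)

variable (A) in
/-- The canonical unitary implementing `s ∈ G`: the permutation matrix of left translation by `s`
on `⊕_G A`. -/
def crossedUnitary (s : G) : CStarMatrix G G A :=
  CStarMatrix.ofMatrix (Matrix.of fun g h => if g = s * h then 1 else 0)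

/-- The C⋆-algebra generated by `A` and the canonical unitaries, acting on `⊕_G A`. -/
def crossedSubalgebra (α : G →* (A ≃⋆ₐ[ℂ] A)) : StarSubalgebra ℂ (CStarMatrix G G A) :=
  (StarAlgebra.adjoin ℂ
    (Set.range (crossedDiag α) ∪ Set.range (crossedUnitary A (G := G)))).topologicalClosure

/-- The crossed product `A ⋊_α G` of a unital C⋆-algebra by an action of a finite group, realized
through the regular representation. (The group being finite, the full and the reduced crossed
products agree.) -/
def CrossedProduct (α : G →* (A ≃⋆ₐ[ℂ] A)) : Type u := crossedSubalgebra α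

instance (α : G →* (A ≃⋆ₐ[ℂ] A)) : CStarAlgebra (CrossedProduct α) :=
  haveI : IsClosed (crossedSubalgebra α : Set (CStarMatrix G G A)) :=
    StarSubalgebra.isClosed_topologicalClosure _
  inferInstanceAs (CStarAlgebra (crossedSubalgebra α))

end CrossedProduct

/-! ### Circle actions -/

section CircleActions

variable {A : Type u} [CStarAlgebra A]

/-- A homomorphism from the circle to `Aut(A)` is a continuous action if it is continuous for the
topology of pointwise norm convergence. -/
def IsContinuousAction (α : Circle →* (A ≃⋆ₐ[ℂ] A)) : Prop :=
  ∀ a : A, Continuous fun ζ : Circle => α ζ a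

/-- The Rokhlin property for a circle action. -/
def HasRokhlinProperty (α : Circle →* (A ≃⋆ₐ[ℂ] A)) : Prop :=
  ∀ (F : Finset A) (ε : ℝ), 0 < ε → ∃ w ∈ unitary A,
    (∀ ζ : Circle, ‖α ζ w - (ζ : ℂ) • w‖ < ε) ∧ ∀ a ∈ F, ‖w * a - a * w‖ < ε

/-- The restriction of a circle action to the cyclic group `ℤ/n`, identified with the `n`-th roots
of unity through `k ↦ exp(2πik/n)`. -/
def restrictCyclic (α : Circle →* (A ≃⋆ₐ[ℂ] A)) (n : ℕ) [NeZero n] :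
    Multiplicative (ZMod n) →* (A ≃⋆ₐ[ℂ] A) :=
  α.comp (ZMod.toCircle (N := n)).toMonoidHom

end CircleActions

end

/-! Write `B` for the crossed product. By one-sided approximate intertwining
(`nonempty_starAlgEquiv_of_intertwining`), `B` absorbs `D` once `b ↦ b ⊗ 1` is injective and there
are unitaries of `B ⊗ D` which almost commute with `B ⊗ 1` and conjugate given finite sets of `B ⊗
D` almost into `B ⊗ 1`. They are taken as images of unitaries `w ∈ A ⊗ D` which almost commute with
`A ⊗ 1`, for which `w* (1 ⊗ d) w` is near `A ⊗ 1`, and which are almost fixed by `α ⊗ id` on `ℤ/n`.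
The last property says that the image of `w` almost commutes with the implementing unitaries of `B`.

Without invariance such unitaries come from `D` alone. Strong self-absorption gives an approximately
inner half flip, `w₀ (d ⊗ 1) w₀* ≈ 1 ⊗ d`, and `A ≅ A ⊗ D` contains asymptotically central unital
copies `ψₖ(D)`. The unitary `v = (ψₖ ⊗ id)(w₀)` then almost commutes with `A ⊗ 1` and satisfies `v*
(1 ⊗ d) v ≈ ψₖ(d) ⊗ 1`.

The Rokhlin property makes `v` invariant by averaging. For a Rokhlin unitary `u` and `ω =
exp(2πi/N)`, the windows `gₖ(u)` concentrate where `u` is near `ωᵏ` and satisfy `∑ gₖ* gₖ = 1`. The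
map `x ↦ ∑ gₖ* α_{ω⁻ᵏ}(x) gₖ` is unital and contractive, and `α_{ωᶜ}` almost permutes its summands
because it almost rotates `u` by `ωᶜ`. It is also asymptotically multiplicative
(`exists_norm_rokhlinAverage_mul_sub_lt`): the defect for `x y` is controlled by the oscillation of
`α_ζ(y)` between overlapping windows, and the overlap weighted by `|ωᵏ - ωˡ|²` is `O(1/N)`
(`norm_spread_le`). So the average of `v` is almost unitary, and its polar part is the required `w`
(`exists_almost_invariant_unitary`).

Injectivity of `b ↦ b ⊗ 1` needs separating representations. The spatial norm is defined by
representations, so `A ≅ A ⊗ D` has enough of them; the GNS construction carries them over to `B`.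
-/

namespace MinTensor

/-! ### Elementary tensors and extension of maps to the minimal tensor product -/

section Basic

variable {A B C D : Type u} [CStarAlgebra A] [CStarAlgebra B] [CStarAlgebra C] [CStarAlgebra D]

theorem tmul_mul_tmul (a b : A) (d e : D) :
    tmul a d * tmul b e = tmul (a * b) (d * e) := by
  refine (map_mul ofAlg _ _).symm.trans (congrArg ofAlg ?_)
  exact Algebra.TensorProduct.tmul_mul_tmul a b d e

theorem star_tmul (a : A) (d : D) : star (tmul a d) = tmul (star a) (star d) :=
  (star_ofAlg _).trans (congrArg ofAlg (TensorProduct.star_tmul a d))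

theorem one_tmul_one : tmul (1 : A) (1 : D) = 1 := map_one ofAlg

theorem tmul_smul (c : ℂ) (a : A) (d : D) : tmul a (c • d) = c • tmul a d :=
  (congrArg ofAlg (TensorProduct.tmul_smul c a d)).trans (map_smul ofAlg c _)

theorem tmul_add (a : A) (d e : D) : tmul a (d + e) = tmul a d + tmul a e :=
  (congrArg ofAlg (TensorProduct.tmul_add a d e)).trans (map_add ofAlg _ _)

theorem tmul_zero (a : A) : tmul a (0 : D) = 0 :=
  (congrArg ofAlg (TensorProduct.tmul_zero D a)).trans (map_zero ofAlg)

theorem inl_apply (a : A) : inl A D a = tmul a 1 := rfl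

variable (A D) in
/-- The second-factor embedding `d ↦ 1 ⊗ d`. -/
noncomputable def inr : D →⋆ₐ[ℂ] MinTensor A D where
  toFun d := tmul 1 d
  map_one' := one_tmul_one
  map_mul' d e := by rw [tmul_mul_tmul, one_mul]
  map_zero' := tmul_zero 1
  map_add' d e := tmul_add 1 d e
  commutes' c := by
    rw [Algebra.algebraMap_eq_smul_one, Algebra.algebraMap_eq_smul_one, tmul_smul, one_tmul_one]
  map_star' d := by rw [star_tmul, star_one]

theorem inr_apply (d : D) : inr A D d = tmul 1 d := rfl

theorem inl_mul_inr (a : A) (d : D) : inl A D a * inr A D d = tmul a d := by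
  rw [inl_apply, inr_apply, tmul_mul_tmul, mul_one, one_mul]

theorem inr_mul_inl (a : A) (d : D) : inr A D d * inl A D a = tmul a d := by
  rw [inl_apply, inr_apply, tmul_mul_tmul, mul_one, one_mul]

/-- A closed additive property of the elementary tensors holds on the minimal tensor product. -/
theorem induction_tmul {p : MinTensor A D → Prop} (x : MinTensor A D)
    (hp : IsClosed {x | p x}) (h0 : p 0) (hadd : ∀ x y, p x → p y → p (x + y))
    (ht : ∀ a d, p (tmul a d)) : p x := by
  refine induction_on x hp fun z => ?_
  refine TensorProduct.induction_on (motive := fun z => p (ofAlg (z : SpatialAlg A D))) z ?_ ht ?_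
  · exact (map_zero (ofAlg (A := A) (D := D))).symm ▸ h0
  · intro x y hx hy
    exact (map_add (ofAlg (A := A) (D := D)) x y).symm ▸ hadd _ _ hx hy

theorem norm_inl_le (a : A) : ‖inl A D a‖ ≤ ‖a‖ := NonUnitalStarAlgHom.norm_apply_le _ a

theorem norm_inr_le (d : D) : ‖inr A D d‖ ≤ ‖d‖ := NonUnitalStarAlgHom.norm_apply_le _ d

/-- A contractive `⋆`-homomorphism on the algebraic tensor product extends to the minimal tensor
product. -/
noncomputable def lift (f : SpatialAlg A D →ₐ[ℂ] C) (hn : ∀ z, ‖f z‖ ≤ ‖z‖)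
    (hs : ∀ z, f (star z) = star (f z)) : MinTensor A D →⋆ₐ[ℂ] C :=
  have hc : Continuous f := AddMonoidHomClass.continuous_of_bound f 1 (by simpa using hn)
  let F : MinTensor A D →+* C := UniformSpace.Completion.extensionHom f.toRingHom hc
  have hF : Continuous F := UniformSpace.Completion.continuous_extension
  have hFz : ∀ z, F (ofAlg z) = f z := fun z =>
    UniformSpace.Completion.extensionHom_coe f.toRingHom hc z
  { F with
    commutes' := fun c => by
      have := hFz (algebraMap ℂ _ c)
      rw [AlgHom.commutes, AlgHom.commutes] at this
      exact this
    map_star' := fun x => by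
      refine induction_on (p := fun x => F (star x) = star (F x)) x
        (isClosed_eq (hF.comp continuous_star') (continuous_star.comp hF)) fun z => ?_
      rw [star_ofAlg, hFz, hFz, hs] }

theorem lift_ofAlg (f : SpatialAlg A D →ₐ[ℂ] C) (hn : ∀ z, ‖f z‖ ≤ ‖z‖)
    (hs : ∀ z, f (star z) = star (f z)) (z : SpatialAlg A D) : lift f hn hs (ofAlg z) = f z :=
  UniformSpace.Completion.extensionHom_coe f.toRingHom
    (AddMonoidHomClass.continuous_of_bound f 1 (by simpa using hn)) z

theorem continuous_starAlgHom (f : A →⋆ₐ[ℂ] B) : Continuous f :=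
  AddMonoidHomClass.continuous_of_bound f 1
    (by simpa using fun x => NonUnitalStarAlgHom.norm_apply_le f x)

theorem hom_ext {f g : MinTensor A D →⋆ₐ[ℂ] C}
    (h : ∀ a d, f (tmul a d) = g (tmul a d)) : f = g := by
  ext x
  refine induction_tmul (p := fun x => f x = g x) x
    (isClosed_eq (continuous_starAlgHom f) (continuous_starAlgHom g)) ?_ ?_ h
  · rw [map_zero, map_zero]
  · intro x y hx hy
    rw [map_add, map_add, hx, hy]

end Basic

end MinTensor

/-- The restriction of a representation along a `⋆`-homomorphism. -/
noncomputable def HilbertRep.comp {A B : Type u} [CStarAlgebra A] [CStarAlgebra B]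
    (π : HilbertRep B) (f : A →⋆ₐ[ℂ] B) : HilbertRep A where
  space := π.space
  rep := π.rep.comp f

namespace MinTensor

/-! ### Functoriality, the flip and faithfulness of the minimal tensor product -/

section Functor

variable {A B C D : Type u} [CStarAlgebra A] [CStarAlgebra B] [CStarAlgebra C] [CStarAlgebra D]

/-- Pulling representations back along `f` and `g` gives only some of the representations over which
the supremum on the right is taken. -/
theorem spatialNorm_map_le (f : A →⋆ₐ[ℂ] B) (g : D →⋆ₐ[ℂ] C) (z : A ⊗[ℂ] D) :
    spatialNorm (Algebra.TensorProduct.map f.toAlgHom g.toAlgHom z) ≤ spatialNorm z := by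
  refine Real.iSup_le (fun p => ?_) (spatialNorm_nonneg z)
  refine le_trans (le_of_eq (congrArg _ ?_)) (le_spatialNorm (p.1.comp f, p.2.comp g) z)
  induction z with
  | zero => exact (congrArg _ (map_zero _)).trans ((map_zero _).trans (map_zero _).symm)
  | add x y hx hy =>
    rw [map_add, map_add, hx, hy]
    exact (map_add _ _ _).symm
  | tmul a d =>
    rw [Algebra.TensorProduct.map_tmul, HilbertRep.tensor_tmul]
    exact (HilbertRep.tensor_tmul (p.1.comp f) (p.2.comp g) a d).symm

/-- The tensor product of two `⋆`-homomorphisms. -/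
noncomputable def map (f : A →⋆ₐ[ℂ] B) (g : D →⋆ₐ[ℂ] C) : MinTensor A D →⋆ₐ[ℂ] MinTensor B C :=
  lift (ofAlg.comp
      (Algebra.TensorProduct.map f.toAlgHom g.toAlgHom : A ⊗[ℂ] D →ₐ[ℂ] B ⊗[ℂ] C))
    (fun z => (norm_ofAlg _).trans_le (spatialNorm_map_le f g z))
    (fun z => by
      refine Eq.trans ?_ (star_ofAlg _).symm
      refine congrArg ofAlg ?_
      refine TensorProduct.induction_on
        (motive := fun z : A ⊗[ℂ] D => Algebra.TensorProduct.map f.toAlgHom g.toAlgHom (star z) =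
          star (Algebra.TensorProduct.map f.toAlgHom g.toAlgHom z)) z ?_ ?_ ?_
      · simp
      · intro a d
        rw [TensorProduct.star_tmul, Algebra.TensorProduct.map_tmul,
          Algebra.TensorProduct.map_tmul, TensorProduct.star_tmul]
        exact congrArg₂ _ (map_star f a) (map_star g d)
      · intro x y hx hy
        rw [star_add, map_add, map_add, hx, hy, star_add])

theorem map_tmul (f : A →⋆ₐ[ℂ] B) (g : D →⋆ₐ[ℂ] C) (a : A) (d : D) :
    map f g (tmul a d) = tmul (f a) (g d) :=
  lift_ofAlg _ _ _ _

/-- The flip of Hilbert space tensor products. -/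
noncomputable def _root_.HilbertTensor.swap (H K : Type u) [NormedAddCommGroup H]
    [InnerProductSpace ℂ H] [NormedAddCommGroup K] [InnerProductSpace ℂ K] :
    HilbertTensor H K →L[ℂ] HilbertTensor K H :=
  (TensorProduct.commIsometry ℂ H K).toLinearIsometry.toContinuousLinearMap.completion

theorem _root_.HilbertTensor.swap_tmul {H K : Type u} [NormedAddCommGroup H]
    [InnerProductSpace ℂ H] [NormedAddCommGroup K] [InnerProductSpace ℂ K] (h : H) (k : K) :
    HilbertTensor.swap H K (.tmul h k) = .tmul k h :=
  (ContinuousLinearMap.completion_apply_coe _ _).trans (by simp [HilbertTensor.tmul])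

theorem _root_.HilbertTensor.norm_swap_le (H K : Type u) [NormedAddCommGroup H]
    [InnerProductSpace ℂ H] [NormedAddCommGroup K] [InnerProductSpace ℂ K] :
    ‖HilbertTensor.swap H K‖ ≤ 1 := by
  refine ContinuousLinearMap.opNorm_le_bound _ zero_le_one fun x => ?_
  refine UniformSpace.Completion.induction_on
    (p := fun x => ‖HilbertTensor.swap H K x‖ ≤ 1 * ‖(x : HilbertTensor H K)‖) x
    (isClosed_le (by fun_prop) (by fun_prop)) fun z => ?_
  have h1 : HilbertTensor.swap H K (z : UniformSpace.Completion (H ⊗[ℂ] K)) =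
      ((TensorProduct.comm ℂ H K z : K ⊗[ℂ] H) : UniformSpace.Completion (K ⊗[ℂ] H)) :=
    ContinuousLinearMap.completion_apply_coe _ _
  rw [h1, one_mul]
  refine (UniformSpace.Completion.norm_coe _).trans_le ?_
  exact (TensorProduct.norm_comm z).trans_le (UniformSpace.Completion.norm_coe z).symm.le

/-- The contractive flip of Hilbert spaces intertwines `π ⊗ ρ` with `ρ ⊗ π`. -/
theorem spatialNorm_comm_le (z : A ⊗[ℂ] D) :
    spatialNorm (Algebra.TensorProduct.comm ℂ A D z) ≤ spatialNorm z := by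
  refine Real.iSup_le (fun p => ?_) (spatialNorm_nonneg z)
  have key : p.1.tensor p.2 (Algebra.TensorProduct.comm ℂ A D z) =
      (HilbertTensor.swap _ _).comp ((p.2.tensor p.1 z).comp (HilbertTensor.swap _ _)) := by
    induction z with
    | zero => simp
    | add x y hx hy =>
      rw [map_add, map_add, map_add, hx, hy, ContinuousLinearMap.add_comp,
        ContinuousLinearMap.comp_add]
    | tmul a d =>
      refine HilbertTensor.ext fun h k => ?_
      simp [HilbertRep.tensor_tmul, HilbertTensor.map_tmul, HilbertTensor.swap_tmul]
  rw [key]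
  refine (ContinuousLinearMap.opNorm_comp_le _ _).trans ?_
  have h1 := HilbertTensor.norm_swap_le p.2.space p.1.space
  have h2 := HilbertTensor.norm_swap_le p.1.space p.2.space
  have h3 := ContinuousLinearMap.opNorm_comp_le (p.2.tensor p.1 z)
    (HilbertTensor.swap p.1.space p.2.space)
  have h4 := le_spatialNorm (p.2, p.1) z
  calc _ ≤ 1 * (‖p.2.tensor p.1 z‖ * 1) := by gcongr; exact h3.trans (by gcongr)
    _ ≤ _ := by simpa using h4

variable (A D) in
/-- The flip `a ⊗ d ↦ d ⊗ a`. -/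
noncomputable def swap : MinTensor A D →⋆ₐ[ℂ] MinTensor D A :=
  lift (ofAlg.comp
      ((Algebra.TensorProduct.comm ℂ A D).toAlgHom : A ⊗[ℂ] D →ₐ[ℂ] D ⊗[ℂ] A))
    (fun z => (norm_ofAlg _).trans_le (spatialNorm_comm_le z))
    (fun z => by
      refine Eq.trans ?_ (star_ofAlg _).symm
      refine congrArg ofAlg ?_
      refine TensorProduct.induction_on
        (motive := fun z : A ⊗[ℂ] D => Algebra.TensorProduct.comm ℂ A D (star z) =
          star (Algebra.TensorProduct.comm ℂ A D z)) z ?_ ?_ ?_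
      · simp
      · intro a d
        simp [TensorProduct.star_tmul]
      · intro x y hx hy
        rw [star_add, map_add, map_add, hx, hy, star_add])

theorem swap_tmul (a : A) (d : D) : swap A D (tmul a d) = tmul d a :=
  lift_ofAlg _ _ _ _

/-- The representation `π ⊗ ρ` of the minimal tensor product. -/
noncomputable def tensorRep (π : HilbertRep A) (ρ : HilbertRep D) : HilbertRep (MinTensor A D) where
  space := HilbertTensor π.space ρ.space
  rep := lift (A := A) (D := D) (π.tensor ρ)
    (fun z => le_spatialNorm (π, ρ) z) (fun z => HilbertRep.tensor_star π ρ z)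

theorem tensorRep_ofAlg (π : HilbertRep A) (ρ : HilbertRep D) (z : SpatialAlg A D) :
    (tensorRep π ρ).rep (ofAlg z) = π.tensor ρ z :=
  lift_ofAlg (A := A) (D := D) (π.tensor ρ) (fun z => le_spatialNorm (π, ρ) z)
    (fun z => HilbertRep.tensor_star π ρ z) z

/-- The representations `π ⊗ ρ` separate the points of the minimal tensor product. -/
theorem exists_tensorRep_ne_zero {x : MinTensor A D} (hx : x ≠ 0) :
    ∃ (π : HilbertRep A) (ρ : HilbertRep D), (tensorRep π ρ).rep x ≠ 0 := by
  by_contra! h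
  refine hx (norm_le_zero_iff.1 (le_of_forall_pos_le_add fun ε hε => ?_))
  obtain ⟨z, hz⟩ := denseRange_ofAlg.exists_dist_lt x (half_pos hε)
  rw [dist_eq_norm] at hz
  have h1 : ‖(ofAlg z : MinTensor A D)‖ ≤ ε / 2 := by
    rw [norm_ofAlg]
    refine Real.iSup_le (fun p => ?_) (half_pos hε).le
    -- Every `π ⊗ ρ` kills `x`, so its norm at `z` is its norm at `x - z`, at most `ε / 2`.
    have h2 := NonUnitalStarAlgHom.norm_apply_le (tensorRep p.1 p.2).rep (x - ofAlg z)
    rw [map_sub, h, zero_sub, norm_neg, tensorRep_ofAlg] at h2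
    exact h2.trans hz.le
  calc ‖x‖ = ‖(x - ofAlg z) + ofAlg z‖ := by rw [sub_add_cancel]
    _ ≤ 0 + ε := by linarith [norm_add_le (x - ofAlg z) (ofAlg z)]

/-- Provides a nonzero vector in the second leg, against which injectivity of `a ↦ a ⊗ 1` is tested.
If all spaces of `D` were zero, every `π ⊗ ρ` would vanish at `1`. -/
theorem exists_rep_space_ne_zero [Nontrivial (MinTensor A D)] :
    ∃ (ρ : HilbertRep D) (k : ρ.space), k ≠ 0 := by
  obtain ⟨π, ρ, h⟩ := exists_tensorRep_ne_zero (one_ne_zero (α := MinTensor A D))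
  refine ⟨ρ, ?_⟩
  by_contra! hk
  refine h (HilbertTensor.ext fun x k => ?_)
  have : HilbertTensor.tmul x k = 0 := by
    rw [hk k]
    simpa using HilbertTensor.tmul_smul (0 : ℂ) x (0 : ρ.space)
  rw [this]
  exact (map_zero ((tensorRep π ρ).rep 1)).trans (map_zero _).symm

/-- `a ↦ a ⊗ 1` is injective when the representations of `A` separate points. -/
theorem inl_injective (hA : ∀ a : A, a ≠ 0 → ∃ π : HilbertRep A, π.rep a ≠ 0)
    (hD : ∃ (ρ : HilbertRep D) (k : ρ.space), k ≠ 0) : Function.Injective (inl A D) := by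
  rw [injective_iff_map_eq_zero]
  intro a ha
  by_contra h
  obtain ⟨π, hπ⟩ := hA a h
  obtain ⟨ρ, k, hk⟩ := hD
  refine hπ (ContinuousLinearMap.ext fun x => ?_)
  have h1 : π.tensor ρ (a ⊗ₜ 1) = 0 :=
    (tensorRep_ofAlg π ρ _).symm.trans ((congrArg _ ha).trans (map_zero _))
  rw [HilbertRep.tensor_tmul, map_one] at h1
  have h2 : HilbertTensor.tmul (π.rep a x) k = 0 := by
    have := congrArg (fun T => T (HilbertTensor.tmul x k)) h1
    simpa [HilbertTensor.map_tmul] using this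
  have h3 := HilbertTensor.inner_tmul (π.rep a x) (π.rep a x) k k
  rw [h2, inner_zero_left, eq_comm, mul_eq_zero, inner_self_eq_zero, inner_self_eq_zero] at h3
  exact h3.resolve_right hk

end Functor

end MinTensor

/-! ### Norm identities for unitaries -/

section UnitaryNorms

variable {A : Type u} [CStarAlgebra A]

theorem norm_unitary_mul {w : A} (hw : w ∈ unitary A) (x : A) : ‖w * x‖ = ‖x‖ :=
  CStarRing.norm_mem_unitary_mul x hw

theorem norm_mul_unitary {w : A} (hw : w ∈ unitary A) (x : A) : ‖x * w‖ = ‖x‖ :=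
  CStarRing.norm_mul_mem_unitary x hw

theorem norm_conj_unitary {w : A} (hw : w ∈ unitary A) (x : A) : ‖w * x * star w‖ = ‖x‖ := by
  rw [norm_mul_unitary (Unitary.star_mem hw), norm_unitary_mul hw]

theorem norm_unitary_le {w : A} (hw : w ∈ unitary A) : ‖w‖ ≤ 1 := by
  have h : ‖star w * w‖ = ‖w‖ * ‖w‖ := CStarRing.norm_star_mul_self
  rw [norm_unitary_mul (Unitary.star_mem hw)] at h
  nlinarith [norm_nonneg w]

theorem norm_conj_sub {w : A} (hw : w ∈ unitary A) (x y : A) :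
    ‖w * x * star w - y‖ = ‖x - star w * y * w‖ := by
  have h : w * x * star w - y = w * (x - star w * y * w) * star w := by
    have h1 : w * star w = 1 := Unitary.mul_star_self_of_mem hw
    calc w * x * star w - y = w * x * star w - (w * star w) * y * (w * star w) := by
          rw [h1]; simp
      _ = _ := by noncomm_ring
  rw [h, norm_conj_unitary hw]

theorem norm_conj_sub_self {w : A} (hw : w ∈ unitary A) (x : A) :
    ‖w * x * star w - x‖ = ‖w * x - x * w‖ := by
  have h : w * x * star w - x = (w * x - x * w) * star w := by
    rw [sub_mul, mul_assoc x, Unitary.mul_star_self_of_mem hw, mul_one]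
  rw [h, norm_mul_unitary (Unitary.star_mem hw)]

end UnitaryNorms

/-- Approximate unitary equivalence of unital `⋆`-homomorphisms, tested on finite sets. -/
def ApproxEquivOnFinite {A B : Type u} [CStarAlgebra A] [CStarAlgebra B]
    (φ ψ : A →⋆ₐ[ℂ] B) : Prop :=
  ∀ (F : Finset A) (ε : ℝ), 0 < ε → ∃ w ∈ unitary B, ∀ a ∈ F, ‖w * φ a * star w - ψ a‖ < ε

/-! ### Calculus of approximate unitary equivalence -/

namespace ApproxEquivOnFinite

variable {A B C : Type u} [CStarAlgebra A] [CStarAlgebra B] [CStarAlgebra C]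

theorem of_sequence {φ ψ : A →⋆ₐ[ℂ] B} (h : ApproxUnitarilyEquivalent φ ψ) :
    ApproxEquivOnFinite φ ψ := by
  obtain ⟨w, hw⟩ := h
  intro F ε hε
  have : ∀ᶠ n in atTop, ∀ a ∈ F, ‖(w n : B) * φ a * star (w n : B) - ψ a‖ < ε := by
    refine (F.eventually_all).2 fun a _ => ?_
    have := Metric.tendsto_nhds.1 (hw a) ε hε
    simpa only [dist_eq_norm] using this
  obtain ⟨n, hn⟩ := this.exists
  exact ⟨w n, (w n).2, hn⟩

theorem symm {φ ψ : A →⋆ₐ[ℂ] B} (h : ApproxEquivOnFinite φ ψ) : ApproxEquivOnFinite ψ φ := by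
  intro F ε hε
  obtain ⟨w, hw, hF⟩ := h F ε hε
  refine ⟨star w, Unitary.star_mem hw, fun a ha => ?_⟩
  have := hF a ha
  rw [norm_conj_sub hw, norm_sub_rev] at this
  rwa [star_star]

theorem trans {φ ψ χ : A →⋆ₐ[ℂ] B} (h : ApproxEquivOnFinite φ ψ) (h' : ApproxEquivOnFinite ψ χ) :
    ApproxEquivOnFinite φ χ := by
  intro F ε hε
  obtain ⟨w, hw, hF⟩ := h F (ε / 2) (half_pos hε)
  obtain ⟨v, hv, hF'⟩ := h' F (ε / 2) (half_pos hε)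
  refine ⟨v * w, mul_mem hv hw, fun a ha => ?_⟩
  have e : v * w * φ a * star (v * w) - χ a =
      v * (w * φ a * star w - ψ a) * star v + (v * ψ a * star v - χ a) := by
    rw [star_mul]; noncomm_ring
  have h1 := norm_add_le (v * (w * φ a * star w - ψ a) * star v) (v * ψ a * star v - χ a)
  rw [norm_conj_unitary hv] at h1
  rw [e]
  linarith [hF a ha, hF' a ha]

theorem comp_left {φ ψ : A →⋆ₐ[ℂ] B} (h : ApproxEquivOnFinite φ ψ) (f : B →⋆ₐ[ℂ] C) :
    ApproxEquivOnFinite (f.comp φ) (f.comp ψ) := by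
  intro F ε hε
  obtain ⟨w, hw, hF⟩ := h F ε hε
  refine ⟨f w, Unitary.map_mem f hw, fun a ha => ?_⟩
  refine lt_of_le_of_lt ?_ (hF a ha)
  have : f w * (f.comp φ) a * star (f w) - (f.comp ψ) a = f (w * φ a * star w - ψ a) := by
    simp [map_star]
  rw [this]
  exact NonUnitalStarAlgHom.norm_apply_le f _

theorem comp_right {φ ψ : B →⋆ₐ[ℂ] C} (h : ApproxEquivOnFinite φ ψ) (f : A →⋆ₐ[ℂ] B) :
    ApproxEquivOnFinite (φ.comp f) (ψ.comp f) := by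
  classical
  intro F ε hε
  obtain ⟨w, hw, hF⟩ := h (F.image f) ε hε
  exact ⟨w, hw, fun a ha => hF (f a) (Finset.mem_image_of_mem f ha)⟩

end ApproxEquivOnFinite

/-! ### The approximately inner half flip -/

namespace IsStronglySelfAbsorbing

variable {D : Type u} [CStarAlgebra D]

/-- A strongly self-absorbing C⋆-algebra has approximately inner half flip. -/
theorem inl_approxEquiv_inr (hD : IsStronglySelfAbsorbing D) :
    ApproxEquivOnFinite (MinTensor.inl D D) (MinTensor.inr D D) := by
  obtain ⟨e, he⟩ := hD.exists_equiv
  set φ : D →⋆ₐ[ℂ] MinTensor D D := (e : D →⋆ₐ[ℂ] MinTensor D D) with hφ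
  set φ' : MinTensor D D →⋆ₐ[ℂ] D := (e.symm : MinTensor D D →⋆ₐ[ℂ] D) with hφ'
  have e1 : ∀ x, φ' (φ x) = x := e.symm_apply_apply
  have e2 : ∀ x, φ (φ' x) = x := e.apply_symm_apply
  set i₁ := MinTensor.inl D D
  set i₂ := MinTensor.inr D D
  set σ := MinTensor.swap D D with hσ
  have hf : ApproxEquivOnFinite (φ'.comp i₁) (StarAlgHom.id ℂ D) := by
    have := (ApproxEquivOnFinite.of_sequence he).comp_left φ'
    rwa [show φ'.comp φ = StarAlgHom.id ℂ D from StarAlgHom.ext e1] at this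
  -- `m l r` is `l ⊗ r` and `s` is the flip, both transported to `D`. Since `φ' ∘ i₁` is
  -- approximately the identity and `m l r` restricts to `l` on the first leg, `m l r` is equivalent
  -- to `l` whatever `r` is.
  let m : (D →⋆ₐ[ℂ] D) → (D →⋆ₐ[ℂ] D) → (D →⋆ₐ[ℂ] D) := fun l r =>
    φ'.comp ((MinTensor.map l r).comp φ)
  let s : D →⋆ₐ[ℂ] D := φ'.comp (σ.comp φ)
  have hm : ∀ l r, ApproxEquivOnFinite (m l r) l := by
    intro l r
    have h1 := (hf.comp_left (m l r)).symm
    have h2 : (m l r).comp (φ'.comp i₁) = (φ'.comp i₁).comp l := by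
      refine StarAlgHom.ext fun d => ?_
      change φ' (MinTensor.map l r (φ (φ' (i₁ d)))) = φ' (i₁ (l d))
      rw [e2]
      exact congrArg φ' ((MinTensor.map_tmul l r d 1).trans (by rw [map_one]; rfl))
    rw [h2] at h1
    exact h1.trans (hf.comp_right l)
  have hs : ∀ l r, s.comp ((m l r).comp s) = m r l := by
    intro l r
    have h1 : σ.comp ((MinTensor.map l r).comp σ) = MinTensor.map r l := by
      refine MinTensor.hom_ext fun a d => ?_
      change σ (MinTensor.map l r (σ (MinTensor.tmul a d))) = _
      rw [hσ, MinTensor.swap_tmul, MinTensor.map_tmul, MinTensor.swap_tmul, MinTensor.map_tmul]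
    refine StarAlgHom.ext fun d => ?_
    change φ' (σ (φ (φ' (MinTensor.map l r (φ (φ' (σ (φ d)))))))) = φ' (MinTensor.map r l (φ d))
    rw [e2, e2, ← h1]
    rfl
  have hss : s.comp s = StarAlgHom.id ℂ D := by
    have h1 : σ.comp σ = StarAlgHom.id ℂ _ := by
      refine MinTensor.hom_ext fun a d => ?_
      change σ (σ (MinTensor.tmul a d)) = MinTensor.tmul a d
      rw [hσ, MinTensor.swap_tmul, MinTensor.swap_tmul]
    refine StarAlgHom.ext fun d => ?_
    change φ' (σ (φ (φ' (σ (φ d))))) = d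
    rw [e2]
    exact (congrArg φ' (DFunLike.congr_fun h1 (φ d))).trans (e1 d)
  -- Every unital endomorphism is approximately inner: conjugating `m id r ≈ id` by `s` gives `m r
  -- id ≈ id`, whereas `m r id ≈ r`. Applied to `φ' ∘ i₂`, this compares the two legs.
  have hend : ∀ r, ApproxEquivOnFinite (StarAlgHom.id ℂ D) r := by
    intro r
    have h1 := ((hm (StarAlgHom.id ℂ D) r).comp_right s).comp_left s
    rw [hs, StarAlgHom.id_comp, hss] at h1
    exact h1.symm.trans (hm r _)
  have h3 : ApproxEquivOnFinite (φ'.comp i₁) (φ'.comp i₂) := hf.trans (hend _)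
  have h4 := h3.comp_left φ
  have h5 : ∀ i : D →⋆ₐ[ℂ] MinTensor D D, φ.comp (φ'.comp i) = i :=
    fun i => StarAlgHom.ext fun d => e2 (i d)
  rwa [h5, h5] at h4

end IsStronglySelfAbsorbing

/-! ### One-sided approximate intertwining -/

section Intertwining

variable {B C : Type u} [CStarAlgebra B] [CStarAlgebra C]

/-- One-sided approximate intertwining: an injective unital `⋆`-homomorphism `ι : B → C` of separable
C⋆-algebras is approximately unitarily equivalent to an isomorphism if there are unitaries in `C`
which almost commute with `ι(B)` and almost conjugate `C` into `ι(B)`. -/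
theorem nonempty_starAlgEquiv_of_intertwining [TopologicalSpace.SeparableSpace B]
    [TopologicalSpace.SeparableSpace C] (ι : B →⋆ₐ[ℂ] C) (hι : Function.Injective ι)
    (h : ∀ (F : Finset B) (S : Finset C) (ε : ℝ), 0 < ε → ∃ v ∈ unitary C,
      (∀ b ∈ F, ‖v * ι b - ι b * v‖ < ε) ∧ ∀ c ∈ S, ∃ x, ‖star v * c * v - ι x‖ < ε) :
    Nonempty (C ≃⋆ₐ[ℂ] B) := by
  classical
  let b : ℕ → B := TopologicalSpace.denseSeq B
  let c : ℕ → C := TopologicalSpace.denseSeq C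
  -- A state is the product `w` of the unitaries chosen so far, with the finite set that later
  -- unitaries must almost commute with.
  let State := {p : C × Finset B // p.1 ∈ unitary C}
  -- Pass from `w` to `w v`, where `v` conjugates the elements `w* cⱼ w`, `j ≤ n`, almost into the
  -- range of `ι`. Their approximants join the finite set, so later steps barely move them.
  have hstep : ∀ (n : ℕ) (p : State), ∃ p' : State, p.1.2 ⊆ p'.1.2 ∧ b n ∈ p'.1.2 ∧
      (∀ x ∈ p.1.2, ‖p'.1.1 * ι x * star p'.1.1 - p.1.1 * ι x * star p.1.1‖ ≤ 1 / 2 ^ n) ∧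
      ∀ j ≤ n, ∃ x ∈ p'.1.2, ‖c j - p'.1.1 * ι x * star p'.1.1‖ ≤ 1 / 2 ^ n := by
    rintro n ⟨⟨w, F⟩, hw⟩
    obtain ⟨v, hv, hF, hS⟩ := h F
      ((Finset.range (n + 1)).image fun j => star w * c j * w) (1 / 2 ^ n) (by positivity)
    have hS' : ∀ j, ∃ x, j ≤ n → ‖star v * (star w * c j * w) * v - ι x‖ < 1 / 2 ^ n := by
      intro j
      by_cases hj : j ≤ n
      · obtain ⟨x, hx⟩ := hS _ (Finset.mem_image_of_mem _
          (Finset.mem_range.2 (Nat.lt_succ_of_le hj)))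
        exact ⟨x, fun _ => hx⟩
      · exact ⟨0, fun h => absurd h hj⟩
    choose y hy using hS'
    refine ⟨⟨⟨w * v, insert (b n) (F ∪ (Finset.range (n + 1)).image y)⟩, mul_mem hw hv⟩,
      fun x hx => by simp [hx], by simp, fun x hx => ?_, fun j hj => ⟨y j, ?_, ?_⟩⟩
    · have e : w * v * ι x * star (w * v) - w * ι x * star w =
          w * (v * ι x * star v - ι x) * star w := by rw [star_mul]; noncomm_ring
      change ‖w * v * ι x * star (w * v) - w * ι x * star w‖ ≤ _
      rw [e, norm_conj_unitary hw, norm_conj_sub_self hv]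
      exact (hF x hx).le
    · refine Finset.mem_insert_of_mem (Finset.mem_union_right _ (Finset.mem_image_of_mem _ ?_))
      exact Finset.mem_range.2 (Nat.lt_succ_of_le hj)
    · change ‖c j - w * v * ι (y j) * star (w * v)‖ ≤ _
      rw [norm_sub_rev, norm_conj_sub (mul_mem hw hv), norm_sub_rev]
      refine le_trans (le_of_eq (congrArg _ ?_)) (hy j hj).le
      rw [star_mul]; noncomm_ring
  choose next hnext1 hnext2 hnext3 hnext4 using hstep
  let st : ℕ → State := fun n => Nat.rec ⟨⟨1, ∅⟩, one_mem _⟩ (fun n p => next n p) n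
  have hst : ∀ n, st (n + 1) = next n (st n) := fun n => rfl
  let w : ℕ → C := fun n => (st n).1.1
  let F : ℕ → Finset B := fun n => (st n).1.2
  have hw : ∀ n, w n ∈ unitary C := fun n => (st n).2
  have hFmono : ∀ n k, F n ⊆ F (n + k) := by
    intro n k
    induction k with
    | zero => exact fun x hx => hx
    | succ k ih => exact ih.trans (hnext1 _ _)
  let T : ℕ → B → C := fun n x => w n * ι x * star (w n)
  have hTsub : ∀ n x y, T n x - T n y = T n (x - y) := by
    intro n x y
    simp only [T, map_sub]; noncomm_ring
  have hTnorm : ∀ n x, ‖T n x‖ = ‖x‖ := fun n x =>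
    (norm_conj_unitary (hw n) _).trans (NonUnitalStarAlgHom.norm_map ι hι x)
  -- The bound is `1 / 2 ^ (n + k)`, written in the shape expected by the geometric-series lemmas.
  have hTF : ∀ n x, x ∈ F n → ∀ k,
      dist (T (n + k) x) (T (n + (k + 1)) x) ≤ (2 / 2 ^ n) / 2 / 2 ^ k := by
    intro n x hx k
    rw [dist_comm, dist_eq_norm]
    refine (hnext3 (n + k) (st (n + k)) x (hFmono n k hx)).trans_eq ?_
    rw [pow_add]; field_simp
  have hcauF : ∀ n x, x ∈ F n → CauchySeq fun m => T m x := by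
    intro n x hx
    have h1 : CauchySeq fun k => T (n + k) x := cauchySeq_of_le_geometric_two (hTF n x hx)
    obtain ⟨l, hl⟩ := cauchySeq_tendsto_of_complete h1
    have h2 : Tendsto (fun k => T (k + n) x) atTop (𝓝 l) := by simpa only [add_comm] using hl
    exact ((tendsto_add_atTop_iff_nat n).1 h2).cauchySeq
  -- The dense points `b n` lie in the sets `F (n + 1)`, and each `T m` is an additive isometry, so
  -- convergence extends to all of `B`.
  have hcau : ∀ x, CauchySeq fun m => T m x := by
    intro x
    refine Metric.cauchySeq_iff'.2 fun ε hε => ?_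
    obtain ⟨n, hn⟩ := (TopologicalSpace.denseRange_denseSeq B).exists_dist_lt x
      (show 0 < ε / 3 by positivity)
    obtain ⟨N, hN⟩ := Metric.cauchySeq_iff'.1 (hcauF (n + 1) (b n) (hnext2 n (st n)))
      (ε / 3) (by positivity)
    refine ⟨N, fun m hm => ?_⟩
    have h1 : ∀ m, dist (T m x) (T m (b n)) < ε / 3 := by
      intro m
      rwa [dist_eq_norm, hTsub, hTnorm, ← dist_eq_norm]
    have h2 := dist_triangle4 (T m x) (T m (b n)) (T N (b n)) (T N x)
    have h3 := h1 N
    rw [dist_comm] at h3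
    linarith [h1 m, hN m hm]
  choose ψ hψ using fun x => cauchySeq_tendsto_of_complete (hcau x)
  have hw1 : ∀ n, star (w n) * w n = 1 := fun n => Unitary.star_mul_self_of_mem (hw n)
  have hw2 : ∀ n, w n * star (w n) = 1 := fun n => Unitary.mul_star_self_of_mem (hw n)
  let Ψ : B →⋆ₐ[ℂ] C :=
    { toFun := ψ
      map_one' := tendsto_nhds_unique (hψ 1) (by
        refine tendsto_const_nhds.congr fun n => ?_
        simp [T, hw2])
      map_mul' := fun x y => tendsto_nhds_unique (hψ (x * y)) (((hψ x).mul (hψ y)).congr fun n => by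
        simp only [T, map_mul]
        calc w n * ι x * star (w n) * (w n * ι y * star (w n)) =
            w n * ι x * (star (w n) * w n) * ι y * star (w n) := by noncomm_ring
          _ = _ := by rw [hw1]; noncomm_ring)
      map_zero' := tendsto_nhds_unique (hψ 0) (by
        refine tendsto_const_nhds.congr fun n => ?_
        simp [T])
      map_add' := fun x y => tendsto_nhds_unique (hψ (x + y)) (((hψ x).add (hψ y)).congr fun n => by
        simp only [T, map_add]; noncomm_ring)
      commutes' := fun r => tendsto_nhds_unique (hψ _) (by
        refine tendsto_const_nhds.congr fun n => ?_
        change _ = w n * ι (algebraMap ℂ B r) * star (w n)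
        rw [AlgHomClass.commutes, ← Algebra.commutes, mul_assoc, hw2, mul_one])
      map_star' := fun x => tendsto_nhds_unique (hψ (star x)) ((hψ x).star.congr fun n => by
        simp [T, map_star, mul_assoc]) }
  have hΨ : ∀ x, ‖Ψ x‖ = ‖x‖ := fun x =>
    tendsto_nhds_unique (hψ x).norm (tendsto_const_nhds.congr fun n => (hTnorm n x).symm)
  have hiso : Isometry Ψ := AddMonoidHomClass.isometry_of_norm Ψ hΨ
  -- The range of an isometry is closed, so density is enough. Some `x ∈ F (n + 1)` has `T (n + 1)
  -- x` within `1 / 2 ^ n` of `c j`, and the remaining steps move it by at most `2 / 2 ^ (n + 1)`.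
  have hsurj : Function.Surjective Ψ := by
    have hcl : IsClosed (Set.range Ψ) := hiso.isClosedEmbedding.isClosed_range
    intro z
    have hz : z ∈ closure (Set.range Ψ) := by
      refine Metric.mem_closure_iff.2 fun ε hε => ?_
      obtain ⟨j, hj⟩ := (TopologicalSpace.denseRange_denseSeq C).exists_dist_lt z
        (show 0 < ε / 3 by positivity)
      obtain ⟨N, hN⟩ := exists_pow_lt_of_lt_one (show 0 < ε / 3 by positivity)
        (show (1 / 2 : ℝ) < 1 by norm_num)
      let n := max N j
      obtain ⟨x, hx, hxc⟩ := hnext4 n (st n) j (le_max_right _ _)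
      have hn : 1 / 2 ^ n < ε / 3 := by
        refine lt_of_le_of_lt ?_ hN
        rw [one_div, one_div, inv_pow]
        exact inv_anti₀ (by positivity) (pow_le_pow_right₀ one_le_two (le_max_left _ _))
      have h1 : dist (T (n + 1 + 0) x) (Ψ x) ≤ 2 / 2 ^ (n + 1) := by
        refine dist_le_of_le_geometric_two_of_tendsto₀ (f := fun k => T (n + 1 + k) x)
          (hTF (n + 1) x hx) ?_
        have := (tendsto_add_atTop_iff_nat (n + 1)).2 (hψ x)
        simp only [add_comm _ (n + 1)] at this
        exact this
      have h1' : (2 : ℝ) / 2 ^ (n + 1) = 1 / 2 ^ n := by rw [pow_succ]; field_simp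
      have h2 : dist (c j) (T (n + 1 + 0) x) ≤ 1 / 2 ^ n := by
        rw [dist_eq_norm]; exact hxc
      refine ⟨Ψ x, ⟨x, rfl⟩, ?_⟩
      have := dist_triangle4 z (c j) (T (n + 1 + 0) x) (Ψ x)
      rw [h1'] at h1
      linarith
    rwa [hcl.closure_eq] at hz
  exact ⟨(StarAlgEquiv.ofBijective Ψ ⟨hiso.injective, hsurj⟩).symm⟩

end Intertwining

/-! ### Norm bounds for sums of conjugates -/

section Columns

attribute [local instance] CStarAlgebra.spectralOrder CStarAlgebra.spectralOrderedRing

variable {E : Type u} [CStarAlgebra E] {ι : Type*} [Fintype ι]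

/-- `‖∑ cᵢ* zᵢ cᵢ‖ ≤ ‖∑ cᵢ* cᵢ‖` if all `‖zᵢ‖ ≤ 1`. -/
theorem norm_sum_conj_le_of_norm_le_one (c z : ι → E) (hz : ∀ i, ‖z i‖ ≤ 1) :
    ‖∑ i, star (c i) * z i * c i‖ ≤ ‖∑ i, star (c i) * c i‖ := by
  -- Cauchy–Schwarz in the Hilbert module `E^ι`: the sum is the inner product of `(cᵢ*)` and `(cᵢ*
  -- zᵢ)`, and the second vector is no longer than the first because `zᵢ zᵢ* ≤ 1`.
  let x : WithCStarModule E (ι → E) := (WithCStarModule.equiv E (ι → E)).symm fun i => star (c i)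
  let y : WithCStarModule E (ι → E) := (WithCStarModule.equiv E (ι → E)).symm
    fun i => star (c i) * z i
  have h1 : inner E x y = ∑ i, star (c i) * z i * c i := by
    rw [WithCStarModule.pi_inner]
    refine Finset.sum_congr rfl fun i _ => ?_
    rw [WithCStarModule.inner_def]
    simp [x, y]
  have h2 : inner E x x = ∑ i, star (c i) * c i := by
    rw [WithCStarModule.pi_inner]
    refine Finset.sum_congr rfl fun i _ => ?_
    rw [WithCStarModule.inner_def]
    simp [x]
  have h3 : inner E y y = ∑ i, star (c i) * (z i * star (z i)) * c i := by
    rw [WithCStarModule.pi_inner]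
    refine Finset.sum_congr rfl fun i _ => ?_
    rw [WithCStarModule.inner_def]
    simp [y, mul_assoc]
  have h4 : ‖inner E y y‖ ≤ ‖inner E x x‖ := by
    rw [h2, h3]
    refine CStarAlgebra.norm_le_norm_of_nonneg_of_le
      (Finset.sum_nonneg fun i _ => star_left_conjugate_nonneg (mul_star_self_nonneg _) _)
      (Finset.sum_le_sum fun i _ => ?_)
    have h5 : z i * star (z i) ≤ 1 := by
      refine (CStarAlgebra.norm_le_one_iff_of_nonneg _ (mul_star_self_nonneg _)).1 ?_
      rw [CStarRing.norm_self_mul_star]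
      exact mul_le_one₀ (hz i) (norm_nonneg _) (hz i)
    simpa using star_left_conjugate_le_conjugate h5 (c i)
  have h6 : ‖x‖ ^ 2 = ‖inner E x x‖ := CStarModule.norm_sq_eq E
  have h7 : ‖y‖ ^ 2 = ‖inner E y y‖ := CStarModule.norm_sq_eq E
  have h8 : ‖inner E x y‖ ≤ ‖x‖ * ‖y‖ := CStarModule.norm_inner_le _
  have h9 : ‖y‖ ≤ ‖x‖ := by
    refine le_of_sq_le_sq ?_ (norm_nonneg x)
    rw [h6, h7]; exact h4
  rw [← h1, ← h2, ← h6, sq]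
  exact h8.trans (mul_le_mul_of_nonneg_left h9 (norm_nonneg x))

/-- `‖∑ cᵢ* zᵢ cᵢ‖ ≤ ‖∑ wᵢ cᵢ* cᵢ‖` if `‖zᵢ‖ ≤ wᵢ`. -/
theorem norm_sum_conj_le_weighted (c z : ι → E) (w : ι → ℝ) (hz : ∀ i, ‖z i‖ ≤ w i) :
    ‖∑ i, star (c i) * z i * c i‖ ≤ ‖∑ i, (w i : ℂ) • (star (c i) * c i)‖ := by
  have hw : ∀ i, 0 ≤ w i := fun i => (norm_nonneg _).trans (hz i)
  have hs : ∀ i, ((√(w i) : ℝ) : ℂ) * ((√(w i) : ℝ) : ℂ) = w i := fun i => by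
    rw [← Complex.ofReal_mul, Real.mul_self_sqrt (hw i)]
  -- Move the weight from `zᵢ` to `cᵢ`, as a square root on each side. A zero weight forces `zᵢ =
  -- 0`, so the junk inverse is harmless.
  have h := norm_sum_conj_le_of_norm_le_one (fun i => ((√(w i) : ℝ) : ℂ) • c i)
    (fun i => ((w i)⁻¹ : ℂ) • z i) (fun i => by
      rw [norm_smul, norm_inv, Complex.norm_real, Real.norm_of_nonneg (hw i)]
      exact inv_mul_le_one_of_le₀ (hz i) (hw i))
  have e1 : ∀ i, star (((√(w i) : ℝ) : ℂ) • c i) * (((w i)⁻¹ : ℂ) • z i) *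
      (((√(w i) : ℝ) : ℂ) • c i) = star (c i) * z i * c i := by
    intro i
    rcases (hw i).eq_or_lt with h0 | h0
    · have : z i = 0 := norm_le_zero_iff.1 (h0 ▸ hz i)
      simp [this]
    · simp only [star_smul, smul_mul_assoc, mul_smul_comm, smul_smul, Complex.star_def,
        Complex.conj_ofReal]
      rw [mul_comm ((w i : ℂ)⁻¹), ← mul_assoc, hs, mul_inv_cancel₀ (by exact_mod_cast h0.ne'),
        one_smul]
  have e2 : ∀ i, star (((√(w i) : ℝ) : ℂ) • c i) * (((√(w i) : ℝ) : ℂ) • c i) =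
      (w i : ℂ) • (star (c i) * c i) := by
    intro i
    simp only [star_smul, smul_mul_assoc, mul_smul_comm, smul_smul, Complex.star_def,
      Complex.conj_ofReal, hs]
  simpa only [e1, e2] using h

/-- The bound does not depend on the number of summands. This keeps averages under control as the
number of windows grows. -/
theorem norm_sum_conj_le (c z : ι → E) (M : ℝ) (hM : 0 ≤ M) (hz : ∀ i, ‖z i‖ ≤ M)
    (hc : ∑ i, star (c i) * c i = 1) : ‖∑ i, star (c i) * z i * c i‖ ≤ M := by
  refine (norm_sum_conj_le_weighted c z (fun _ => M) hz).trans ?_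
  rw [← Finset.smul_sum, hc, norm_smul, Complex.norm_real, Real.norm_of_nonneg hM]
  exact mul_le_of_le_one_right hM (norm_unitary_le (one_mem (unitary E)))

end Columns

/-! ### Fourier windows of a unitary: partition of unity, moments, overlap -/

section Fejer

variable {E : Type u} [CStarAlgebra E] (N : ℕ) [NeZero N]

/-- The discrete Fourier windows `gₖ(u) = N⁻¹ ∑_{j < N} (ω⁻ᵏ u)ʲ` of `u`, with `ω = exp(2πi/N)`. -/
noncomputable def fourierWindow (u : E) (k : ZMod N) : E :=
  (N : ℂ)⁻¹ • ∑ j ∈ Finset.range N, (ZMod.stdAddChar (-k) • u) ^ j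

variable {N}

theorem star_stdAddChar (k : ZMod N) :
    star (ZMod.stdAddChar k : ℂ) = ZMod.stdAddChar (-k) := by
  rw [AddChar.map_neg_eq_inv, ZMod.stdAddChar_apply, Complex.star_def, ← Circle.coe_inv,
    Circle.coe_inv_eq_conj]

theorem norm_stdAddChar (k : ZMod N) : ‖(ZMod.stdAddChar k : ℂ)‖ = 1 := by
  rw [ZMod.stdAddChar_apply, Circle.norm_coe]

theorem sum_stdAddChar_mul (a : ZMod N) :
    ∑ k : ZMod N, (ZMod.stdAddChar (k * a) : ℂ) = if a = 0 then (N : ℂ) else 0 := by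
  rw [AddChar.sum_mulShift a (ZMod.isPrimitive_stdAddChar N), ZMod.card]
  split_ifs <;> simp

theorem fourierWindow_eq (u : E) (k : ZMod N) :
    fourierWindow N u k =
      (N : ℂ)⁻¹ • ∑ j ∈ Finset.range N, ZMod.stdAddChar (k * (-(j : ZMod N))) • u ^ j := by
  refine congrArg _ (Finset.sum_congr rfl fun j _ => ?_)
  rw [smul_pow, ← AddChar.map_nsmul_eq_pow, nsmul_eq_mul]
  congr 2
  ring

theorem star_fourierWindow_eq (u : E) (k : ZMod N) :
    star (fourierWindow N u k) =
      (N : ℂ)⁻¹ • ∑ j ∈ Finset.range N, ZMod.stdAddChar (k * (j : ZMod N)) • star u ^ j := by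
  rw [fourierWindow_eq, star_smul, star_sum]
  congr 1
  · simp
  · refine Finset.sum_congr rfl fun j _ => ?_
    rw [star_smul, star_stdAddChar, star_pow]
    congr 2
    ring

/-- Parseval: summing over `k` kills the terms with `j ≠ l`, since exponents in `[0, N)` that agree
modulo `N` are equal. -/
theorem sum_star_mul_fourierWindow {u : E} (hu : u ∈ unitary E) :
    ∑ k, star (fourierWindow N u k) * fourierWindow N u k = 1 := by
  have hN : (N : ℂ) ≠ 0 := Nat.cast_ne_zero.2 (NeZero.ne N)
  have h1 : ∀ k : ZMod N, star (fourierWindow N u k) * fourierWindow N u k =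
      ((N : ℂ)⁻¹ * (N : ℂ)⁻¹) • ∑ j ∈ Finset.range N, ∑ l ∈ Finset.range N,
        (ZMod.stdAddChar (k * ((j : ZMod N) - (l : ZMod N))) : ℂ) • (star u ^ j * u ^ l) := by
    intro k
    rw [star_fourierWindow_eq, fourierWindow_eq, smul_mul_smul_comm, Finset.sum_mul_sum]
    refine congrArg _ (Finset.sum_congr rfl fun j _ => Finset.sum_congr rfl fun l _ => ?_)
    rw [smul_mul_smul_comm, ← AddChar.map_add_eq_mul]
    congr 2
    ring
  simp only [h1]
  rw [← Finset.smul_sum, Finset.sum_comm]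
  have h2 : ∀ j ∈ Finset.range N, ∑ k : ZMod N, ∑ l ∈ Finset.range N,
      (ZMod.stdAddChar (k * ((j : ZMod N) - (l : ZMod N))) : ℂ) • (star u ^ j * u ^ l) = (N : ℂ) • (1 : E) := by
    intro j hj
    rw [Finset.sum_comm]
    simp only [← Finset.sum_smul, sum_stdAddChar_mul]
    rw [Finset.sum_eq_single j]
    · rw [sub_self, if_pos rfl, ← star_pow, Unitary.star_mul_self_of_mem (pow_mem hu j)]
    · intro l hl hlj
      rw [if_neg, zero_smul]
      rw [sub_eq_zero]
      intro h
      refine hlj ?_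
      have := (ZMod.natCast_eq_natCast_iff' _ _ _).1 h
      rw [Nat.mod_eq_of_lt (Finset.mem_range.1 hj), Nat.mod_eq_of_lt (Finset.mem_range.1 hl)] at this
      exact this.symm
    · exact fun h => absurd hj h
  rw [Finset.sum_congr rfl h2, Finset.sum_const, Finset.card_range, ← Nat.cast_smul_eq_nsmul ℂ,
    smul_smul, smul_smul]
  field_simp
  simp

/-- Only `j = N - 1` survives, being the one exponent below `N` with `j + 1 = 0` modulo `N`. This
evaluates the error term of the first moment. -/
theorem sum_smul_star_fourierWindow (u : E) :
    ∑ k, (ZMod.stdAddChar k : ℂ) • star (fourierWindow N u k) = star u ^ (N - 1) := by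
  have hN : (N : ℂ) ≠ 0 := Nat.cast_ne_zero.2 (NeZero.ne N)
  have hN' : 0 < N := Nat.pos_of_ne_zero (NeZero.ne N)
  have h1 : ∀ k : ZMod N, (ZMod.stdAddChar k : ℂ) • star (fourierWindow N u k) =
      (N : ℂ)⁻¹ • ∑ j ∈ Finset.range N,
        (ZMod.stdAddChar (k * ((j : ZMod N) + 1)) : ℂ) • star u ^ j := by
    intro k
    rw [star_fourierWindow_eq, smul_comm, Finset.smul_sum]
    refine congrArg _ (Finset.sum_congr rfl fun j _ => ?_)
    rw [smul_smul, ← AddChar.map_add_eq_mul]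
    congr 2
    ring
  simp only [h1]
  rw [← Finset.smul_sum, Finset.sum_comm]
  simp only [← Finset.sum_smul, sum_stdAddChar_mul]
  rw [Finset.sum_eq_single (N - 1)]
  · rw [if_pos, smul_smul, inv_mul_cancel₀ hN, one_smul]
    rw [← Nat.cast_succ, Nat.succ_eq_add_one, Nat.sub_add_cancel hN', ZMod.natCast_self]
  · intro j hj hjN
    rw [if_neg, zero_smul]
    rw [← Nat.cast_succ, ZMod.natCast_eq_zero_iff]
    intro h
    have := Nat.le_of_dvd (Nat.succ_pos _) h
    have := Finset.mem_range.1 hj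
    omega
  · intro h
    exact absurd (Finset.mem_range.2 (by omega)) h

/-- The geometric sum in `q = ω⁻ᵏ u` telescopes against `q - 1`, and `q ^ N = u ^ N`. So the window
is an approximate eigenvector of `u` for `ωᵏ`, with error `O(1/N)`. -/
theorem mul_fourierWindow_sub (u : E) (k : ZMod N) :
    u * fourierWindow N u k - (ZMod.stdAddChar k : ℂ) • fourierWindow N u k =
      ((N : ℂ)⁻¹ * ZMod.stdAddChar k) • (u ^ N - 1) := by
  set q : E := (ZMod.stdAddChar (-k) : ℂ) • u with hq
  have h1 : (ZMod.stdAddChar k : ℂ) * ZMod.stdAddChar (-k) = 1 := by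
    rw [← AddChar.map_add_eq_mul, add_neg_cancel, AddChar.map_zero_eq_one]
  have hu : u = (ZMod.stdAddChar k : ℂ) • q := by rw [hq, smul_smul, h1, one_smul]
  have hqN : q ^ N = u ^ N := by
    rw [hq, smul_pow, ← AddChar.map_nsmul_eq_pow, nsmul_eq_mul, ZMod.natCast_self, zero_mul,
      AddChar.map_zero_eq_one, one_smul]
  have h2 : (q - 1) * ∑ j ∈ Finset.range N, q ^ j = q ^ N - 1 := mul_geom_sum q N
  have h3 : fourierWindow N u k = (N : ℂ)⁻¹ • ∑ j ∈ Finset.range N, q ^ j := rfl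
  have h4 : u * fourierWindow N u k = (ZMod.stdAddChar k : ℂ) • (q * fourierWindow N u k) := by
    conv_lhs => rw [hu]
    rw [smul_mul_assoc, ← hu]
  rw [h4, ← smul_sub, ← hqN, ← h2, h3, mul_smul_comm, ← smul_sub, smul_smul, sub_mul, one_mul,
    mul_comm]

theorem star_mul_self_comm {u : E} (hu : u ∈ unitary E) : Commute (star u) u := by
  rw [Commute, SemiconjBy, Unitary.star_mul_self_of_mem hu, Unitary.mul_star_self_of_mem hu]

theorem commute_fourierWindow (u : E) (k l : ZMod N) :
    Commute (fourierWindow N u k) (fourierWindow N u l) := by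
  refine Commute.smul_left (Commute.smul_right ?_ _) _
  refine Commute.sum_left _ _ _ fun i _ => Commute.sum_right _ _ _ fun j _ => ?_
  exact ((Commute.refl u).smul_left _ |>.smul_right _).pow_pow _ _

theorem commute_star_fourierWindow {u : E} (hu : u ∈ unitary E) (k l : ZMod N) :
    Commute (star (fourierWindow N u k)) (fourierWindow N u l) := by
  rw [star_fourierWindow_eq]
  refine Commute.smul_left (Commute.smul_right ?_ _) _
  refine Commute.sum_left _ _ _ fun i _ => Commute.sum_right _ _ _ fun j _ => ?_
  refine (Commute.smul_left ?_ _)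
  exact ((star_mul_self_comm hu).smul_right _).pow_pow _ _

/-- All windows and their adjoints commute, being polynomials in `u` and `u*`. Double sums over
pairs of windows therefore factor. -/
theorem star_mul_mul_fourierWindow {u : E} (hu : u ∈ unitary E) (k l : ZMod N) :
    star (fourierWindow N u l * fourierWindow N u k) *
        (fourierWindow N u l * fourierWindow N u k) =
      (star (fourierWindow N u k) * fourierWindow N u k) *
        (star (fourierWindow N u l) * fourierWindow N u l) := by
  set g := fourierWindow N u k
  set h := fourierWindow N u l
  have h1 : h * g = g * h := commute_fourierWindow u l k
  have h2 : star h * g = g * star h := commute_star_fourierWindow hu l k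
  rw [h1, star_mul]
  have h3 : star h * star g = star g * star h := by rw [← star_mul, ← star_mul, h1]
  calc star h * star g * (g * h) = star g * (star h * g) * h := by rw [h3]; noncomm_ring
    _ = star g * g * (star h * h) := by rw [h2]; noncomm_ring

theorem sum_star_mul_mul_fourierWindow {u : E} (hu : u ∈ unitary E) :
    ∑ p : ZMod N × ZMod N, star (fourierWindow N u p.2 * fourierWindow N u p.1) *
        (fourierWindow N u p.2 * fourierWindow N u p.1) = 1 := by
  rw [Fintype.sum_prod_type]
  simp only [star_mul_mul_fourierWindow hu]
  rw [← Finset.sum_mul_sum, sum_star_mul_fourierWindow hu, one_mul]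

/-- The first moment of the windows is close to `u`. -/
theorem norm_moment_sub_le {u : E} (hu : u ∈ unitary E) :
    ‖∑ k : ZMod N, (ZMod.stdAddChar k : ℂ) • (star (fourierWindow N u k) * fourierWindow N u k) - u‖
      ≤ 2 / N := by
  -- The eigenvector relation multiplied by `gₖ*`. Summed over `k`, its errors collapse to `N⁻¹`
  -- times a unitary times `u ^ N - 1`, whence `2 / N`.
  have h1 : ∀ k : ZMod N, (ZMod.stdAddChar k : ℂ) •
      (star (fourierWindow N u k) * fourierWindow N u k) =
      (star (fourierWindow N u k) * fourierWindow N u k) * u -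
        ((N : ℂ)⁻¹ • ((ZMod.stdAddChar k : ℂ) • star (fourierWindow N u k))) * (u ^ N - 1) := by
    intro k
    have h2 := mul_fourierWindow_sub u k
    have h3 : Commute u (fourierWindow N u k) := by
      refine Commute.smul_right (Commute.sum_right _ _ _ fun j _ => ?_) _
      exact ((Commute.refl u).smul_right _).pow_right _
    rw [← mul_smul_comm, eq_sub_iff_add_eq, smul_smul, smul_mul_assoc, ← mul_smul_comm, ← h2,
      mul_assoc, ← h3.eq, ← mul_add, add_sub_cancel]
  simp only [h1]
  rw [Finset.sum_sub_distrib, ← Finset.sum_mul, sum_star_mul_fourierWindow hu, one_mul,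
    ← Finset.sum_mul, ← Finset.smul_sum, sum_smul_star_fourierWindow, sub_sub_cancel_left, norm_neg,
    smul_mul_assoc, norm_smul, norm_unitary_mul (pow_mem (Unitary.star_mem hu) _), norm_inv,
    Complex.norm_natCast, div_eq_inv_mul]
  gcongr
  refine (norm_sub_le _ _).trans ?_
  have := norm_unitary_le (pow_mem hu N)
  have := norm_unitary_le (one_mem (unitary E))
  linarith

/-- The windows `gₖ(u)` and `gₗ(u)` are almost orthogonal when `ωᵏ` and `ωˡ` are far apart. -/
theorem norm_spread_le {u : E} (hu : u ∈ unitary E) :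
    ‖∑ p : ZMod N × ZMod N,
      ((‖(ZMod.stdAddChar p.1 : ℂ) - ZMod.stdAddChar p.2‖ ^ 2 : ℝ) : ℂ) •
      (star (fourierWindow N u p.2 * fourierWindow N u p.1) *
        (fourierWindow N u p.2 * fourierWindow N u p.1))‖ ≤ 16 / N := by
  have hN : (1 : ℝ) ≤ N := by exact_mod_cast Nat.pos_of_ne_zero (NeZero.ne N)
  set h : ZMod N → E := fun k => star (fourierWindow N u k) * fourierWindow N u k with hh
  set m : E := ∑ k : ZMod N, (ZMod.stdAddChar k : ℂ) • h k with hm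
  have hsum : ∑ k, h k = 1 := sum_star_mul_fourierWindow hu
  have hm' : star m = ∑ k : ZMod N, star (ZMod.stdAddChar k : ℂ) • h k := by
    rw [hm, star_sum]
    refine Finset.sum_congr rfl fun k _ => ?_
    rw [star_smul]
    simp [hh]
  have hc : ∀ p : ZMod N × ZMod N,
      ((‖(ZMod.stdAddChar p.1 : ℂ) - ZMod.stdAddChar p.2‖ ^ 2 : ℝ) : ℂ) =
      2 - ZMod.stdAddChar p.1 * star (ZMod.stdAddChar p.2 : ℂ)
        - star (ZMod.stdAddChar p.1 : ℂ) * ZMod.stdAddChar p.2 := by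
    intro p
    have h1 : ∀ k : ZMod N, (ZMod.stdAddChar k : ℂ) * star (ZMod.stdAddChar k : ℂ) = 1 := by
      intro k
      rw [Complex.star_def, Complex.mul_conj, Complex.normSq_eq_norm_sq, norm_stdAddChar]; simp
    rw [← Complex.normSq_eq_norm_sq, Complex.normSq_eq_conj_mul_self, map_sub, ← Complex.star_def]
    linear_combination h1 p.1 + h1 p.2
  -- Expanding `|ωᵏ - ωˡ|² = 2 - ωᵏ ω⁻ˡ - ω⁻ᵏ ωˡ` separates the variables and leaves only the first
  -- moment `m`.
  have key : ∑ p : ZMod N × ZMod N,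
      ((‖(ZMod.stdAddChar p.1 : ℂ) - ZMod.stdAddChar p.2‖ ^ 2 : ℝ) : ℂ) •
      (star (fourierWindow N u p.2 * fourierWindow N u p.1) *
        (fourierWindow N u p.2 * fourierWindow N u p.1)) = 2 - m * star m - star m * m := by
    have h2 : (2 : E) = (2 : ℂ) • ((∑ k, h k) * ∑ k, h k) := by
      rw [hsum, one_mul, two_smul, one_add_one_eq_two]
    rw [h2, hm', hm]
    simp only [Finset.sum_mul_sum, Finset.smul_sum, ← Finset.sum_sub_distrib, smul_mul_smul_comm]
    rw [Fintype.sum_prod_type]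
    refine Finset.sum_congr rfl fun k _ => Finset.sum_congr rfl fun l _ => ?_
    rw [star_mul_mul_fourierWindow hu, hc, sub_smul, sub_smul]
  rw [key]
  have hmu : ‖m - u‖ ≤ 2 / N := norm_moment_sub_le hu
  have hu1 := norm_unitary_le hu
  have hm3 : ‖m‖ ≤ 3 := by
    have h3 : (2 : ℝ) / N ≤ 2 := div_le_self (by norm_num) hN
    have h4 := norm_add_le (m - u) u
    rw [sub_add_cancel] at h4
    linarith
  -- The expression vanishes at `m = u`. With `‖m‖ ≤ 3` the four terms cost `3 + 1 + 3 + 1 = 8`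
  -- times `2 / N`.
  have e : 2 - m * star m - star m * m =
      -(m * star (m - u)) - (m - u) * star u - star m * (m - u) - star (m - u) * u := by
    have e1 := Unitary.star_mul_self_of_mem hu
    have e2 := Unitary.mul_star_self_of_mem hu
    rw [star_sub, mul_sub, sub_mul, mul_sub, sub_mul, e1, e2, ← one_add_one_eq_two]
    abel
  rw [e]
  have n1 : ‖m * star (m - u)‖ ≤ 3 * (2 / N) := (norm_mul_le _ _).trans (by
    rw [norm_star]; gcongr)
  have n2 : ‖(m - u) * star u‖ ≤ 2 / N := by rwa [norm_mul_unitary (Unitary.star_mem hu)]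
  have n3 : ‖star m * (m - u)‖ ≤ 3 * (2 / N) := (norm_mul_le _ _).trans (by
    rw [norm_star]; gcongr)
  have n4 : ‖star (m - u) * u‖ ≤ 2 / N := by rwa [norm_mul_unitary hu, norm_star]
  have t1 := norm_sub_le (-(m * star (m - u)) - (m - u) * star u - star m * (m - u))
    (star (m - u) * u)
  have t2 := norm_sub_le (-(m * star (m - u)) - (m - u) * star u) (star m * (m - u))
  have t3 := norm_sub_le (-(m * star (m - u))) ((m - u) * star u)
  rw [norm_neg] at t3
  have : (16 : ℝ) / N = 8 * (2 / N) := by ring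
  rw [this]
  linarith

end Fejer

/-! ### Continuity, near-centrality and rotation of the windows -/

section WindowEstimates

variable {E : Type u} [CStarAlgebra E] {N : ℕ} [NeZero N]

theorem norm_pow_sub_pow_le {u v : E} (hu : u ∈ unitary E) (hv : v ∈ unitary E) (j : ℕ) :
    ‖u ^ j - v ^ j‖ ≤ j * ‖u - v‖ := by
  induction j with
  | zero => simp
  | succ j ih =>
    have e : u ^ (j + 1) - v ^ (j + 1) = u ^ j * (u - v) + (u ^ j - v ^ j) * v := by
      rw [pow_succ, pow_succ]; noncomm_ring
    rw [e]
    refine (norm_add_le _ _).trans ?_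
    rw [norm_unitary_mul (pow_mem hu j), norm_mul_unitary hv]
    push_cast
    linarith

theorem norm_pow_mul_sub_le {u : E} (hu : u ∈ unitary E) (x : E) (j : ℕ) :
    ‖u ^ j * x - x * u ^ j‖ ≤ j * ‖u * x - x * u‖ := by
  induction j with
  | zero => simp
  | succ j ih =>
    have e : u ^ (j + 1) * x - x * u ^ (j + 1) =
        u ^ j * (u * x - x * u) + (u ^ j * x - x * u ^ j) * u := by
      rw [pow_succ]; noncomm_ring
    rw [e]
    refine (norm_add_le _ _).trans ?_
    rw [norm_unitary_mul (pow_mem hu j), norm_mul_unitary hu]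
    push_cast
    linarith

theorem smul_stdAddChar_mem_unitary {u : E} (hu : u ∈ unitary E) (k : ZMod N) :
    (ZMod.stdAddChar k : ℂ) • u ∈ unitary E := by
  have h : star (ZMod.stdAddChar k : ℂ) * ZMod.stdAddChar k = 1 := by
    rw [star_stdAddChar, ← AddChar.map_add_eq_mul, neg_add_cancel, AddChar.map_zero_eq_one]
  rw [Unitary.mem_iff, star_smul, smul_mul_smul_comm, smul_mul_smul_comm, mul_comm _ (star _), h,
    Unitary.star_mul_self_of_mem hu, Unitary.mul_star_self_of_mem hu, one_smul]
  exact ⟨rfl, rfl⟩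

theorem norm_inv_smul_sum_range_le (f : ℕ → E) (C : ℝ) (hf : ∀ j < N, ‖f j‖ ≤ C) :
    ‖(N : ℂ)⁻¹ • ∑ j ∈ Finset.range N, f j‖ ≤ C := by
  have hN : (0 : ℝ) < N := by exact_mod_cast Nat.pos_of_ne_zero (NeZero.ne N)
  rw [norm_smul, norm_inv, Complex.norm_natCast, inv_mul_le_iff₀ hN]
  refine (norm_sum_le_of_le _ fun j hj => hf j (Finset.mem_range.1 hj)).trans ?_
  simp

theorem norm_fourierWindow_le {u : E} (hu : u ∈ unitary E) (k : ZMod N) :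
    ‖fourierWindow N u k‖ ≤ 1 :=
  norm_inv_smul_sum_range_le _ _ fun j _ =>
    norm_unitary_le (pow_mem (smul_stdAddChar_mem_unitary hu _) j)

theorem norm_fourierWindow_sub_le {u v : E} (hu : u ∈ unitary E) (hv : v ∈ unitary E)
    (k : ZMod N) : ‖fourierWindow N u k - fourierWindow N v k‖ ≤ N * ‖u - v‖ := by
  rw [fourierWindow, fourierWindow, ← smul_sub, ← Finset.sum_sub_distrib]
  refine norm_inv_smul_sum_range_le _ _ fun j hj => ?_
  refine (norm_pow_sub_pow_le (smul_stdAddChar_mem_unitary hu _)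
    (smul_stdAddChar_mem_unitary hv _) j).trans ?_
  rw [← smul_sub, norm_smul, norm_stdAddChar, one_mul]
  gcongr

theorem norm_fourierWindow_mul_sub_le {u : E} (hu : u ∈ unitary E) (x : E) (k : ZMod N) :
    ‖fourierWindow N u k * x - x * fourierWindow N u k‖ ≤ N * ‖u * x - x * u‖ := by
  rw [fourierWindow, smul_mul_assoc, mul_smul_comm, ← smul_sub, Finset.sum_mul, Finset.mul_sum,
    ← Finset.sum_sub_distrib]
  refine norm_inv_smul_sum_range_le _ _ fun j hj => ?_
  refine (norm_pow_mul_sub_le (smul_stdAddChar_mem_unitary hu _) x j).trans ?_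
  rw [smul_mul_assoc, mul_smul_comm, ← smul_sub, norm_smul, norm_stdAddChar, one_mul]
  gcongr

/-- Rotating `u` by a root of unity only relabels the windows; invariance of the averages rests on
this. -/
theorem fourierWindow_smul (u : E) (k c : ZMod N) :
    fourierWindow N ((ZMod.stdAddChar c : ℂ) • u) k = fourierWindow N u (k - c) := by
  rw [fourierWindow, fourierWindow, smul_smul, ← AddChar.map_add_eq_mul]
  congr 4
  ring_nf

theorem map_fourierWindow {F : Type u} [CStarAlgebra F] (f : E →⋆ₐ[ℂ] F) (u : E) (k : ZMod N) :
    f (fourierWindow N u k) = fourierWindow N (f u) k := by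
  simp [fourierWindow]

theorem tendsto_mul_mul_zero {ι : Type*} {l : Filter ι} {a b c : ι → E} {Ca Cc : ℝ}
    (ha : ∀ i, ‖a i‖ ≤ Ca) (hb : Tendsto b l (𝓝 0)) (hc : ∀ i, ‖c i‖ ≤ Cc) :
    Tendsto (fun i => a i * b i * c i) l (𝓝 0) := by
  have h : Tendsto (fun i => Ca * ‖b i‖ * Cc) l (𝓝 0) := by
    simpa using (hb.norm.const_mul Ca).mul_const Cc
  refine squeeze_zero_norm (fun i => ?_) h
  have h0 : 0 ≤ Ca := (norm_nonneg _).trans (ha i)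
  refine (norm_mul_le _ _).trans (mul_le_mul ((norm_mul_le _ _).trans ?_) (hc i) (norm_nonneg _)
    (by positivity))
  exact mul_le_mul_of_nonneg_right (ha i) (norm_nonneg _)

theorem norm_starAlgEquiv_apply {F : Type u} [CStarAlgebra F] (e : E ≃⋆ₐ[ℂ] F) (x : E) :
    ‖e x‖ = ‖x‖ := NonUnitalStarAlgHom.norm_map e e.injective x

end WindowEstimates

/-! ### The Rokhlin average and its asymptotic properties -/

section Average

variable {E : Type u} [CStarAlgebra E]

/-- The average `∑ₖ gₖ(u)* β_{ω⁻ᵏ}(x) gₖ(u)` of `x` along the circle action `β`. -/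
noncomputable def rokhlinAverage (β : Circle →* (E ≃⋆ₐ[ℂ] E)) (N : ℕ) [NeZero N] (u x : E) : E :=
  ∑ k : ZMod N, star (fourierWindow N u k) * β (ZMod.toCircle (-k)) x * fourierWindow N u k

variable (β : Circle →* (E ≃⋆ₐ[ℂ] E)) {N : ℕ} [NeZero N]

theorem rokhlinAverage_sub (u x y : E) :
    rokhlinAverage β N u (x - y) = rokhlinAverage β N u x - rokhlinAverage β N u y := by
  simp [rokhlinAverage, mul_sub, sub_mul, Finset.sum_sub_distrib]

theorem rokhlinAverage_star (u x : E) :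
    rokhlinAverage β N u (star x) = star (rokhlinAverage β N u x) := by
  simp [rokhlinAverage, mul_assoc, map_star]

theorem rokhlinAverage_one {u : E} (hu : u ∈ unitary E) : rokhlinAverage β N u 1 = 1 := by
  simp [rokhlinAverage, sum_star_mul_fourierWindow hu]

theorem norm_rokhlinAverage_le {u : E} (hu : u ∈ unitary E) (x : E) :
    ‖rokhlinAverage β N u x‖ ≤ ‖x‖ :=
  norm_sum_conj_le _ _ _ (norm_nonneg x) (fun _ => (norm_starAlgEquiv_apply _ x).le)
    (sum_star_mul_fourierWindow hu)

theorem rokhlinAverage_mem (S : StarSubalgebra ℂ E) {u x : E} (hu : u ∈ S)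
    (hx : ∀ ζ, β ζ x ∈ S) : rokhlinAverage β N u x ∈ S := by
  have hg : ∀ k : ZMod N, fourierWindow N u k ∈ S := fun k =>
    S.smul_mem (sum_mem fun j _ => pow_mem (S.smul_mem hu _) j) _
  exact sum_mem fun k _ => mul_mem (mul_mem (star_mem (hg k)) (hx _)) (hg k)

/-- Close parameters are handled by continuity at `1`, distant ones by the trivial bound `2‖y‖`,
which a multiple of the squared distance dominates. The square is what the overlap estimate for
windows can absorb. -/
theorem exists_quadratic_modulus (hβ : ∀ x, Continuous fun ζ => β ζ x) (y : E) {ε : ℝ}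
    (hε : 0 < ε) : ∃ C : ℝ, 0 ≤ C ∧ ∀ ζ η : Circle,
      ‖β ζ⁻¹ y - β η⁻¹ y‖ ≤ ε + C * ‖(ζ : ℂ) - η‖ ^ 2 := by
  obtain ⟨δ, hδ, h⟩ := Metric.continuousAt_iff.1 ((hβ y).continuousAt (x := 1)) ε hε
  refine ⟨2 * ‖y‖ / δ ^ 2, by positivity, fun ζ η => ?_⟩
  have h1 : ‖β ζ⁻¹ y - β η⁻¹ y‖ = ‖β (η * ζ⁻¹) y - y‖ := by
    rw [← norm_starAlgEquiv_apply (β η), map_sub, ← StarAlgEquiv.mul_apply,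
      ← StarAlgEquiv.mul_apply, ← map_mul, ← map_mul, mul_inv_cancel, map_one]
    rfl
  have h2 : dist (η * ζ⁻¹) 1 = ‖(ζ : ℂ) - η‖ := by
    have h3 : dist (η * ζ⁻¹) 1 = dist ((η * ζ⁻¹ : Circle) : ℂ) ((1 : Circle) : ℂ) := rfl
    rw [h3, dist_eq_norm, Circle.coe_mul, Circle.coe_inv, Circle.coe_one,
      ← mul_one ‖(ζ : ℂ) - η‖, ← Circle.norm_coe ζ⁻¹, ← norm_mul, Circle.coe_inv, sub_mul,
      mul_inv_cancel₀ (Circle.coe_ne_zero ζ), norm_sub_rev]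
  rw [h1]
  by_cases hd : dist (η * ζ⁻¹) 1 < δ
  · have h3 := h hd
    rw [dist_eq_norm, map_one] at h3
    have : 0 ≤ 2 * ‖y‖ / δ ^ 2 * ‖(ζ : ℂ) - η‖ ^ 2 := by positivity
    change ‖β (η * ζ⁻¹) y - y‖ < ε at h3
    linarith
  · rw [h2, not_lt] at hd
    have h3 := norm_sub_le (β (η * ζ⁻¹) y) y
    rw [norm_starAlgEquiv_apply] at h3
    have h4 : 2 * ‖y‖ ≤ 2 * ‖y‖ / δ ^ 2 * ‖(ζ : ℂ) - η‖ ^ 2 := by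
      rw [div_mul_eq_mul_div, le_div_iff₀ (by positivity)]
      gcongr
    linarith

section Asymptotics

variable {ι : Type*} {l : Filter ι} {U : ι → E} (hU : ∀ i, U i ∈ unitary E)
  (hc : ∀ x, Tendsto (fun i => U i * x - x * U i) l (𝓝 0))

include hU hc

theorem tendsto_fourierWindow_commutator (x : E) (k : ZMod N) :
    Tendsto (fun i => fourierWindow N (U i) k * x - x * fourierWindow N (U i) k) l (𝓝 0) :=
  squeeze_zero_norm (fun i => norm_fourierWindow_mul_sub_le (hU i) x k)
    (by simpa using (hc x).norm.const_mul (N : ℝ))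

theorem tendsto_star_fourierWindow_commutator (x : E) (k : ZMod N) :
    Tendsto (fun i => star (fourierWindow N (U i) k) * x - x * star (fourierWindow N (U i) k)) l
      (𝓝 0) := by
  have h := (tendsto_fourierWindow_commutator hU hc (star x) k).star.neg
  rw [star_zero, neg_zero] at h
  refine h.congr fun i => ?_
  simp

/-- For fixed `d` the average is `∑ gₖ* d gₖ`; moving `d` to the left of `gₖ*` costs commutators
tending to zero, and `∑ gₖ* gₖ = 1`. -/
theorem tendsto_rokhlinAverage_of_fixed {d : E} (hd : ∀ ζ, β ζ d = d) :
    Tendsto (fun i => rokhlinAverage β N (U i) d) l (𝓝 d) := by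
  have h1 : ∀ i, rokhlinAverage β N (U i) d = d - ∑ k : ZMod N, star (fourierWindow N (U i) k) *
      (fourierWindow N (U i) k * d - d * fourierWindow N (U i) k) * 1 := by
    intro i
    simp only [rokhlinAverage, hd, mul_one, mul_sub, Finset.sum_sub_distrib, ← mul_assoc,
      ← Finset.sum_mul, sum_star_mul_fourierWindow (hU i), one_mul]
    abel
  simp only [h1]
  have h2 : Tendsto (fun i => ∑ k : ZMod N, star (fourierWindow N (U i) k) *
      (fourierWindow N (U i) k * d - d * fourierWindow N (U i) k) * 1) l (𝓝 0) := by
    rw [← Finset.sum_const_zero (s := (Finset.univ : Finset (ZMod N)))]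
    refine tendsto_finsetSum _ fun k _ => ?_
    exact tendsto_mul_mul_zero (Ca := 1) (Cc := ‖(1 : E)‖)
      (fun i => by rw [norm_star]; exact norm_fourierWindow_le (hU i) k)
      (tendsto_fourierWindow_commutator hU hc d k) (fun _ => le_rfl)
  simpa using tendsto_const_nhds.sub h2

/-- The commutator with `a` is the window-conjugate sum of the commutators of the `β ζ x` with `a`,
of norm at most `M`, up to commutators of the windows with `a`, which vanish in the limit. -/
theorem eventually_norm_rokhlinAverage_commutator_lt {x a : E} {M ε : ℝ} (hM : 0 ≤ M)
    (hε : 0 < ε) (hx : ∀ ζ, ‖β ζ x * a - a * β ζ x‖ ≤ M) :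
    ∀ᶠ i in l, ‖rokhlinAverage β N (U i) x * a - a * rokhlinAverage β N (U i) x‖ < M + ε := by
  let g : ι → ZMod N → E := fun i k => fourierWindow N (U i) k
  let X : ZMod N → E := fun k => β (ZMod.toCircle (-k)) x
  have e : ∀ i, rokhlinAverage β N (U i) x * a - a * rokhlinAverage β N (U i) x =
      (∑ k, star (g i k) * (X k * a - a * X k) * g i k) +
      ∑ k, ((star (g i k) * X k) * (g i k * a - a * g i k) * 1 +
        1 * (star (g i k) * a - a * star (g i k)) * (X k * g i k)) := by
    intro i
    rw [← Finset.sum_add_distrib, rokhlinAverage, Finset.sum_mul, Finset.mul_sum,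
      ← Finset.sum_sub_distrib]
    refine Finset.sum_congr rfl fun k _ => ?_
    simp only [g, X]
    noncomm_ring
  have hg : ∀ i k, ‖g i k‖ ≤ 1 := fun i k => norm_fourierWindow_le (hU i) k
  have hXn : ∀ k, ‖X k‖ ≤ ‖x‖ := fun k => (norm_starAlgEquiv_apply _ x).le
  have h1 : Tendsto (fun i => ∑ k, ((star (g i k) * X k) * (g i k * a - a * g i k) * 1 +
        1 * (star (g i k) * a - a * star (g i k)) * (X k * g i k))) l (𝓝 0) := by
    rw [← Finset.sum_const_zero (s := (Finset.univ : Finset (ZMod N)))]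
    refine tendsto_finsetSum _ fun k _ => ?_
    rw [← add_zero (0 : E)]
    refine Tendsto.add ?_ ?_
    · refine tendsto_mul_mul_zero (Ca := 1 * ‖x‖) (Cc := ‖(1 : E)‖) (fun i => ?_)
        (tendsto_fourierWindow_commutator hU hc a k) (fun _ => le_rfl)
      refine (norm_mul_le _ _).trans ?_
      rw [norm_star]
      exact mul_le_mul (hg i k) (hXn k) (norm_nonneg _) zero_le_one
    · refine tendsto_mul_mul_zero (Ca := ‖(1 : E)‖) (Cc := ‖x‖ * 1) (fun _ => le_rfl)
        (tendsto_star_fourierWindow_commutator hU hc a k) (fun i => ?_)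
      exact (norm_mul_le _ _).trans
        (mul_le_mul (hXn k) (hg i k) (norm_nonneg _) (norm_nonneg _))
  have h2 := Metric.tendsto_nhds.1 h1 ε hε
  filter_upwards [h2] with i hi
  rw [dist_zero_right] at hi
  rw [e]
  have h3 := norm_sum_conj_le (g i) (fun k => X k * a - a * X k) M hM (fun k => hx _)
    (sum_star_mul_fourierWindow (hU i))
  exact (norm_add_le _ _).trans_lt (add_lt_add_of_le_of_lt h3 hi)

omit hc in
-- Applying `β` turns `U` into nearly `ωᶜ U`, which shifts the windows by `c`; the orbit of `x` is
-- shifted by the same amount, so reindexing `k ↦ k - c` gives back the average.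
theorem tendsto_rokhlinAverage_invariance (c : ZMod N)
    (hβU : Tendsto (fun i => β (ZMod.toCircle c) (U i) - (ZMod.stdAddChar c : ℂ) • U i) l (𝓝 0))
    (x : E) :
    Tendsto (fun i => β (ZMod.toCircle c) (rokhlinAverage β N (U i) x) -
      rokhlinAverage β N (U i) x) l (𝓝 0) := by
  let V : ι → E := fun i => β (ZMod.toCircle c) (U i)
  let W : ι → E := fun i => (ZMod.stdAddChar c : ℂ) • U i
  have hV : ∀ i, V i ∈ unitary E := fun i =>
    Unitary.map_mem (β (ZMod.toCircle c)) (hU i)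
  have hW : ∀ i, W i ∈ unitary E := fun i => smul_stdAddChar_mem_unitary (hU i) c
  let X : ZMod N → E := fun k => β (ZMod.toCircle (c - k)) x
  have h1 : ∀ i, β (ZMod.toCircle c) (rokhlinAverage β N (U i) x) =
      ∑ k, star (fourierWindow N (V i) k) * X k * fourierWindow N (V i) k := by
    intro i
    rw [rokhlinAverage, map_sum]
    refine Finset.sum_congr rfl fun k _ => ?_
    have h2 := map_fourierWindow (β (ZMod.toCircle c) : E →⋆ₐ[ℂ] E) (U i) k
    have h2' : β (ZMod.toCircle c) (fourierWindow N (U i) k) = fourierWindow N (V i) k := h2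
    rw [map_mul, map_mul, map_star, h2', ← StarAlgEquiv.mul_apply, ← map_mul,
      ← AddChar.map_add_eq_mul, ← sub_eq_add_neg]
  have h2 : ∀ i, rokhlinAverage β N (U i) x =
      ∑ k, star (fourierWindow N (W i) k) * X k * fourierWindow N (W i) k := by
    intro i
    rw [rokhlinAverage, ← (Equiv.subRight c).sum_comp]
    refine Finset.sum_congr rfl fun k _ => ?_
    simp only [W, X, fourierWindow_smul, Equiv.subRight_apply, neg_sub]
  have h3 : ∀ i, β (ZMod.toCircle c) (rokhlinAverage β N (U i) x) - rokhlinAverage β N (U i) x =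
      ∑ k, ((star (fourierWindow N (V i) k) * X k) *
        (fourierWindow N (V i) k - fourierWindow N (W i) k) * 1 +
        1 * star (fourierWindow N (V i) k - fourierWindow N (W i) k) *
          (X k * fourierWindow N (W i) k)) := by
    intro i
    rw [h1, h2, ← Finset.sum_sub_distrib]
    refine Finset.sum_congr rfl fun k _ => ?_
    rw [star_sub]
    noncomm_ring
  simp only [h3]
  have h4 : ∀ k, Tendsto (fun i => fourierWindow N (V i) k - fourierWindow N (W i) k) l (𝓝 0) :=
    fun k => squeeze_zero_norm (fun i => norm_fourierWindow_sub_le (hV i) (hW i) k)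
      (by simpa using hβU.norm.const_mul (N : ℝ))
  have hXn : ∀ k, ‖X k‖ ≤ ‖x‖ := fun k => (norm_starAlgEquiv_apply _ x).le
  rw [← Finset.sum_const_zero (s := (Finset.univ : Finset (ZMod N)))]
  refine tendsto_finsetSum _ fun k _ => ?_
  rw [← add_zero (0 : E)]
  refine Tendsto.add ?_ ?_
  · refine tendsto_mul_mul_zero (Ca := 1 * ‖x‖) (Cc := ‖(1 : E)‖) (fun i => ?_)
      (h4 k) (fun _ => le_rfl)
    refine (norm_mul_le _ _).trans ?_
    rw [norm_star]
    exact mul_le_mul (norm_fourierWindow_le (hV i) k) (hXn k) (norm_nonneg _) zero_le_one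
  · refine tendsto_mul_mul_zero (Ca := ‖(1 : E)‖) (Cc := ‖x‖ * 1) (fun _ => le_rfl)
      (by simpa using (h4 k).star) (fun i => ?_)
    exact (norm_mul_le _ _).trans
      (mul_le_mul (hXn k) (norm_fourierWindow_le (hW i) k) (norm_nonneg _) (norm_nonneg _))

/-- Up to an error tending to zero along the net, the defect of multiplicativity of the average is
a sum of conjugates of the oscillations `x_k (y_k - y_l)`. -/
theorem tendsto_rokhlinAverage_mul_defect (x y : E) :
    Tendsto (fun i => rokhlinAverage β N (U i) (x * y) -
      rokhlinAverage β N (U i) x * rokhlinAverage β N (U i) y -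
      ∑ p : ZMod N × ZMod N, star (fourierWindow N (U i) p.2 * fourierWindow N (U i) p.1) *
        (β (ZMod.toCircle (-p.1)) x *
          (β (ZMod.toCircle (-p.1)) y - β (ZMod.toCircle (-p.2)) y)) *
        (fourierWindow N (U i) p.2 * fourierWindow N (U i) p.1)) l (𝓝 0) := by
  let g : ι → ZMod N → E := fun i k => fourierWindow N (U i) k
  let X : ZMod N → E := fun k => β (ZMod.toCircle (-k)) x
  let Y : ZMod N → E := fun k => β (ZMod.toCircle (-k)) y
  have hg : ∀ i k, ‖g i k‖ ≤ 1 := fun i k => norm_fourierWindow_le (hU i) k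
  have hgs : ∀ i k, ‖star (g i k)‖ ≤ 1 := fun i k => (norm_star _).trans_le (hg i k)
  have hX : ∀ k, ‖X k‖ ≤ ‖x‖ := fun k => (norm_starAlgEquiv_apply _ x).le
  have hY : ∀ k, ‖Y k‖ ≤ ‖y‖ := fun k => (norm_starAlgEquiv_apply _ y).le
  -- Insert `∑ᵣ gᵣ* gᵣ = 1` into the average of `x y` and bring both sides to the form `(gᵣ gₖ)* ·
  -- (gᵣ gₖ)`. What is left involves only commutators of windows with fixed elements.
  have e : ∀ i, rokhlinAverage β N (U i) (x * y) -
      rokhlinAverage β N (U i) x * rokhlinAverage β N (U i) y -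
      ∑ p : ZMod N × ZMod N, star (g i p.2 * g i p.1) *
        (X p.1 * (Y p.1 - Y p.2)) * (g i p.2 * g i p.1) =
      ∑ k, ∑ r, ((star (g i k) * star (g i r)) *
          (g i r * (X k * Y k) - (X k * Y k) * g i r) * g i k
        + star (g i k) * (star (g i r) * X k - X k * star (g i r)) * (g i k * Y r * g i r)
        - (star (g i k) * star (g i r) * X k) * (g i k * Y r - Y r * g i k) * g i r) := by
    intro i
    have h1 : rokhlinAverage β N (U i) (x * y) =
        ∑ k, ∑ r, star (g i k) * (star (g i r) * g i r) * (X k * Y k) * g i k := by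
      rw [rokhlinAverage]
      refine Finset.sum_congr rfl fun k _ => ?_
      rw [← Finset.sum_mul, ← Finset.sum_mul, ← Finset.mul_sum]
      simp only [g, X, Y]
      rw [sum_star_mul_fourierWindow (hU i), mul_one, map_mul]
    have h2 : rokhlinAverage β N (U i) x * rokhlinAverage β N (U i) y =
        ∑ k, ∑ r, (star (g i k) * X k * g i k) * (star (g i r) * Y r * g i r) :=
      Finset.sum_mul_sum _ _ _ _
    rw [h1, h2, Fintype.sum_prod_type, ← Finset.sum_sub_distrib, ← Finset.sum_sub_distrib]
    refine Finset.sum_congr rfl fun k _ => ?_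
    rw [← Finset.sum_sub_distrib, ← Finset.sum_sub_distrib]
    refine Finset.sum_congr rfl fun r _ => ?_
    have c1 : g i r * g i k = g i k * g i r := commute_fourierWindow (U i) r k
    have c2 : star (g i r) * g i k = g i k * star (g i r) :=
      commute_star_fourierWindow (hU i) r k
    have c3 : star (g i r * g i k) = star (g i k) * star (g i r) := star_mul _ _
    have c4 : star (g i k) * X k * g i k * (star (g i r) * Y r * g i r) =
        star (g i k) * X k * star (g i r) * g i k * Y r * g i r := by
      calc _ = star (g i k) * X k * (g i k * star (g i r)) * Y r * g i r := by noncomm_ring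
        _ = _ := by rw [← c2]; noncomm_ring
    have c5 : star (g i r * g i k) * (X k * (Y k - Y r)) * (g i r * g i k) =
        star (g i k) * star (g i r) * X k * Y k * g i r * g i k -
        star (g i k) * star (g i r) * X k * Y r * g i k * g i r := by
      calc _ = star (g i k) * star (g i r) * X k * Y k * g i r * g i k -
          star (g i k) * star (g i r) * X k * Y r * (g i r * g i k) := by
            rw [c3]; noncomm_ring
        _ = _ := by rw [c1]; noncomm_ring
    rw [c4, c5]
    noncomm_ring
  refine Tendsto.congr (fun i => (e i).symm) ?_
  rw [← Finset.sum_const_zero (s := (Finset.univ : Finset (ZMod N)))]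
  refine tendsto_finsetSum _ fun k _ => ?_
  rw [← Finset.sum_const_zero (s := (Finset.univ : Finset (ZMod N)))]
  refine tendsto_finsetSum _ fun r _ => ?_
  rw [show (0 : E) = 0 + 0 - 0 by simp]
  have n2 : ∀ (a b : E) {α β : ℝ}, ‖a‖ ≤ α → ‖b‖ ≤ β → ‖a * b‖ ≤ α * β :=
    fun a b α β ha hb => (norm_mul_le _ _).trans
      (mul_le_mul ha hb (norm_nonneg _) ((norm_nonneg _).trans ha))
  refine Tendsto.sub (Tendsto.add ?_ ?_) ?_
  · exact tendsto_mul_mul_zero (fun i => n2 _ _ (hgs i k) (hgs i r))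
      (tendsto_fourierWindow_commutator hU hc _ r) (fun i => hg i k)
  · exact tendsto_mul_mul_zero (fun i => hgs i k)
      (tendsto_star_fourierWindow_commutator hU hc _ r)
      (fun i => n2 _ _ (n2 _ _ (hg i k) (hY r)) (hg i r))
  · exact tendsto_mul_mul_zero (fun i => n2 _ _ (n2 _ _ (hgs i k) (hgs i r)) (hX k))
      (tendsto_fourierWindow_commutator hU hc _ k) (fun i => hg i r)

/-- The averages are asymptotically multiplicative. -/
theorem exists_norm_rokhlinAverage_mul_sub_lt (hβ : ∀ x, Continuous fun ζ => β ζ x) (x y : E)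
    {ε : ℝ} (hε : 0 < ε) : ∃ N₀ : ℕ, ∀ (N : ℕ) [NeZero N], N₀ ≤ N → ∀ᶠ i in l,
      ‖rokhlinAverage β N (U i) (x * y) -
        rokhlinAverage β N (U i) x * rokhlinAverage β N (U i) y‖ < ε := by
  -- The oscillation sum costs `(‖x‖ + 1) * 2δ = ε / 2`; the other `ε / 2` is for the vanishing
  -- error.
  set δ : ℝ := ε / (4 * (‖x‖ + 1)) with hδ
  have hx1 : 0 < ‖x‖ + 1 := by positivity
  have hδ0 : 0 < δ := by positivity
  obtain ⟨C, hC, hmod⟩ := exists_quadratic_modulus β hβ y hδ0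
  -- The quadratic term of the modulus, summed over pairs of windows, contributes `C * (16 / N)`,
  -- which must not exceed `δ`.
  obtain ⟨N₀, hN₀⟩ := exists_nat_gt (16 * C / δ)
  refine ⟨N₀, fun N _ hN => ?_⟩
  have hN0 : (0 : ℝ) < N := by exact_mod_cast Nat.pos_of_ne_zero (NeZero.ne N)
  have hCN : C * (16 / N) ≤ δ := by
    have h1 : 16 * C / δ < N := hN₀.trans_le (by exact_mod_cast hN)
    rw [div_lt_iff₀ hδ0] at h1
    rw [← mul_div_assoc, div_le_iff₀ hN0]
    linarith
  have h1 := Metric.tendsto_nhds.1 (tendsto_rokhlinAverage_mul_defect (N := N) β hU hc x y)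
    (ε / 2) (half_pos hε)
  filter_upwards [h1] with i hi
  rw [dist_zero_right] at hi
  let c : ZMod N × ZMod N → E := fun p => fourierWindow N (U i) p.2 * fourierWindow N (U i) p.1
  let z : ZMod N × ZMod N → E := fun p => β (ZMod.toCircle (-p.1)) x *
          (β (ZMod.toCircle (-p.1)) y - β (ZMod.toCircle (-p.2)) y)
  let w : ZMod N × ZMod N → ℝ := fun p => (‖x‖ + 1) * (δ + C *
    ‖(ZMod.stdAddChar p.1 : ℂ) - ZMod.stdAddChar p.2‖ ^ 2)
  have hz : ∀ p, ‖z p‖ ≤ w p := by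
    intro p
    refine (norm_mul_le _ _).trans ?_
    rw [norm_starAlgEquiv_apply]
    refine mul_le_mul (by linarith) ?_ (norm_nonneg _) hx1.le
    have := hmod (ZMod.toCircle p.1) (ZMod.toCircle p.2)
    rwa [← AddChar.map_neg_eq_inv, ← AddChar.map_neg_eq_inv] at this
  have h2 := norm_sum_conj_le_weighted c z w hz
  have h3 : ∑ p, (w p : ℂ) • (star (c p) * c p) = ((‖x‖ + 1 : ℝ) : ℂ) • ((δ : ℂ) • 1 +
      (C : ℂ) • ∑ p : ZMod N × ZMod N,
        ((‖(ZMod.stdAddChar p.1 : ℂ) - ZMod.stdAddChar p.2‖ ^ 2 : ℝ) : ℂ) •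
        (star (c p) * c p)) := by
    rw [← sum_star_mul_mul_fourierWindow (N := N) (hU i), Finset.smul_sum, Finset.smul_sum,
      ← Finset.sum_add_distrib, Finset.smul_sum]
    refine Finset.sum_congr rfl fun p _ => ?_
    rw [smul_smul (C : ℂ), ← add_smul, smul_smul]
    congr 1
    simp only [w]
    push_cast
    ring
  have h4 : ‖∑ p, (w p : ℂ) • (star (c p) * c p)‖ ≤ (‖x‖ + 1) * (δ + δ) := by
    rw [h3, norm_smul, Complex.norm_real, Real.norm_of_nonneg hx1.le]
    gcongr
    refine (norm_add_le _ _).trans (add_le_add ?_ ?_)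
    · rw [norm_smul, Complex.norm_real, Real.norm_of_nonneg hδ0.le]
      exact mul_le_of_le_one_right hδ0.le (norm_unitary_le (one_mem (unitary E)))
    · rw [norm_smul, Complex.norm_real, Real.norm_of_nonneg hC]
      exact (mul_le_mul_of_nonneg_left (norm_spread_le (hU i)) hC).trans hCN
  have h5 : (‖x‖ + 1) * (δ + δ) = ε / 2 := by rw [hδ]; field_simp; ring
  rw [h5] at h4
  have h6 := norm_add_le _ (∑ p, star (c p) * z p * c p) |>.trans_lt
    (add_lt_add_of_lt_of_le hi (h2.trans h4))
  rw [add_halves] at h6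
  refine lt_of_le_of_lt (le_of_eq (congrArg _ ?_)) h6
  exact (sub_add_cancel _ _).symm

end Asymptotics

end Average

/-! ### Perturbing almost unitary elements to unitaries -/

section Polar

attribute [local instance] CStarAlgebra.spectralOrder CStarAlgebra.spectralOrderedRing

variable {E : Type u} [CStarAlgebra E]

/-- On the spectrum, `|1 - t| = |1 - √t| (1 + √t) ≥ |1 - √t|`. -/
theorem norm_one_sub_sqrt_le {a : E} (ha : 0 ≤ a) : ‖1 - CFC.sqrt a‖ ≤ ‖1 - a‖ := by
  nontriviality E
  have hsa : IsSelfAdjoint a := IsSelfAdjoint.of_nonneg ha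
  have h1 : 1 - CFC.sqrt a = cfc (fun t : ℝ => 1 - √t) a := by
    rw [cfc_sub _ _ a, cfc_const_one ℝ a, CFC.sqrt_eq_real_sqrt a, cfcₙ_eq_cfc]
  rw [h1]
  refine norm_cfc_le (norm_nonneg _) fun t ht => ?_
  have ht0 : 0 ≤ t := spectrum_nonneg_of_nonneg ha ht
  have h2 : 1 - t ∈ spectrum ℝ (1 - a) := by
    have h3 := spectrum.singleton_sub_eq a (1 : ℝ)
    rw [map_one] at h3
    rw [← h3]
    exact ⟨1, rfl, t, ht, rfl⟩
  have h4 := spectrum.norm_le_norm_of_mem h2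
  refine le_trans ?_ h4
  rw [Real.norm_eq_abs, Real.norm_eq_abs]
  have h5 : 1 - t = (1 - √t) * (1 + √t) := by
    have := Real.mul_self_sqrt ht0
    linear_combination this
  rw [h5, abs_mul]
  refine le_mul_of_one_le_right (abs_nonneg _) ?_
  rw [abs_of_nonneg (by positivity)]
  linarith [Real.sqrt_nonneg t]

/-- An approximately unitary element is close to a unitary. -/
theorem exists_unitary_norm_sub_le {x : E} {ε : ℝ} (hε : ε < 1) (h1 : ‖1 - star x * x‖ ≤ ε)
    (h2 : ‖1 - x * star x‖ ≤ ε) : ∃ w ∈ unitary E, ‖w - x‖ ≤ ε := by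
  have hu : ∀ a : E, ‖1 - a‖ < 1 → IsUnit a := fun a ha =>
    ⟨Units.oneSub (1 - a) ha, by simp⟩
  have ha : 0 ≤ star x * x := star_mul_self_nonneg x
  have hau : IsUnit (star x * x) := hu _ (h1.trans_lt hε)
  have hbu : IsUnit (x * star x) := hu _ (h2.trans_lt hε)
  have hxu : IsUnit x := by
    rw [isUnit_iff_exists_and_exists]
    obtain ⟨a, ha⟩ := hau
    obtain ⟨b, hb⟩ := hbu
    refine ⟨⟨star x * ↑b⁻¹, ?_⟩, ⟨↑a⁻¹ * star x, ?_⟩⟩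
    · rw [← mul_assoc, ← hb, Units.mul_inv]
    · rw [mul_assoc, ← ha, Units.inv_mul]
  obtain ⟨s, hs⟩ := (CFC.isUnit_sqrt_iff (star x * x) ha).2 hau
  have hss : (s : E) * s = star x * x := by rw [hs]; exact CFC.sqrt_mul_sqrt_self _ ha
  have hsa : star (s : E) = s := by
    rw [hs]; exact (IsSelfAdjoint.of_nonneg (CFC.sqrt_nonneg _)).star_eq
  have hsi : star (↑s⁻¹ : E) = ↑s⁻¹ := by
    have h3 : star (↑s⁻¹ : E) * s = 1 := by
      rw [← hsa, ← star_mul, Units.mul_inv, star_one]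
    exact (Units.inv_eq_of_mul_eq_one_left h3).symm
  -- The unitary polar part `x |x|⁻¹`; it differs from `x` by `w (1 - |x|)`.
  set w : E := x * ↑s⁻¹ with hw
  have hw1 : star w * w = 1 := by
    rw [hw, star_mul, hsi]
    calc (↑s⁻¹ : E) * star x * (x * ↑s⁻¹) = ↑s⁻¹ * (star x * x) * ↑s⁻¹ := by noncomm_ring
      _ = (↑s⁻¹ * ↑s) * (↑s * ↑s⁻¹) := by rw [← hss]; noncomm_ring
      _ = 1 := by simp
  have hw2 : w * star w = 1 := by
    have : IsUnit w := hxu.mul s⁻¹.isUnit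
    obtain ⟨y, hy⟩ := this
    rw [← hy] at hw1 ⊢
    rw [← Units.inv_eq_of_mul_eq_one_left hw1, Units.mul_inv]
  have hwm : w ∈ unitary E := Unitary.mem_iff.2 ⟨hw1, hw2⟩
  refine ⟨w, hwm, ?_⟩
  have h3 : w - x = w * (1 - CFC.sqrt (star x * x)) := by
    rw [mul_sub, mul_one, ← hs, hw, mul_assoc, Units.inv_mul, mul_one]
  rw [h3, norm_unitary_mul hwm]
  exact (norm_one_sub_sqrt_le ha).trans h1

end Polar

/-! ### Averaging a unitary to an almost invariant one -/

section InvariantUnitary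

variable {E : Type u} [CStarAlgebra E]

/-- The `n`-th roots of unity sit among the `nm`-th ones, so a fine averaging grid can still be
permuted by `ℤ/n`. -/
theorem toCircle_eq_toCircle_mul (n m : ℕ) [NeZero n] [NeZero m] (c : ZMod n) :
    ZMod.toCircle c = ZMod.toCircle ((m * c.val : ℕ) : ZMod (n * m)) := by
  ext
  rw [ZMod.toCircle_natCast, ZMod.toCircle_apply]
  have hm : (m : ℂ) ≠ 0 := Nat.cast_ne_zero.2 (NeZero.ne m)
  have hn : (n : ℂ) ≠ 0 := Nat.cast_ne_zero.2 (NeZero.ne n)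
  congr 1
  push_cast
  field_simp

theorem norm_conj_sub_conj_le {w x : E} (hw : ‖w‖ ≤ 1) (hx : ‖x‖ ≤ 1) (d : E) :
    ‖star w * d * w - star x * d * x‖ ≤ 2 * (‖w - x‖ * ‖d‖) := by
  have e : star w * d * w - star x * d * x = star (w - x) * d * w + star x * d * (w - x) := by
    rw [star_sub]; noncomm_ring
  rw [e]
  have h1 : ‖star (w - x) * d * w‖ ≤ ‖w - x‖ * ‖d‖ * 1 := by
    refine (norm_mul_le _ _).trans (mul_le_mul ((norm_mul_le _ _).trans ?_) hw (norm_nonneg _)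
      (by positivity))
    rw [norm_star]
  have h2 : ‖star x * d * (w - x)‖ ≤ 1 * ‖d‖ * ‖w - x‖ := by
    refine (norm_mul_le _ _).trans (mul_le_mul_of_nonneg_right ((norm_mul_le _ _).trans ?_)
      (norm_nonneg _))
    rw [norm_star]
    exact mul_le_mul_of_nonneg_right hx (norm_nonneg _)
  refine (norm_add_le _ _).trans ((add_le_add h1 h2).trans_eq ?_)
  ring

theorem norm_commutator_le {w x : E} (a : E) :
    ‖w * a - a * w‖ ≤ ‖x * a - a * x‖ + 2 * (‖w - x‖ * ‖a‖) := by
  have e : w * a - a * w = (x * a - a * x) + ((w - x) * a - a * (w - x)) := by noncomm_ring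
  rw [e]
  refine (norm_add_le _ _).trans (add_le_add_right ((norm_sub_le _ _).trans ?_) _)
  have h1 := norm_mul_le (w - x) a
  have h2 := norm_mul_le a (w - x)
  linarith

/-- A circle action with asymptotically central Rokhlin unitaries: a unitary `v` can be averaged to
an almost `ℤ/n`-invariant unitary, keeping approximate commutation relations with elements that
almost commute with the orbit of `v`, and keeping the property of conjugating fixed points close to
an invariant subalgebra which contains the Rokhlin unitaries. -/
theorem exists_almost_invariant_unitary (β : Circle →* (E ≃⋆ₐ[ℂ] E))
    (hβ : ∀ x, Continuous fun ζ => β ζ x) {ι : Type*} {l : Filter ι} [l.NeBot] {U : ι → E}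
    (hU : ∀ i, U i ∈ unitary E) (hc : ∀ x, Tendsto (fun i => U i * x - x * U i) l (𝓝 0))
    (hβU : ∀ ζ : Circle, Tendsto (fun i => β ζ (U i) - (ζ : ℂ) • U i) l (𝓝 0))
    (S : StarSubalgebra ℂ E) (hUS : ∀ i, U i ∈ S) (hβS : ∀ ζ, ∀ x ∈ S, β ζ x ∈ S)
    (n : ℕ) [NeZero n] {v : E} (hv : v ∈ unitary E) (F T : Finset E)
    (hT : ∀ d ∈ T, ∀ ζ, β ζ d = d) {ε : ℝ} (hε : 0 < ε)
    (hF : ∀ a ∈ F, ∀ ζ, ‖β ζ v * a - a * β ζ v‖ ≤ ε)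
    (hvT : ∀ d ∈ T, ∃ x ∈ S, ‖star v * d * v - x‖ ≤ ε) :
    ∃ w ∈ unitary E, (∀ c : ZMod n, ‖β (ZMod.toCircle c) w - w‖ < 2 * ε) ∧
      (∀ a ∈ F, ‖w * a - a * w‖ < 2 * ε) ∧
      ∀ d ∈ T, ∃ x ∈ S, ‖star w * d * w - x‖ < 2 * ε := by
  classical
  obtain ⟨R, hR1, hR⟩ : ∃ R : ℝ, 1 ≤ R ∧ ∀ a ∈ F ∪ T, ‖a‖ ≤ R := by
    refine ⟨1 + ∑ a ∈ F ∪ T, ‖a‖, ?_, fun a ha => ?_⟩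
    · linarith [Finset.sum_nonneg fun a (_ : a ∈ F ∪ T) => norm_nonneg a]
    · linarith [Finset.single_le_sum (fun a (_ : a ∈ F ∪ T) => norm_nonneg a) ha]
  -- The most expensive estimate below adds `2ηR + 3η ≤ 5ηR ≤ ε / 2` to `ε`; `η < 1` is needed for
  -- the polar part.
  obtain ⟨η, hη, hη1, hηε⟩ : ∃ η : ℝ, 0 < η ∧ η < 1 ∧ η * (10 * R) ≤ ε := by
    refine ⟨min (1 / 2) (ε / (10 * R)), by positivity, ?_, ?_⟩
    · exact (min_le_left _ _).trans_lt (by norm_num)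
    · rw [← le_div_iff₀ (by positivity)]; exact min_le_right _ _
  have hηR : η ≤ η * R := le_mul_of_one_le_right hη.le hR1
  -- The products on which the average must be almost multiplicative: `v* v` and `v v*` make the
  -- average of `v` almost unitary, `v* d` and `(v* d) v` control the conjugates of `d`.
  let P : Finset (E × E) := {(star v, v), (v, star v)} ∪
    (T.image (fun d => (star v, d)) ∪ T.image fun d => (star v * d, v))
  choose N₀ hN₀ using fun p : E × E =>
    exists_norm_rokhlinAverage_mul_sub_lt β hU hc hβ p.1 p.2 hη
  let m : ℕ := P.sup N₀ + 1
  have : NeZero m := ⟨Nat.succ_ne_zero _⟩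
  -- A multiple of `n`, so that `ℤ/n` permutes the windows, and at least `m`, which exceeds every
  -- threshold `N₀ p`.
  let N : ℕ := n * m
  have hmN : m ≤ N := Nat.le_mul_of_pos_left m (Nat.pos_of_ne_zero (NeZero.ne n))
  have hmul : ∀ᶠ i in l, ∀ p ∈ P, ‖rokhlinAverage β N (U i) (p.1 * p.2) -
      rokhlinAverage β N (U i) p.1 * rokhlinAverage β N (U i) p.2‖ < η :=
    P.eventually_all.2 fun p hp => hN₀ p N
      (((Finset.le_sup hp).trans (Nat.le_succ _)).trans hmN)
  have hinv : ∀ᶠ i in l, ∀ c : ZMod n, ‖β (ZMod.toCircle c) (rokhlinAverage β N (U i) v) -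
      rokhlinAverage β N (U i) v‖ < η := by
    refine eventually_all.2 fun c => ?_
    have h1 := tendsto_rokhlinAverage_invariance (N := N) β hU ((m * c.val : ℕ) : ZMod N)
      (hβU _) v
    rw [← toCircle_eq_toCircle_mul] at h1
    simpa only [dist_zero_right] using Metric.tendsto_nhds.1 h1 η hη
  have hcomm : ∀ᶠ i in l, ∀ a ∈ F, ‖rokhlinAverage β N (U i) v * a -
      a * rokhlinAverage β N (U i) v‖ < ε + η :=
    F.eventually_all.2 fun a ha =>
      eventually_norm_rokhlinAverage_commutator_lt β hU hc hε.le hη (hF a ha)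
  have hfix : ∀ᶠ i in l, ∀ d ∈ T, ‖rokhlinAverage β N (U i) d - d‖ < η := by
    refine T.eventually_all.2 fun d hd => ?_
    simpa only [dist_eq_norm] using
      Metric.tendsto_nhds.1 (tendsto_rokhlinAverage_of_fixed (N := N) β hU hc (hT d hd)) η hη
  obtain ⟨i, hmul, hinv, hcomm, hfix⟩ := (hmul.and (hinv.and (hcomm.and hfix))).exists
  set y : E := rokhlinAverage β N (U i) v with hy
  have hys : rokhlinAverage β N (U i) (star v) = star y := rokhlinAverage_star β _ _
  have hy1 : ‖y‖ ≤ 1 := (norm_rokhlinAverage_le β (hU i) v).trans (norm_unitary_le hv)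
  have hP1 := hmul (star v, v) (by simp [P])
  have hP2 := hmul (v, star v) (by simp [P])
  rw [Unitary.star_mul_self_of_mem hv, rokhlinAverage_one β (hU i), hys] at hP1
  rw [Unitary.mul_star_self_of_mem hv, rokhlinAverage_one β (hU i), hys] at hP2
  obtain ⟨w, hw, hwy⟩ := exists_unitary_norm_sub_le hη1 hP1.le hP2.le
  refine ⟨w, hw, fun c => ?_, fun a ha => ?_, fun d hd => ?_⟩
  · have e : β (ZMod.toCircle c) w - w =
        β (ZMod.toCircle c) (w - y) + (β (ZMod.toCircle c) y - y) - (w - y) := by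
      rw [map_sub]; abel
    rw [e]
    have h1 := norm_sub_le (β (ZMod.toCircle c) (w - y) + (β (ZMod.toCircle c) y - y)) (w - y)
    have h2 := norm_add_le (β (ZMod.toCircle c) (w - y)) (β (ZMod.toCircle c) y - y)
    rw [norm_starAlgEquiv_apply] at h2
    linarith [hinv c]
  · have h1 := norm_commutator_le (w := w) (x := y) a
    have h2 : ‖w - y‖ * ‖a‖ ≤ η * R :=
      mul_le_mul hwy (hR a (Finset.mem_union_left _ ha)) (norm_nonneg _) hη.le
    linarith [hcomm a ha]
  · obtain ⟨x, hx, hxd⟩ := hvT d hd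
    refine ⟨rokhlinAverage β N (U i) x, rokhlinAverage_mem β S (hUS i) (fun ζ => hβS ζ x hx), ?_⟩
    have hP3 := hmul (star v, d) (Finset.mem_union_right _ (Finset.mem_union_left _
      (Finset.mem_image_of_mem _ hd)))
    have hP4 := hmul (star v * d, v) (Finset.mem_union_right _ (Finset.mem_union_right _
      (Finset.mem_image_of_mem _ hd)))
    simp only [hys] at hP3 hP4
    have h1 := norm_conj_sub_conj_le (norm_unitary_le hw) hy1 d
    have h2 : ‖w - y‖ * ‖d‖ ≤ η * R :=
      mul_le_mul hwy (hR d (Finset.mem_union_right _ hd)) (norm_nonneg _) hη.le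
    have h3 : ‖rokhlinAverage β N (U i) (star v * d * v) - rokhlinAverage β N (U i) x‖ ≤ ε := by
      rw [← rokhlinAverage_sub]
      exact (norm_rokhlinAverage_le β (hU i) _).trans hxd
    set A := rokhlinAverage β N (U i)
    -- The chain `w* d w ≈ y* d y ≈ y* A(d) y ≈ A(v* d) y ≈ A(v* d v) ≈ A(x)`.
    have e : star w * d * w - A x = (star w * d * w - star y * d * y)
        - star y * (A d - d) * y - (A (star v * d) - star y * A d) * y
        - (A (star v * d * v) - A (star v * d) * y) + (A (star v * d * v) - A x) := by
      noncomm_ring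
    have n1 : ‖star y * (A d - d) * y‖ ≤ 1 * η * 1 := by
      refine (norm_mul_le _ _).trans (mul_le_mul ((norm_mul_le _ _).trans ?_) hy1 (norm_nonneg _)
        (by positivity))
      rw [norm_star]
      exact mul_le_mul hy1 (hfix d hd).le (norm_nonneg _) zero_le_one
    have n2 : ‖(A (star v * d) - star y * A d) * y‖ ≤ η * 1 :=
      (norm_mul_le _ _).trans (mul_le_mul hP3.le hy1 (norm_nonneg _) hη.le)
    have n3 : ‖A (star v * d * v) - A (star v * d) * y‖ ≤ η := hP4.le
    have t1 := norm_add_le ((star w * d * w - star y * d * y)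
        - star y * (A d - d) * y - (A (star v * d) - star y * A d) * y
        - (A (star v * d * v) - A (star v * d) * y)) (A (star v * d * v) - A x)
    have t2 := norm_sub_le ((star w * d * w - star y * d * y)
        - star y * (A d - d) * y - (A (star v * d) - star y * A d) * y)
        (A (star v * d * v) - A (star v * d) * y)
    have t3 := norm_sub_le ((star w * d * w - star y * d * y)
        - star y * (A d - d) * y) ((A (star v * d) - star y * A d) * y)
    have t4 := norm_sub_le (star w * d * w - star y * d * y) (star y * (A d - d) * y)
    rw [e]
    linarith

end InvariantUnitary

/-! ### Representations from positive functionals -/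

section GNS

attribute [local instance] CStarAlgebra.spectralOrder CStarAlgebra.spectralOrderedRing

open scoped ComplexOrder in
/-- A positive functional with `f(b* b) ≠ 0` yields a representation which does not vanish at `b`. -/
theorem exists_hilbertRep_ne_zero {B : Type u} [CStarAlgebra B] (f : B →ₗ[ℂ] ℂ)
    (hf : ∀ b, 0 ≤ f (star b * b)) {b : B} (hb : f (star b * b) ≠ 0) :
    ∃ π : HilbertRep B, π.rep b ≠ 0 := by
  let F : B →ₚ[ℂ] ℂ := PositiveLinearMap.mk₀ f fun x hx => by
    obtain ⟨y, rfl⟩ := CStarAlgebra.nonneg_iff_eq_star_mul_self.1 hx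
    exact hf y
  refine ⟨{ space := F.GNS, rep := F.gnsStarAlgHom }, fun h => hb ?_⟩
  -- The operator of `b` sends the class of `1` to the class of `b`, whose squared norm is `f (b*
  -- b)`.
  have h1 : F.gnsStarAlgHom b ((F.toPreGNS 1 : F.PreGNS) : F.GNS) = 0 := by
    change F.gnsStarAlgHom b = 0 at h
    rw [h]; rfl
  have h2 : F.gnsStarAlgHom b ((F.toPreGNS 1 : F.PreGNS) : F.GNS) =
      ((F.toPreGNS b : F.PreGNS) : F.GNS) := by
    refine (PositiveLinearMap.gnsNonUnitalStarAlgHom_apply_coe F).trans ?_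
    rw [PositiveLinearMap.leftMulMapPreGNS_apply]
    simp
  rw [h2] at h1
  have h3 : ‖(F.toPreGNS b : F.PreGNS)‖ = 0 := by
    rw [← UniformSpace.Completion.norm_coe, h1, norm_zero]
  have h4 := PositiveLinearMap.preGNS_norm_sq F (F.toPreGNS b)
  rw [h3] at h4
  have h5 : F (star b * b) = 0 := by simpa using h4.symm
  exact h5

end GNS

/-! ### The crossed product: covariance, density of generators, separating representations -/

namespace CrossedProduct

variable {A : Type u} [CStarAlgebra A] {G : Type} [Group G] [Fintype G] [DecidableEq G]
  (α : G →* (A ≃⋆ₐ[ℂ] A))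

section

attribute [local instance] CStarAlgebra.spectralOrder CStarAlgebra.spectralOrderedRing

/-- The inclusion of the crossed product in the matrices over `A`. -/
noncomputable def val : CrossedProduct α →⋆ₐ[ℂ] CStarMatrix G G A :=
  StarSubalgebra.subtype (crossedSubalgebra α)

theorem val_injective : Function.Injective (val α) := Subtype.val_injective

theorem isEmbedding_val : Topology.IsEmbedding (val α) := Topology.IsEmbedding.subtypeVal

theorem crossedDiag_mem (a : A) : crossedDiag α a ∈ crossedSubalgebra α :=
  StarSubalgebra.le_topologicalClosure _
    (StarAlgebra.subset_adjoin ℂ _ (Or.inl ⟨a, rfl⟩))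

theorem crossedUnitary_mem (s : G) : crossedUnitary A s ∈ crossedSubalgebra α :=
  StarSubalgebra.le_topologicalClosure _
    (StarAlgebra.subset_adjoin ℂ _ (Or.inr ⟨s, rfl⟩))

theorem crossedDiag_mul (a b : A) : crossedDiag α (a * b) = crossedDiag α a * crossedDiag α b := by
  refine Eq.trans ?_ (Matrix.diagonal_mul_diagonal (fun g => α g⁻¹ a) (fun g => α g⁻¹ b)).symm
  exact congrArg _ (congrArg _ (funext fun g => map_mul _ _ _))

omit [Fintype G] in
theorem crossedDiag_add (a b : A) : crossedDiag α (a + b) = crossedDiag α a + crossedDiag α b := by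
  refine Eq.trans ?_ (Matrix.diagonal_add (fun g => α g⁻¹ a) (fun g => α g⁻¹ b)).symm
  exact congrArg _ (congrArg _ (funext fun g => map_add _ _ _))

omit [Fintype G] in
theorem crossedDiag_star (a : A) : crossedDiag α (star a) = star (crossedDiag α a) := by
  refine Eq.trans ?_ (Matrix.diagonal_conjTranspose (fun g => α g⁻¹ a)).symm
  exact congrArg _ (congrArg _ (funext fun g => map_star _ _))

theorem crossedDiag_algebraMap (c : ℂ) :
    crossedDiag α (algebraMap ℂ A c) = algebraMap ℂ (CStarMatrix G G A) c := by
  ext g h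
  rw [CStarMatrix.algebraMap_apply]
  change Matrix.diagonal (fun g => α g⁻¹ (algebraMap ℂ A c)) g h = _
  rw [Matrix.diagonal_apply]
  simp only [AlgHomClass.commutes]

/-- The canonical embedding of `A` in the crossed product. -/
noncomputable def embed : A →⋆ₐ[ℂ] CrossedProduct α where
  toFun a := (⟨crossedDiag α a, crossedDiag_mem α a⟩ : crossedSubalgebra α)
  map_one' := val_injective α <| by
    have := crossedDiag_algebraMap α 1
    rw [map_one, map_one] at this
    exact this
  map_mul' a b := val_injective α (crossedDiag_mul α a b)
  map_zero' := val_injective α <| by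
    have := crossedDiag_algebraMap α 0
    rw [map_zero, map_zero] at this
    exact this
  map_add' a b := val_injective α (crossedDiag_add α a b)
  commutes' c := val_injective α (crossedDiag_algebraMap α c)
  map_star' a := val_injective α (crossedDiag_star α a)

/-- The canonical unitary implementing `s`. -/
noncomputable def gen (s : G) : CrossedProduct α :=
  (⟨crossedUnitary A s, crossedUnitary_mem α s⟩ : crossedSubalgebra α)

theorem gen_mul_embed (s : G) (a : A) : gen α s * embed α a = embed α (α s a) * gen α s := by
  refine val_injective α ?_
  ext g h
  refine (Matrix.mul_diagonal (fun h => α h⁻¹ a) _ g h).trans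
    (Eq.trans ?_ (Matrix.diagonal_mul (fun g => α g⁻¹ (α s a)) _ g h).symm)
  change (if g = s * h then (1 : A) else 0) * α h⁻¹ a =
    α g⁻¹ (α s a) * (if g = s * h then (1 : A) else 0)
  split_ifs with hg
  · rw [one_mul, mul_one, hg, ← StarAlgEquiv.mul_apply, ← map_mul]
    simp
  · simp

/-- A closed `⋆`-subalgebra of the crossed product containing the generators is everything. -/
theorem induction_on {p : CrossedProduct α → Prop} (x : CrossedProduct α) (hp : IsClosed {x | p x})
    (hembed : ∀ a, p (embed α a)) (hgen : ∀ s, p (gen α s))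
    (hadd : ∀ x y, p x → p y → p (x + y)) (hmul : ∀ x y, p x → p y → p (x * y))
    (hstar : ∀ x, p x → p (star x)) : p x := by
  obtain ⟨x, hx⟩ := x
  have key : ∀ y, y ∈ StarAlgebra.adjoin ℂ
      (Set.range (crossedDiag α) ∪ Set.range (crossedUnitary A (G := G))) →
      ∃ z : CrossedProduct α, val α z = y ∧ p z := by
    intro y hy
    induction hy using StarAlgebra.adjoin_induction with
    | mem y hy =>
      rcases hy with ⟨a, rfl⟩ | ⟨s, rfl⟩
      · exact ⟨embed α a, rfl, hembed a⟩
      · exact ⟨gen α s, rfl, hgen s⟩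
    | algebraMap c =>
      exact ⟨embed α (algebraMap ℂ A c), crossedDiag_algebraMap α c, hembed _⟩
    | add y z _ _ hy hz =>
      obtain ⟨y', rfl, hy⟩ := hy
      obtain ⟨z', rfl, hz⟩ := hz
      exact ⟨y' + z', map_add _ _ _, hadd _ _ hy hz⟩
    | mul y z _ _ hy hz =>
      obtain ⟨y', rfl, hy⟩ := hy
      obtain ⟨z', rfl, hz⟩ := hz
      exact ⟨y' * z', map_mul _ _ _, hmul _ _ hy hz⟩
    | star y _ hy =>
      obtain ⟨y', rfl, hy⟩ := hy
      exact ⟨star y', map_star _ _, hstar _ hy⟩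
  have hx' : x ∈ closure (StarAlgebra.adjoin ℂ
      (Set.range (crossedDiag α) ∪ Set.range (crossedUnitary A (G := G))) :
        Set (CStarMatrix G G A)) := hx
  have h1 : (⟨x, hx⟩ : crossedSubalgebra α) ∈ closure {z : CrossedProduct α | p z} := by
    refine ((isEmbedding_val α).closure_eq_preimage_closure_image {z | p z}).symm ▸ ?_
    refine closure_mono ?_ hx'
    intro y hy
    obtain ⟨z, hz, hpz⟩ := key y hy
    exact ⟨z, hpz, hz⟩
  rwa [hp.closure_eq] at h1

theorem separableSpace [TopologicalSpace.SeparableSpace A] :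
    TopologicalSpace.SeparableSpace (CrossedProduct α) := by
  have h0 : SecondCountableTopology A := UniformSpace.secondCountable_of_separable A
  have h1 : SecondCountableTopology (CStarMatrix G G A) :=
    inferInstanceAs (SecondCountableTopology (G → G → A))
  have h2 : SecondCountableTopology (CrossedProduct α) :=
    (isEmbedding_val α).isInducing.secondCountableTopology
  infer_instance

theorem nontrivial [Nontrivial A] : Nontrivial (CrossedProduct α) := by
  refine ⟨⟨0, 1, fun h => zero_ne_one (α := CStarMatrix G G A) ?_⟩⟩
  rw [← map_zero (val α), ← map_one (val α), h]

open scoped ComplexOrder in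
/-- If the representations of `A` separate points, so do those of the crossed product. -/
theorem exists_hilbertRep_ne_zero (hA : ∀ a : A, a ≠ 0 → ∃ π : HilbertRep A, π.rep a ≠ 0)
    {b : CrossedProduct α} (hb : b ≠ 0) : ∃ π : HilbertRep (CrossedProduct α), π.rep b ≠ 0 := by
  obtain ⟨g, h, hgh⟩ : ∃ g h, val α b g h ≠ 0 := by
    by_contra! h0
    refine hb (val_injective α ?_)
    rw [map_zero]
    ext g h
    exact h0 g h
  obtain ⟨π, hπ⟩ := hA _ hgh
  obtain ⟨ξ, hξ⟩ : ∃ ξ, π.rep (val α b g h) ξ ≠ 0 := by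
    by_contra! h0
    exact hπ (ContinuousLinearMap.ext h0)
  -- A vector functional at the diagonal entry `h`. On `c* c` it adds up `‖π(c_{kh}) ξ‖²` over the
  -- column `h`, which contains the entry at `g` where `b` is detected.
  let f : CrossedProduct α →ₗ[ℂ] ℂ :=
    { toFun := fun c => ⟪ξ, π.rep (val α c h h) ξ⟫_ℂ
      map_add' := fun c d => by
        rw [map_add, CStarMatrix.add_apply, map_add, _root_.add_apply, inner_add_right]
      map_smul' := fun r c => by
        rw [map_smul, CStarMatrix.smul_apply, map_smul, _root_.smul_apply,
          inner_smul_right, RingHom.id_apply, smul_eq_mul] }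
  have hf : ∀ c : CrossedProduct α, f (star c * c) =
      ∑ k, ((‖π.rep (val α c k h) ξ‖ ^ 2 : ℝ) : ℂ) := by
    intro c
    change ⟪ξ, π.rep (val α (star c * c) h h) ξ⟫_ℂ = _
    rw [map_mul, map_star, CStarMatrix.mul_apply, map_sum, _root_.sum_apply, inner_sum]
    refine Finset.sum_congr rfl fun k _ => ?_
    rw [CStarMatrix.star_apply, map_mul, map_star]
    change ⟪ξ, star (π.rep (val α c k h)) (π.rep (val α c k h) ξ)⟫_ℂ = _
    rw [ContinuousLinearMap.star_eq_adjoint, ContinuousLinearMap.adjoint_inner_right,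
      inner_self_eq_norm_sq_to_K]
    push_cast
    rfl
  refine _root_.exists_hilbertRep_ne_zero f (fun c => ?_) (b := b) ?_
  · rw [hf]
    exact Finset.sum_nonneg fun k _ => Complex.zero_le_real.2 (sq_nonneg _)
  · rw [hf, ← Complex.ofReal_sum, Complex.ofReal_ne_zero]
    refine ne_of_gt (Finset.sum_pos' (fun k _ => sq_nonneg _) ⟨g, Finset.mem_univ _, ?_⟩)
    have := norm_pos_iff.2 hξ
    positivity

end

end CrossedProduct

/-! ### Limits of equicontinuous families -/

section Equicontinuous

variable {X Y ι : Type*} [SeminormedAddCommGroup X] [SeminormedAddCommGroup Y] {l : Filter ι}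

theorem isClosed_setOf_tendsto_zero {T : ι → X → Y} {C : ℝ}
    (hT : ∀ i x y, ‖T i x - T i y‖ ≤ C * ‖x - y‖) :
    IsClosed {x | Tendsto (fun i => T i x) l (𝓝 0)} := by
  refine isClosed_of_closure_subset fun x hx => ?_
  refine Metric.tendsto_nhds.2 fun ε hε => ?_
  obtain ⟨y, hy, hxy⟩ := Metric.mem_closure_iff.1 hx (ε / 2 / (|C| + 1)) (by positivity)
  rw [dist_eq_norm, lt_div_iff₀ (by positivity)] at hxy
  filter_upwards [Metric.tendsto_nhds.1 hy (ε / 2) (half_pos hε)] with i hi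
  rw [dist_zero_right] at hi ⊢
  have h1 := hT i x y
  have h2 : C * ‖x - y‖ ≤ ‖x - y‖ * (|C| + 1) := by
    nlinarith [le_abs_self C, norm_nonneg (x - y)]
  have h3 := norm_add_le (T i x - T i y) (T i y)
  rw [sub_add_cancel] at h3
  linarith

/-- Pointwise convergence of a uniformly Lipschitz family is uniform on compact sets. This is needed
on whole orbits of the circle. -/
theorem eventually_forall_norm_lt_of_isCompact {T : ι → X → Y} {C : ℝ}
    (hT : ∀ i x y, ‖T i x - T i y‖ ≤ C * ‖x - y‖)
    (h : ∀ x, Tendsto (fun i => T i x) l (𝓝 0)) {K : Set X} (hK : IsCompact K) {ε : ℝ}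
    (hε : 0 < ε) : ∀ᶠ i in l, ∀ x ∈ K, ‖T i x‖ < ε := by
  obtain ⟨t, -, ht, hKt⟩ := hK.finite_cover_balls (e := ε / 2 / (|C| + 1)) (by positivity)
  have h1 : ∀ᶠ i in l, ∀ y ∈ t, ‖T i y‖ < ε / 2 := (eventually_all_finite ht).2 fun y _ => by
    simpa only [dist_zero_right] using Metric.tendsto_nhds.1 (h y) (ε / 2) (half_pos hε)
  filter_upwards [h1] with i hi x hx
  obtain ⟨y, hy, hxy⟩ := Set.mem_iUnion₂.1 (hKt hx)
  rw [Metric.mem_ball, dist_eq_norm, lt_div_iff₀ (by positivity)] at hxy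
  have h1 := hT i x y
  have h2 : C * ‖x - y‖ ≤ ‖x - y‖ * (|C| + 1) := by
    nlinarith [le_abs_self C, norm_nonneg (x - y)]
  have h3 := norm_add_le (T i x - T i y) (T i y)
  rw [sub_add_cancel] at h3
  linarith [hi y hy]

end Equicontinuous

/-! ### Asymptotic commutants -/

section Commutators

variable {E ι : Type*} [CStarAlgebra E] {l : Filter ι} {u : ι → E}

theorem norm_commutator_sub_le {v : E} {C : ℝ} (hv : ‖v‖ ≤ C) (x y : E) :
    ‖(v * x - x * v) - (v * y - y * v)‖ ≤ 2 * C * ‖x - y‖ := by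
  have e : (v * x - x * v) - (v * y - y * v) = v * (x - y) - (x - y) * v := by noncomm_ring
  rw [e]
  refine (norm_sub_le _ _).trans ?_
  have h1 := norm_mul_le v (x - y)
  have h2 := norm_mul_le (x - y) v
  nlinarith [norm_nonneg (x - y)]

theorem isClosed_setOf_tendsto_commutator {C : ℝ} (hu : ∀ i, ‖u i‖ ≤ C) :
    IsClosed {x | Tendsto (fun i => u i * x - x * u i) l (𝓝 0)} :=
  isClosed_setOf_tendsto_zero fun i => norm_commutator_sub_le (hu i)

theorem tendsto_commutator_add {x y : E} (hx : Tendsto (fun i => u i * x - x * u i) l (𝓝 0))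
    (hy : Tendsto (fun i => u i * y - y * u i) l (𝓝 0)) :
    Tendsto (fun i => u i * (x + y) - (x + y) * u i) l (𝓝 0) := by
  have := hx.add hy
  rw [add_zero] at this
  exact this.congr fun i => by noncomm_ring

theorem tendsto_commutator_mul {x y : E} (hx : Tendsto (fun i => u i * x - x * u i) l (𝓝 0))
    (hy : Tendsto (fun i => u i * y - y * u i) l (𝓝 0)) :
    Tendsto (fun i => u i * (x * y) - (x * y) * u i) l (𝓝 0) := by
  have := (hx.mul_const y).add (hy.const_mul x)
  rw [zero_mul, mul_zero, add_zero] at this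
  exact this.congr fun i => by noncomm_ring

theorem tendsto_commutator_star (hu : ∀ i, u i ∈ unitary E) {x : E}
    (hx : Tendsto (fun i => u i * x - x * u i) l (𝓝 0)) :
    Tendsto (fun i => u i * star x - star x * u i) l (𝓝 0) := by
  rw [tendsto_zero_iff_norm_tendsto_zero] at hx ⊢
  refine hx.congr fun i => ?_
  rw [← norm_conj_sub_self (hu i), ← norm_conj_sub_self (hu i), ← norm_star]
  simp [mul_assoc]

end Commutators

/-! ### The action `α ⊗ id` and separability of tensor products -/

namespace MinTensor

variable {A B C D : Type u} [CStarAlgebra A] [CStarAlgebra B] [CStarAlgebra C] [CStarAlgebra D]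

theorem map_inl (f : A →⋆ₐ[ℂ] B) (g : D →⋆ₐ[ℂ] C) (a : A) :
    map f g (inl A D a) = inl B C (f a) := by
  rw [inl_apply, map_tmul, map_one, inl_apply]

theorem map_inr (f : A →⋆ₐ[ℂ] B) (g : D →⋆ₐ[ℂ] C) (d : D) :
    map f g (inr A D d) = inr B C (g d) := by
  rw [inr_apply, map_tmul, map_one, inr_apply]

theorem separableSpace [TopologicalSpace.SeparableSpace A] [TopologicalSpace.SeparableSpace D] :
    TopologicalSpace.SeparableSpace (MinTensor A D) := by
  let f : A × D → MinTensor A D := fun p => inl A D p.1 * inr A D p.2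
  have hf : Continuous f := ((continuous_starAlgHom (inl A D)).comp continuous_fst).mul
    ((continuous_starAlgHom (inr A D)).comp continuous_snd)
  have h1 : TopologicalSpace.IsSeparable
      (closure (Submodule.span ℂ (Set.range f) : Set (MinTensor A D))) :=
    (TopologicalSpace.isSeparable_range hf).span.closure
  rw [← TopologicalSpace.isSeparable_univ_iff]
  refine h1.mono fun x _ => ?_
  rw [← Submodule.topologicalClosure_coe]
  refine induction_tmul (p := fun x => x ∈ (Submodule.span ℂ (Set.range f)).topologicalClosure) x
    (Submodule.isClosed_topologicalClosure _) (zero_mem _) (fun x y => add_mem) fun a d => ?_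
  refine Submodule.le_topologicalClosure _ (Submodule.subset_span ⟨(a, d), ?_⟩)
  exact inl_mul_inr a d

variable (D) in
/-- The action `α ⊗ id` on `A ⊗ D`. -/
noncomputable def tensorAction {G : Type*} [Group G] (α : G →* (A ≃⋆ₐ[ℂ] A)) :
    G →* (MinTensor A D ≃⋆ₐ[ℂ] MinTensor A D) :=
  let f : G → (MinTensor A D →⋆ₐ[ℂ] MinTensor A D) := fun g =>
    map (α g : A →⋆ₐ[ℂ] A) (StarAlgHom.id ℂ D)
  have hf : ∀ g h, (f g).comp (f h) = f (g * h) := fun g h => hom_ext fun a d => by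
    change map _ _ (map _ _ (tmul a d)) = map _ _ (tmul a d)
    rw [map_tmul, map_tmul, map_tmul, map_mul]
    rfl
  have h1 : f 1 = StarAlgHom.id ℂ _ := hom_ext fun a d => by
    refine (map_tmul _ _ a d).trans ?_
    rw [map_one]
    rfl
  { toFun := fun g => StarAlgEquiv.ofStarAlgHom (f g) (f g⁻¹)
      (by rw [hf, inv_mul_cancel, h1]) (by rw [hf, mul_inv_cancel, h1])
    map_one' := StarAlgEquiv.ext fun x => DFunLike.congr_fun h1 x
    map_mul' := fun g h => StarAlgEquiv.ext fun x => (DFunLike.congr_fun (hf g h) x).symm }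

theorem tensorAction_tmul {G : Type*} [Group G] (α : G →* (A ≃⋆ₐ[ℂ] A)) (g : G) (a : A) (d : D) :
    tensorAction D α g (tmul a d) = tmul (α g a) d :=
  map_tmul _ _ a d

theorem tensorAction_inl {G : Type*} [Group G] (α : G →* (A ≃⋆ₐ[ℂ] A)) (g : G) (a : A) :
    tensorAction D α g (inl A D a) = inl A D (α g a) :=
  tensorAction_tmul α g a 1

theorem tensorAction_inr {G : Type*} [Group G] (α : G →* (A ≃⋆ₐ[ℂ] A)) (g : G) (d : D) :
    tensorAction D α g (inr A D d) = inr A D d := by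
  rw [inr_apply, tensorAction_tmul, map_one]

theorem continuous_tensorAction {α : Circle →* (A ≃⋆ₐ[ℂ] A)} (hα : IsContinuousAction α)
    (x : MinTensor A D) : Continuous fun ζ => tensorAction D α ζ x := by
  refine induction_tmul (p := fun x => Continuous fun ζ => tensorAction D α ζ x) x ?_ ?_ ?_ ?_
  -- Automorphisms are isometric, so approximating `x` approximates its orbit map uniformly in `ζ`.
  · refine isClosed_of_closure_subset fun x hx => ?_
    refine continuous_of_uniform_approx_of_continuous fun s hs => ?_
    obtain ⟨ε, hε, hεs⟩ := Metric.mem_uniformity_dist.1 hs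
    obtain ⟨y, hy, hxy⟩ := Metric.mem_closure_iff.1 hx ε hε
    refine ⟨_, hy, fun ζ => hεs ?_⟩
    rwa [dist_eq_norm, ← map_sub, norm_starAlgEquiv_apply, ← dist_eq_norm]
  · simpa using continuous_const
  · intro x y hx hy
    refine (hx.add hy).congr fun ζ => (map_add _ _ _).symm
  · intro a d
    refine (((continuous_starAlgHom (inl A D)).comp (hα a)).mul
      (continuous_const (y := inr A D d))).congr fun ζ => ?_
    rw [tensorAction_tmul, ← inl_mul_inr]
    rfl

/-- Asymptotic commutation with the elementary tensors. -/
theorem tendsto_commutator {ι : Type*} {l : Filter ι} {u : ι → MinTensor A D} {M : ℝ}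
    (hu : ∀ i, ‖u i‖ ≤ M)
    (hl : ∀ a, Tendsto (fun i => u i * inl A D a - inl A D a * u i) l (𝓝 0))
    (hr : ∀ d, Tendsto (fun i => u i * inr A D d - inr A D d * u i) l (𝓝 0)) (x : MinTensor A D) :
    Tendsto (fun i => u i * x - x * u i) l (𝓝 0) := by
  refine induction_tmul (p := fun x => Tendsto (fun i => u i * x - x * u i) l (𝓝 0)) x
    (isClosed_setOf_tendsto_commutator hu) (by simpa using tendsto_const_nhds)
    (fun x y => tendsto_commutator_add) fun a d => ?_
  rw [← inl_mul_inr]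
  exact tendsto_commutator_mul (hl a) (hr d)

theorem inl_mul_inr_comm (a : A) (d : D) : inl A D a * inr A D d = inr A D d * inl A D a := by
  rw [inl_mul_inr, inr_mul_inl]

end MinTensor

/-! ### Asymptotically central copies of `D` -/

section CentralSequences

variable {A D : Type u} [CStarAlgebra A] [CStarAlgebra D]

/-- A strongly self-absorbing C⋆-algebra has an asymptotically central sequence of unital
endomorphisms. -/
theorem IsStronglySelfAbsorbing.exists_central_sequence (hD : IsStronglySelfAbsorbing D) :
    ∃ χ : ℕ → (D →⋆ₐ[ℂ] D), ∀ d x,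
      Tendsto (fun k => χ k d * x - x * χ k d) atTop (𝓝 0) := by
  obtain ⟨e, w, hw⟩ := hD.exists_equiv
  -- Under `e`, `χ k d` becomes `wₖ (1 ⊗ d) wₖ*`, which commutes exactly with `wₖ (x ⊗ 1) wₖ*`, and
  -- the latter tends to `e x`.
  let χ : ℕ → (D →⋆ₐ[ℂ] D) := fun k => (e.symm : MinTensor D D →⋆ₐ[ℂ] D).comp
    (((Unitary.conjStarAlgAut ℂ (MinTensor D D) (w k) :
      MinTensor D D →⋆ₐ[ℂ] MinTensor D D)).comp (MinTensor.inr D D))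
  refine ⟨χ, fun d x => ?_⟩
  have hχ : ∀ k, e (χ k d) = (w k : MinTensor D D) * MinTensor.inr D D d * star (w k : MinTensor D D) :=
    fun k => e.apply_symm_apply _
  have hx : Tendsto (fun k => ‖e x - (w k : MinTensor D D) * MinTensor.inl D D x *
      star (w k : MinTensor D D)‖) atTop (𝓝 0) := by
    have h1 := (tendsto_const_nhds (x := e x)).sub (hw x)
    rw [tendsto_zero_iff_norm_tendsto_zero.symm]
    have h2 : e x - (e : D →⋆ₐ[ℂ] MinTensor D D) x = 0 := sub_self _
    rwa [h2] at h1
  refine squeeze_zero_norm (a := fun k => 2 * ‖d‖ * ‖e x - (w k : MinTensor D D) *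
    MinTensor.inl D D x * star (w k : MinTensor D D)‖) (fun k => ?_)
    (by simpa using hx.const_mul (2 * ‖d‖))
  have hwk := (w k).2
  have h0 : ‖e (χ k d)‖ ≤ ‖d‖ := by
    rw [hχ, norm_conj_unitary hwk]
    exact MinTensor.norm_inr_le d
  have h1 := norm_commutator_sub_le h0 (e x) ((w k : MinTensor D D) *
    MinTensor.inl D D x * star (w k : MinTensor D D))
  have h2 : e (χ k d) * ((w k : MinTensor D D) * MinTensor.inl D D x * star (w k : MinTensor D D)) -
      ((w k : MinTensor D D) * MinTensor.inl D D x * star (w k : MinTensor D D)) * e (χ k d) = 0 := by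
    have h3 : star (w k : MinTensor D D) * (w k : MinTensor D D) = 1 :=
      Unitary.star_mul_self_of_mem hwk
    have h4 : ∀ p q : MinTensor D D, ((w k : MinTensor D D) * p * star (w k : MinTensor D D)) *
        ((w k : MinTensor D D) * q * star (w k : MinTensor D D)) =
        (w k : MinTensor D D) * (p * q) * star (w k : MinTensor D D) := fun p q => by
      calc _ = (w k : MinTensor D D) * p * (star (w k : MinTensor D D) * (w k : MinTensor D D)) * q *
            star (w k : MinTensor D D) := by noncomm_ring
        _ = _ := by rw [h3]; noncomm_ring
    rw [hχ, h4, h4, MinTensor.inl_mul_inr, MinTensor.inr_mul_inl, sub_self]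
  rw [h2, sub_zero, ← map_mul, ← map_mul, ← map_sub, norm_starAlgEquiv_apply] at h1
  exact h1

/-- A `D`-absorbing algebra has an asymptotically central sequence of unital copies of `D`. -/
theorem IsAbsorbing.exists_central_sequence (hD : IsStronglySelfAbsorbing D)
    (hA : IsAbsorbing D A) :
    ∃ ψ : ℕ → (D →⋆ₐ[ℂ] A), ∀ d a,
      Tendsto (fun k => ψ k d * a - a * ψ k d) atTop (𝓝 0) := by
  obtain ⟨θ⟩ := hA
  obtain ⟨χ, hχ⟩ := hD.exists_central_sequence
  refine ⟨fun k => (θ : MinTensor A D →⋆ₐ[ℂ] A).comp ((MinTensor.inr A D).comp (χ k)),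
    fun d a => ?_⟩
  have h1 : Tendsto (fun k => MinTensor.inr A D (χ k d) * θ.symm a -
      θ.symm a * MinTensor.inr A D (χ k d)) atTop (𝓝 0) := by
    refine MinTensor.tendsto_commutator (M := ‖d‖) (fun k => (MinTensor.norm_inr_le _).trans
      (NonUnitalStarAlgHom.norm_apply_le (χ k) d)) (fun a => ?_) (fun x => ?_) _
    · simpa only [MinTensor.inl_mul_inr_comm, sub_self] using tendsto_const_nhds
    · have := ((MinTensor.continuous_starAlgHom (MinTensor.inr A D)).tendsto 0).comp (hχ d x)
      rw [map_zero] at this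
      exact this.congr fun k => by simp
  have h2 := ((MinTensor.continuous_starAlgHom (θ : MinTensor A D →⋆ₐ[ℂ] A)).tendsto 0).comp h1
  rw [map_zero] at h2
  refine h2.congr fun k => ?_
  change θ (_ - _) = θ _ * a - a * θ _
  rw [map_sub, map_mul, map_mul, θ.apply_symm_apply]
  rfl

/-- Asymptotic centrality of `ψ ⊗ id` relative to the first factor. -/
theorem MinTensor.tendsto_map_commutator {ψ : ℕ → (D →⋆ₐ[ℂ] A)}
    (hψ : ∀ d a, Tendsto (fun k => ψ k d * a - a * ψ k d) atTop (𝓝 0)) (z : MinTensor D D) (a : A) :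
    Tendsto (fun k => MinTensor.map (ψ k) (StarAlgHom.id ℂ D) z * MinTensor.inl A D a -
      MinTensor.inl A D a * MinTensor.map (ψ k) (StarAlgHom.id ℂ D) z) atTop (𝓝 0) := by
  refine induction_tmul (p := fun z => Tendsto (fun k => map (ψ k) (StarAlgHom.id ℂ D) z *
      inl A D a - inl A D a * map (ψ k) (StarAlgHom.id ℂ D) z) atTop (𝓝 0)) z ?_ ?_ ?_ ?_
  · refine isClosed_setOf_tendsto_zero (C := 2 * ‖a‖) fun k x y => ?_
    have h1 := norm_commutator_sub_le (norm_inl_le (D := D) a) (map (ψ k) (StarAlgHom.id ℂ D) x)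
      (map (ψ k) (StarAlgHom.id ℂ D) y)
    rw [← norm_neg] at h1
    refine (le_of_eq (congrArg _ ?_)).trans (h1.trans ?_)
    · abel
    · rw [← map_sub]
      exact mul_le_mul_of_nonneg_left (NonUnitalStarAlgHom.norm_apply_le _ _) (by positivity)
  · simp
  · intro x y hx hy
    have := hx.add hy
    rw [add_zero] at this
    refine this.congr fun k => ?_
    rw [map_add]
    noncomm_ring
  · intro d e
    have h1 := (((continuous_starAlgHom (inl A D)).tendsto 0).comp (hψ d a)).mul_const
      (inr A D e)
    rw [map_zero, zero_mul] at h1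
    refine h1.congr fun k => ?_
    simp only [Function.comp_apply]
    rw [map_tmul, inl_apply a, tmul_mul_tmul, tmul_mul_tmul, inl_mul_inr, mul_one, one_mul,
      ← inl_mul_inr, ← inl_mul_inr, ← inl_mul_inr, map_sub, sub_mul]
    rfl

end CentralSequences

/-! ### Index nets of finite sets and tolerances -/

section Nets

theorem tendsto_one_div_snd_add_one (X : Type*) [Preorder X] :
    Tendsto (fun i : X × ℕ => 1 / ((i.2 : ℝ) + 1)) atTop (𝓝 0) := by
  rw [← prod_atTop_atTop_eq]
  exact tendsto_one_div_add_atTop_nhds_zero_nat.comp tendsto_snd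

theorem eventually_mem_fst {X Y : Type*} [Preorder Y] [IsDirectedOrder Y] [Nonempty Y] (x : X) :
    ∀ᶠ i : Finset X × Y in atTop, x ∈ i.1 := by
  rw [← prod_atTop_atTop_eq]
  exact (((eventually_ge_atTop ({x} : Finset X)).mono fun F hF => hF (Finset.mem_singleton_self x)))
    |>.prod_inl _

end Nets

/-! ### Almost invariant unitaries in `A ⊗ D` -/

section Rokhlin

variable {A D : Type u} [CStarAlgebra A] [CStarAlgebra D]

/-- The half flip of `D`, moved into `A ⊗ D` by a nearly central copy of `D` in `A`, has all the
properties except invariance; Rokhlin averaging adds that one. The elements `1 ⊗ d` are fixed and `A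
⊗ 1` is invariant, so the averaging respects the rest. -/
theorem exists_almost_invariant_unitary_minTensor (hD : IsStronglySelfAbsorbing D)
    (hA : IsAbsorbing D A) {α : Circle →* (A ≃⋆ₐ[ℂ] A)} (hα : IsContinuousAction α)
    (hR : HasRokhlinProperty α) (n : ℕ) [NeZero n] (F : Finset A) (S : Finset D) {ε : ℝ}
    (hε : 0 < ε) : ∃ w ∈ unitary (MinTensor A D),
      (∀ c : ZMod n, ‖MinTensor.tensorAction D α (ZMod.toCircle c) w - w‖ < ε) ∧
      (∀ a ∈ F, ‖w * MinTensor.inl A D a - MinTensor.inl A D a * w‖ < ε) ∧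
      ∀ d ∈ S, ∃ a, ‖star w * MinTensor.inr A D d * w - MinTensor.inl A D a‖ < ε := by
  classical
  obtain ⟨ψ, hψ⟩ := hA.exists_central_sequence hD
  obtain ⟨w₀, hw₀, hflip⟩ := hD.inl_approxEquiv_inr S (ε / 2) (half_pos hε)
  -- Averaging involves every `β ζ v`, and `β ζ v` almost commutes with `a` exactly when `v` does
  -- with `β ζ⁻¹ a`. So `v` must almost commute with full orbits, which are compact.
  have hK : IsCompact (⋃ a ∈ F, Set.range fun ζ => α ζ a) :=
    F.finite_toSet.isCompact_biUnion fun a _ => isCompact_range (hα a)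
  have hev := eventually_forall_norm_lt_of_isCompact (l := atTop)
    (T := fun k a => MinTensor.map (ψ k) (StarAlgHom.id ℂ D) w₀ * MinTensor.inl A D a -
      MinTensor.inl A D a * MinTensor.map (ψ k) (StarAlgHom.id ℂ D) w₀) (C := 2 * ‖w₀‖)
    (fun k x y => (norm_commutator_sub_le (NonUnitalStarAlgHom.norm_apply_le _ w₀) _ _).trans (by
      rw [← map_sub]
      exact mul_le_mul_of_nonneg_left (MinTensor.norm_inl_le _) (by positivity)))
    (MinTensor.tendsto_map_commutator hψ w₀) hK (half_pos hε)
  obtain ⟨k, hk⟩ := hev.exists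
  set v := MinTensor.map (ψ k) (StarAlgHom.id ℂ D) w₀ with hv
  have hvu : v ∈ unitary (MinTensor A D) := Unitary.map_mem _ hw₀
  choose u hu huR huF using fun i : Finset A × ℕ => hR i.1 (1 / ((i.2 : ℝ) + 1)) (by positivity)
  have hUu : ∀ i, MinTensor.inl A D (u i) ∈ unitary (MinTensor A D) :=
    fun i => Unitary.map_mem _ (hu i)
  have hUc : ∀ x, Tendsto (fun i => MinTensor.inl A D (u i) * x - x * MinTensor.inl A D (u i))
      atTop (𝓝 0) := by
    refine MinTensor.tendsto_commutator (fun i => norm_unitary_le (hUu i)) (fun a => ?_) fun d => ?_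
    · refine squeeze_zero_norm' ?_ (tendsto_one_div_snd_add_one (Finset A))
      filter_upwards [eventually_mem_fst a] with i hi
      rw [← map_mul, ← map_mul, ← map_sub]
      exact (MinTensor.norm_inl_le _).trans (huF i a hi).le
    · simpa only [MinTensor.inl_mul_inr_comm, sub_self] using tendsto_const_nhds
  have hUR : ∀ ζ : Circle, Tendsto (fun i => MinTensor.tensorAction D α ζ (MinTensor.inl A D (u i)) -
      (ζ : ℂ) • MinTensor.inl A D (u i)) atTop (𝓝 0) := by
    intro ζ
    refine squeeze_zero_norm (fun i => ?_) (tendsto_one_div_snd_add_one (Finset A))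
    rw [MinTensor.tensorAction_inl, ← map_smul, ← map_sub]
    exact (MinTensor.norm_inl_le _).trans (huR i ζ).le
  have hinl : ∀ ζ, ∀ x ∈ (MinTensor.inl A D).range,
      MinTensor.tensorAction D α ζ x ∈ (MinTensor.inl A D).range := by
    rintro ζ _ ⟨a, rfl⟩
    exact ⟨α ζ a, (MinTensor.tensorAction_inl α ζ a).symm⟩
  have hinr : ∀ d ∈ S.image (MinTensor.inr A D), ∀ ζ, MinTensor.tensorAction D α ζ d = d := by
    intro d hd ζ
    obtain ⟨d, -, rfl⟩ := Finset.mem_image.1 hd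
    exact MinTensor.tensorAction_inr α ζ d
  have hvF : ∀ a ∈ F.image (MinTensor.inl A D), ∀ ζ, ‖MinTensor.tensorAction D α ζ v * a -
      a * MinTensor.tensorAction D α ζ v‖ ≤ ε / 2 := by
    intro a ha ζ
    obtain ⟨a, haF, rfl⟩ := Finset.mem_image.1 ha
    have h1 : MinTensor.inl A D a = MinTensor.tensorAction D α ζ
        (MinTensor.inl A D (α ζ⁻¹ a)) := by
      rw [MinTensor.tensorAction_inl, ← StarAlgEquiv.mul_apply, ← map_mul, mul_inv_cancel, map_one]
      rfl
    rw [h1, ← map_mul, ← map_mul, ← map_sub, norm_starAlgEquiv_apply]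
    exact (hk _ (Set.mem_biUnion haF ⟨ζ⁻¹, rfl⟩)).le
  have hvS : ∀ d ∈ S.image (MinTensor.inr A D), ∃ x ∈ (MinTensor.inl A D).range,
      ‖star v * d * v - x‖ ≤ ε / 2 := by
    intro d hd
    obtain ⟨d, hdS, rfl⟩ := Finset.mem_image.1 hd
    refine ⟨_, ⟨ψ k d, rfl⟩, ?_⟩
    have h1 := hflip d hdS
    rw [norm_conj_sub hw₀, ← norm_neg, neg_sub] at h1
    have h2 := NonUnitalStarAlgHom.norm_apply_le (MinTensor.map (ψ k) (StarAlgHom.id ℂ D))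
      (star w₀ * MinTensor.inr D D d * w₀ - MinTensor.inl D D d)
    rw [map_sub, map_mul, map_mul, map_star, MinTensor.map_inr, MinTensor.map_inl] at h2
    exact h2.trans h1.le
  obtain ⟨w, hw, hinv, hcomm, hS⟩ := exists_almost_invariant_unitary
    (MinTensor.tensorAction D α) (MinTensor.continuous_tensorAction hα) hUu hUc hUR
    (MinTensor.inl A D).range (fun i => ⟨_, rfl⟩) hinl n hvu (F.image (MinTensor.inl A D))
    (S.image (MinTensor.inr A D)) hinr (half_pos hε) hvF hvS
  rw [mul_div_cancel₀ ε two_ne_zero] at hinv hcomm hS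
  refine ⟨w, hw, hinv, fun a ha => hcomm _ (Finset.mem_image_of_mem _ ha), fun d hd => ?_⟩
  obtain ⟨_, ⟨a, rfl⟩, ha⟩ := hS _ (Finset.mem_image_of_mem _ hd)
  exact ⟨a, ha⟩

end Rokhlin

/-! ### Passage to the crossed product -/

section Transfer

variable {A D : Type u} [CStarAlgebra A] [CStarAlgebra D]
  {G : Type} [Group G] [Fintype G] [DecidableEq G]

/-- Covariance, checked on elementary tensors: the implementing unitaries of `B ⊗ 1` act on the
image of `A ⊗ D` by `α ⊗ id`, so invariance of an element means commutation with them. -/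
theorem CrossedProduct.inl_gen_mul_map_embed (α : G →* (A ≃⋆ₐ[ℂ] A)) (s : G) (x : MinTensor A D) :
    MinTensor.inl _ D (gen α s) * MinTensor.map (embed α) (StarAlgHom.id ℂ D) x =
      MinTensor.map (embed α) (StarAlgHom.id ℂ D) (MinTensor.tensorAction D α s x) *
        MinTensor.inl _ D (gen α s) := by
  refine MinTensor.induction_tmul (p := fun x => MinTensor.inl _ D (gen α s) *
      MinTensor.map (embed α) (StarAlgHom.id ℂ D) x =
      MinTensor.map (embed α) (StarAlgHom.id ℂ D) (MinTensor.tensorAction D α s x) *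
        MinTensor.inl _ D (gen α s)) x ?_ (by simp) ?_ fun a d => ?_
  · have h1 := MinTensor.continuous_starAlgHom (MinTensor.map (embed α) (StarAlgHom.id ℂ D))
    have h2 : Continuous (MinTensor.tensorAction D α s) := MinTensor.continuous_starAlgHom
      (MinTensor.tensorAction D α s : MinTensor A D →⋆ₐ[ℂ] MinTensor A D)
    exact isClosed_eq (continuous_const.mul h1) ((h1.comp h2).mul continuous_const)
  · intro x y hx hy
    rw [map_add, map_add, map_add, mul_add, add_mul, hx, hy]
  · rw [MinTensor.tensorAction_tmul, MinTensor.map_tmul, MinTensor.map_tmul, MinTensor.inl_apply,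
      MinTensor.tmul_mul_tmul, MinTensor.tmul_mul_tmul, gen_mul_embed, one_mul, mul_one]

/-- Conjugation by `V` almost fixes `a ⊗ 1` and takes `1 ⊗ d` near some `b ⊗ 1`, hence takes `a ⊗ d`
near `ab ⊗ 1`; sums and closure do the rest. -/
theorem MinTensor.eventually_exists_conj_sub_inl_lt {B : Type u} [CStarAlgebra B]
    {ι : Type*} {l : Filter ι} {V : ι → MinTensor B D} (hV : ∀ i, V i ∈ unitary (MinTensor B D))
    (hl : ∀ b, Tendsto (fun i => V i * inl B D b - inl B D b * V i) l (𝓝 0))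
    (hr : ∀ d, ∀ ε > 0, ∀ᶠ i in l, ∃ b, ‖star (V i) * inr B D d * V i - inl B D b‖ < ε)
    (c : MinTensor B D) {ε : ℝ} (hε : 0 < ε) :
    ∀ᶠ i in l, ∃ b, ‖star (V i) * c * V i - inl B D b‖ < ε := by
  have hconj : ∀ i x, ‖star (V i) * x * V i‖ = ‖x‖ := fun i x => by
    have := norm_conj_unitary (Unitary.star_mem (hV i)) x
    rwa [star_star] at this
  refine induction_tmul (p := fun c => ∀ ε : ℝ, 0 < ε →
    ∀ᶠ i in l, ∃ b, ‖star (V i) * c * V i - inl B D b‖ < ε) c ?_ ?_ ?_ ?_ ε hε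
  · refine isClosed_of_closure_subset fun x hx ε hε => ?_
    obtain ⟨y, hy, hxy⟩ := Metric.mem_closure_iff.1 hx (ε / 2) (half_pos hε)
    filter_upwards [hy (ε / 2) (half_pos hε)] with i ⟨b, hb⟩
    refine ⟨b, ?_⟩
    have h1 := hconj i (x - y)
    rw [dist_eq_norm] at hxy
    have e : star (V i) * x * V i - inl B D b =
        star (V i) * (x - y) * V i + (star (V i) * y * V i - inl B D b) := by noncomm_ring
    rw [e]
    linarith [norm_add_le (star (V i) * (x - y) * V i) (star (V i) * y * V i - inl B D b)]
  · exact fun ε hε => Eventually.of_forall fun i => ⟨0, by simpa using hε⟩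
  · intro x y hx hy ε hε
    filter_upwards [hx (ε / 2) (half_pos hε), hy (ε / 2) (half_pos hε)] with i ⟨b, hb⟩ ⟨b', hb'⟩
    refine ⟨b + b', ?_⟩
    have e : star (V i) * (x + y) * V i - inl B D (b + b') =
        (star (V i) * x * V i - inl B D b) + (star (V i) * y * V i - inl B D b') := by
      rw [map_add]; noncomm_ring
    rw [e]
    linarith [norm_add_le (star (V i) * x * V i - inl B D b) (star (V i) * y * V i - inl B D b')]
  · intro a d ε hε
    have h1 := Metric.tendsto_nhds.1 (hl a) (ε / 2 / (‖d‖ + 1)) (by positivity)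
    filter_upwards [hr d (ε / 2 / (‖a‖ + 1)) (by positivity), h1] with i ⟨b, hb⟩ hi
    refine ⟨a * b, ?_⟩
    rw [dist_zero_right, ← norm_neg, neg_sub] at hi
    have h2 : ‖star (V i) * inl B D a * V i - inl B D a‖ < ε / 2 / (‖d‖ + 1) := by
      have e : star (V i) * inl B D a * V i - inl B D a =
          star (V i) * (inl B D a * V i - V i * inl B D a) := by
        have h3 : star (V i) * V i = 1 := Unitary.star_mul_self_of_mem (hV i)
        rw [mul_sub, ← mul_assoc, ← mul_assoc, h3, one_mul]
      rw [e, norm_unitary_mul (Unitary.star_mem (hV i))]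
      exact hi
    have e : star (V i) * tmul a d * V i - inl B D (a * b) =
        (star (V i) * inl B D a * V i - inl B D a) * (star (V i) * inr B D d * V i) +
          inl B D a * (star (V i) * inr B D d * V i - inl B D b) := by
      have h3 : V i * star (V i) = 1 := Unitary.mul_star_self_of_mem (hV i)
      calc _ = star (V i) * inl B D a * (V i * star (V i)) * inr B D d * V i -
            inl B D a * inl B D b := by
            rw [h3, mul_one, map_mul, ← inl_mul_inr]; noncomm_ring
        _ = _ := by noncomm_ring
    rw [e]
    rw [lt_div_iff₀ (by positivity)] at hb h2
    have h4 := norm_mul_le (star (V i) * inl B D a * V i - inl B D a)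
      (star (V i) * inr B D d * V i)
    have h5 := norm_mul_le (inl B D a) (star (V i) * inr B D d * V i - inl B D b)
    rw [hconj] at h4
    have h6 := norm_inl_le (D := D) a
    have h7 := norm_inr_le (A := B) d
    have h8 := norm_add_le ((star (V i) * inl B D a * V i - inl B D a) *
      (star (V i) * inr B D d * V i)) (inl B D a * (star (V i) * inr B D d * V i - inl B D b))
    nlinarith [norm_nonneg (star (V i) * inl B D a * V i - inl B D a),
      norm_nonneg (star (V i) * inr B D d * V i - inl B D b)]

/-- The representations of a `D`-absorbing algebra separate its points. -/
theorem IsAbsorbing.exists_hilbertRep_ne_zero (hA : IsAbsorbing D A) {a : A} (ha : a ≠ 0) :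
    ∃ π : HilbertRep A, π.rep a ≠ 0 := by
  obtain ⟨θ⟩ := hA
  have h1 : θ.symm a ≠ 0 := fun h => ha (by rw [← θ.apply_symm_apply a, h, map_zero])
  obtain ⟨π, ρ, h⟩ := MinTensor.exists_tensorRep_ne_zero h1
  exact ⟨(MinTensor.tensorRep π ρ).comp (θ.symm : A →⋆ₐ[ℂ] MinTensor A D), h⟩

/-- Enough on generators: `hcomm` handles the copy of `A`, and `hinv` with covariance handles the
implementing unitaries. -/
theorem CrossedProduct.tendsto_commutator_map_embed (γ : G →* (A ≃⋆ₐ[ℂ] A)) {ι : Type*}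
    {l : Filter ι} {W : ι → MinTensor A D} (hW : ∀ i, W i ∈ unitary (MinTensor A D))
    (hinv : ∀ s, Tendsto (fun i => MinTensor.tensorAction D γ s (W i) - W i) l (𝓝 0))
    (hcomm : ∀ a, Tendsto (fun i => W i * MinTensor.inl A D a - MinTensor.inl A D a * W i) l (𝓝 0))
    (b : CrossedProduct γ) :
    Tendsto (fun i => MinTensor.map (embed γ) (StarAlgHom.id ℂ D) (W i) * MinTensor.inl _ D b -
      MinTensor.inl _ D b * MinTensor.map (embed γ) (StarAlgHom.id ℂ D) (W i)) l (𝓝 0) := by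
  set j := MinTensor.map (embed γ) (StarAlgHom.id ℂ D) with hj
  have hj0 : Tendsto j (𝓝 0) (𝓝 0) := by
    have := (MinTensor.continuous_starAlgHom j).tendsto 0
    rwa [map_zero] at this
  have hV : ∀ i, j (W i) ∈ unitary (MinTensor (CrossedProduct γ) D) :=
    fun i => Unitary.map_mem j (hW i)
  refine CrossedProduct.induction_on γ (p := fun b => Tendsto (fun i =>
    j (W i) * MinTensor.inl _ D b - MinTensor.inl _ D b * j (W i)) l (𝓝 0)) b ?_ ?_ ?_ ?_ ?_ ?_
  · exact (isClosed_setOf_tendsto_commutator fun i => norm_unitary_le (hV i)).preimage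
      (MinTensor.continuous_starAlgHom (MinTensor.inl _ D))
  · intro a
    have h1 : MinTensor.inl _ D (embed γ a) = j (MinTensor.inl A D a) :=
      (MinTensor.map_inl _ _ a).symm
    refine (hj0.comp (hcomm a)).congr fun i => ?_
    rw [h1, Function.comp_apply, map_sub j, map_mul j, map_mul j]
  · intro s
    have h1 := ((hj0.comp (hinv s)).neg).mul_const (MinTensor.inl _ D (gen γ s))
    rw [neg_zero, zero_mul] at h1
    refine h1.congr fun i => ?_
    rw [hj, CrossedProduct.inl_gen_mul_map_embed, ← hj, Function.comp_apply, map_sub j, neg_sub,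
      sub_mul]
  · intro x y hx hy
    rw [map_add (MinTensor.inl _ D)]
    exact tendsto_commutator_add hx hy
  · intro x y hx hy
    rw [map_mul (MinTensor.inl _ D)]
    exact tendsto_commutator_mul hx hy
  · intro x hx
    rw [map_star (MinTensor.inl _ D)]
    exact tendsto_commutator_star hV hx

/-- Almost invariant, asymptotically central unitaries of `A ⊗ D` which conjugate `1 ⊗ D` close to
`A ⊗ 1` make the crossed product absorb `D`. -/
theorem CrossedProduct.isAbsorbing [TopologicalSpace.SeparableSpace A]
    [TopologicalSpace.SeparableSpace D] [Nontrivial A]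
    (hA : IsAbsorbing D A) (γ : G →* (A ≃⋆ₐ[ℂ] A)) {ι : Type*}
    {l : Filter ι} [l.NeBot] {W : ι → MinTensor A D} (hW : ∀ i, W i ∈ unitary (MinTensor A D))
    (hinv : ∀ s, Tendsto (fun i => MinTensor.tensorAction D γ s (W i) - W i) l (𝓝 0))
    (hcomm : ∀ a, Tendsto (fun i => W i * MinTensor.inl A D a - MinTensor.inl A D a * W i) l (𝓝 0))
    (hD : ∀ d, ∀ ε > 0, ∀ᶠ i in l, ∃ a,
      ‖star (W i) * MinTensor.inr A D d * W i - MinTensor.inl A D a‖ < ε) :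
    IsAbsorbing D (CrossedProduct γ) := by
  have := CrossedProduct.separableSpace γ
  have : TopologicalSpace.SeparableSpace (MinTensor (CrossedProduct γ) D) :=
    MinTensor.separableSpace
  have : Nontrivial (MinTensor A D) := by
    obtain ⟨θ⟩ := hA
    exact θ.toEquiv.nontrivial
  -- Separating representations pass from `A ⊗ D` to `A` by absorption, then to the crossed product
  -- by GNS.
  have hinj : Function.Injective (MinTensor.inl (CrossedProduct γ) D) :=
    MinTensor.inl_injective
      (fun b hb => CrossedProduct.exists_hilbertRep_ne_zero γ
        (fun a ha => hA.exists_hilbertRep_ne_zero ha) hb)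
      (MinTensor.exists_rep_space_ne_zero (A := A))
  have hl := CrossedProduct.tendsto_commutator_map_embed γ hW hinv hcomm
  set j := MinTensor.map (embed γ) (StarAlgHom.id ℂ D) with hj
  have hV : ∀ i, j (W i) ∈ unitary (MinTensor (CrossedProduct γ) D) :=
    fun i => Unitary.map_mem j (hW i)
  have hr : ∀ d, ∀ ε > 0, ∀ᶠ i in l, ∃ b,
      ‖star (j (W i)) * MinTensor.inr _ D d * j (W i) - MinTensor.inl _ D b‖ < ε := by
    intro d ε hε
    filter_upwards [hD d ε hε] with i ⟨a, ha⟩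
    refine ⟨embed γ a, ?_⟩
    have h1 : j (MinTensor.inl A D a) = MinTensor.inl _ D (embed γ a) := MinTensor.map_inl _ _ a
    have h2 : j (MinTensor.inr A D d) = MinTensor.inr _ D d := MinTensor.map_inr _ _ d
    have h3 := NonUnitalStarAlgHom.norm_apply_le j
      (star (W i) * MinTensor.inr A D d * W i - MinTensor.inl A D a)
    rw [map_sub j, map_mul j, map_mul j, map_star j, h1, h2] at h3
    exact h3.trans_lt ha
  refine nonempty_starAlgEquiv_of_intertwining (MinTensor.inl _ D) hinj fun F S ε hε => ?_
  have h1 : ∀ᶠ i in l, ∀ b ∈ F,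
      ‖j (W i) * MinTensor.inl _ D b - MinTensor.inl _ D b * j (W i)‖ < ε :=
    F.eventually_all.2 fun b _ => by
      simpa only [dist_zero_right] using Metric.tendsto_nhds.1 (hl b) ε hε
  have h2 : ∀ᶠ i in l, ∀ c ∈ S, ∃ b, ‖star (j (W i)) * c * j (W i) - MinTensor.inl _ D b‖ < ε :=
    S.eventually_all.2 fun c _ => MinTensor.eventually_exists_conj_sub_inl_lt hV hl hr c hε
  obtain ⟨i, hi1, hi2⟩ := (h1.and h2).exists
  exact ⟨j (W i), hV i, hi1, hi2⟩

theorem CrossedProduct.isAbsorbing_restrictCyclic [Nontrivial A] [TopologicalSpace.SeparableSpace A]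
    (hD : IsStronglySelfAbsorbing D) (hA : IsAbsorbing D A) {α : Circle →* (A ≃⋆ₐ[ℂ] A)}
    (hα : IsContinuousAction α) (hR : HasRokhlinProperty α) (n : ℕ) [NeZero n] :
    IsAbsorbing D (CrossedProduct (restrictCyclic α n)) := by
  classical
  have := hD.separable
  -- The net is indexed by the finite subsets of `A` and `D` to be handled and by the tolerance.
  choose W hW hWinv hWcomm hWS using fun i : Finset A × (Finset D × ℕ) =>
    exists_almost_invariant_unitary_minTensor hD hA hα hR n i.1 i.2.1
      (ε := 1 / ((i.2.2 : ℝ) + 1)) (by positivity)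
  have hlim : Tendsto (fun i : Finset A × (Finset D × ℕ) => 1 / ((i.2.2 : ℝ) + 1)) atTop (𝓝 0) := by
    rw [← prod_atTop_atTop_eq]
    exact (tendsto_one_div_snd_add_one (Finset D)).comp tendsto_snd
  have hmem : ∀ d, ∀ᶠ i : Finset A × (Finset D × ℕ) in atTop, d ∈ i.2.1 := fun d => by
    rw [← prod_atTop_atTop_eq]
    exact (eventually_mem_fst d).prod_inr _
  refine CrossedProduct.isAbsorbing hA _ hW (l := atTop) (fun s => ?_) (fun a => ?_) fun d ε hε => ?_
  · exact squeeze_zero_norm (fun i => (hWinv i (Multiplicative.toAdd s)).le) hlim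
  · refine squeeze_zero_norm' ?_ hlim
    filter_upwards [eventually_mem_fst a] with i hi
    exact (hWcomm i a hi).le
  · filter_upwards [hmem d, hlim.eventually_lt_const hε] with i hd hi
    obtain ⟨a, ha⟩ := hWS i d hd
    exact ⟨a, ha.trans hi⟩

end Transfer

theorem mainTheorem10 {D A : Type u} [CStarAlgebra D] [CStarAlgebra A] [Nontrivial A]
    [TopologicalSpace.SeparableSpace A]
    (hD : IsStronglySelfAbsorbing D) (hA : IsAbsorbing D A)
    (α : Circle →* (A ≃⋆ₐ[ℂ] A)) (hα : IsContinuousAction α) (hR : HasRokhlinProperty α)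
    (n : ℕ) [NeZero n] :
    Nontrivial (CrossedProduct (restrictCyclic α n)) ∧
      TopologicalSpace.SeparableSpace (CrossedProduct (restrictCyclic α n)) ∧
      IsAbsorbing D (CrossedProduct (restrictCyclic α n)) :=
  ⟨CrossedProduct.nontrivial _, CrossedProduct.separableSpace _,
    CrossedProduct.isAbsorbing_restrictCyclic hD hA hα hR n⟩
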